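/- Let $V$ be a euclidean vector space of finite dimension $m\ge 2$ with scalar product $g$, and let $R:V\times V\times V\to V$, $(X,Y,Z)\mapsto R_{X,Y}Z$, be an algebraic curvature tensor: a trilinear map with $R_{X,Y}Z=-R_{Y,X}Z$, with $g(R_{X,Y}Z,W)=-g(Z,R_{X,Y}W)$, and with $R_{X,Y}Z+R_{Y,Z}X+R_{Z,X}Y=0$. Write $R_{\cdot,X}X$ for the endomorphism $Y\mapsto R_{Y,X}X$ of $V$, $\Delta_g=-\sum_\mu\partial^2/\partial x_\mu^2$ for the positive Laplace operator in orthonormal coordinates, $[x]_s=x(x-1)\cdots(x-s+1)$ for the falling factorial, and $\kappa(R)=\sum_{\mu,\nu}g(R_{X_\mu,X_\nu}X_\nu,X_\mu)$ for the scalar curvature, where $X_1,\dots,X_m$ is an orthonormal basis. Let $\mathrm{St}_2V=\{(X,Y)\in V\times V : g(X,X)=g(Y,Y)=1,\ g(X,Y)=0\}$, with the volume $\mathrm{vol}_{\mathrm{FS}}$ of the Riemannian metric $$g^{\mathrm{FS}}_{(X,Y)}\big((\dot X_1,\dot Y_1),(\dot X_2,\dot Y_2)\big)=g(\dot X_1,\dot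 X_2)+g(\dot Y_1,\dot Y_2)-g(Y,\dot X_1)\,g(Y,\dot X_2),$$ and let $\mathrm{Gr}_2V$ be the Grassmannian of $2$-dimensional linear subspaces of $V$, with the volume $\mathrm{vol}_{\mathrm{FS}}$ of the Riemannian metric induced from the scalar product $\frac12\mathrm{tr}_V(FF')$ on symmetric endomorphisms by the embedding $\Sigma\mapsto\mathrm{pr}_\Sigma$ (orthogonal projection). Let $\mathrm{sec}_R(X,Y)=g(R_{Y,X}X,Y)$ on $\mathrm{St}_2V$ and $$\mathrm{sec}_R(\mathrm{span}\{X,Y\})=\frac{g(R_{Y,X}X,Y)}{g(X,X)g(Y,Y)-g(X,Y)^2}$$ on $\mathrm{Gr}_2V$. Then: 1. For all $X$ in a neighbourhood of $0\in V$ the series $\sum_{r>0}\frac1{2r}\mathrm{tr}_V\big((R_{\cdot,X}X)^r\big)$ converges absolutely, $\det_V(\mathrm{id}-R_{\cdot,X}X)>0$, and $$\exp\Big(\sum_{r>0}\frac1{2r}\,\mathrm{tr}_V\big((R_{\cdot,X}X)^r\big)\Big)=\mathrm{det}_V(\mathrm{id}-R_{\cdot,X}X)^{-1/2};$$ this function of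 $X$ is real analytic at $0$. 2. The total volume of $\mathrm{St}_2V$ is positive and finite, and for every integer $k\ge 0$ the function $\mathrm{sec}_R^k$ is integrable on $\mathrm{St}_2V$ with $$\frac1{\mathrm{Vol}\,\mathrm{St}_2V}\int_{\mathrm{St}_2V}g(R_{Y,X}X,Y)^k\,\mathrm{vol}_{\mathrm{FS}}(X,Y)=\frac{(-\Delta_g)^k}{[m+2k-2]_{2k}}\bigg|_0\bigg(X\mapsto\exp\Big(\sum_{r>0}\frac1{2r}\,\mathrm{tr}_V\big((R_{\cdot,X}X)^r\big)\Big)\bigg).$$ 3. In particular $$\frac{\kappa(R)}{m(m-1)}=\frac1{\mathrm{Vol}\,\mathrm{St}_2V}\int_{\mathrm{St}_2V}g(R_{Y,X}X,Y)\,\mathrm{vol}_{\mathrm{FS}}(X,Y).$$ 4. The function $\mathrm{sec}_R$ is constant along the fibers of $\mathrm{St}_2V\to\mathrm{Gr}_2V$, $(X,Y)\mapsto\mathrm{span}\{X,Y\}$: one has $\mathrm{sec}_R(\mathrm{span}\{X,Y\})=\mathrm{sec}_R(X,Y)$. Moreover statements 2 and 3 hold with $\mathrm{St}_2V$ replaced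 by $\mathrm{Gr}_2V$, i.e. for the averages of $\mathrm{sec}_R^k$ and $\mathrm{sec}_R$ over $\mathrm{Gr}_2V$. -/

import Mathlib

open MeasureTheory Filter Topology Module
open scoped ContDiff

/-- An algebraic curvature tensor on a euclidean vector space `V`: a trilinear map
`(X, Y, Z) ↦ R_{X,Y} Z`, alternating in `X, Y`, with `R_{X,Y}` skew-symmetric with respect to the
scalar product, satisfying the first Bianchi identity. -/
structure AlgebraicCurvatureTensor (V : Type*) [NormedAddCommGroup V] [InnerProductSpace ℝ V] where
  toFun : V →ₗ[ℝ] V →ₗ[ℝ] V →ₗ[ℝ] V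
  alternating : ∀ X Y Z : V, toFun X Y Z = -toFun Y X Z
  skew : ∀ X Y Z W : V, inner ℝ (toFun X Y Z) W = -inner ℝ Z (toFun X Y W)
  bianchi : ∀ X Y Z : V, toFun X Y Z + toFun Y Z X + toFun Z X Y = 0

namespace AlgebraicCurvatureTensor

variable {V : Type*} [NormedAddCommGroup V] [InnerProductSpace ℝ V]

/-- The Jacobi operator `R_{·,X} X : Y ↦ R_{Y,X} X`. -/
def jacobi (R : AlgebraicCurvatureTensor V) (X : V) : Module.End ℝ V :=
  (R.toFun.flip X).flip X

/-- The scalar curvature `κ(R) = ∑_{μ,ν} g(R_{X_μ,X_ν} X_ν, X_μ)`, the trace of the Ricci tensor,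
computed in an orthonormal basis. -/
noncomputable def scalarCurvature [FiniteDimensional ℝ V] (R : AlgebraicCurvatureTensor V) : ℝ :=
  ∑ μ : Fin (finrank ℝ V), ∑ ν : Fin (finrank ℝ V),
    inner ℝ (R.toFun (stdOrthonormalBasis ℝ V μ) (stdOrthonormalBasis ℝ V ν)
      (stdOrthonormalBasis ℝ V ν)) (stdOrthonormalBasis ℝ V μ)

/-- The function `X ↦ exp (∑_{r>0} 1/(2r) tr_V (R_{·,X} X)^r)`. The series converges absolutely for
`X` near `0`, so this determines a germ at `0`; only this germ is ever used. -/
noncomputable def momentSeries (R : AlgebraicCurvatureTensor V) (X : V) : ℝ :=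
  Real.exp (∑' r : ℕ, 1 / (2 * ((r : ℝ) + 1)) * LinearMap.trace ℝ V (R.jacobi X ^ (r + 1)))

/-- The expression `g(R_{Y,X} X, Y) / (g(X,X) g(Y,Y) - g(X,Y)^2)`. -/
noncomputable def sectionalQuotient (R : AlgebraicCurvatureTensor V) (X Y : V) : ℝ :=
  inner ℝ (R.toFun Y X X) Y / (inner ℝ X X * inner ℝ Y Y - inner ℝ X Y ^ 2)

/-- The sectional quotient is invariant under a change of basis of the plane. -/
theorem sectionalQuotient_eq_of_span_eq (R : AlgebraicCurvatureTensor V) {X Y X' Y' : V}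
    (hli : LinearIndependent ℝ ![X', Y'])
    (hspan : Submodule.span ℝ {X', Y'} = Submodule.span ℝ {X, Y}) :
    R.sectionalQuotient X' Y' = R.sectionalQuotient X Y := by
  have hX : X' ∈ Submodule.span ℝ {X, Y} := hspan ▸ Submodule.subset_span (by simp)
  have hY : Y' ∈ Submodule.span ℝ {X, Y} := hspan ▸ Submodule.subset_span (by simp)
  obtain ⟨a, b, rfl⟩ := Submodule.mem_span_pair.1 hX
  obtain ⟨c, d, rfl⟩ := Submodule.mem_span_pair.1 hY
  rw [LinearIndependent.pair_iff] at hli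
  have hD : a * d - b * c ≠ 0 := by
    intro h0
    have h1 := hli d (-b) (by
      have : d • (a • X + b • Y) + (-b) • (c • X + d • Y) = (a * d - b * c) • X := by module
      rw [this, h0, zero_smul])
    have h2 := hli (-c) a (by
      have : (-c) • (a • X + b • Y) + a • (c • X + d • Y) = (a * d - b * c) • Y := by module
      rw [this, h0, zero_smul])
    have ha : a = 0 := h2.2
    have hb : b = 0 := by simpa using h1.2
    have h3 := hli 1 0 (by simp [ha, hb])
    exact one_ne_zero h3.1
  have alt : ∀ A Z : V, R.toFun A A Z = 0 := fun A Z => by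
    have h := R.alternating A A Z
    have h2 : (2 : ℝ) • R.toFun A A Z = 0 := by rw [two_smul]; nth_rewrite 1 [h]; simp
    exact (smul_eq_zero.1 h2).resolve_left two_ne_zero
  have skw : ∀ A B Z : V, inner ℝ (R.toFun A B Z) Z = 0 := fun A B Z => by
    have h := R.skew A B Z Z
    rw [real_inner_comm] at h
    have h' : inner ℝ Z (R.toFun A B Z) = (0 : ℝ) := by linarith
    rw [real_inner_comm]; exact h'
  have hnum : inner ℝ (R.toFun (c • X + d • Y) (a • X + b • Y) (a • X + b • Y)) (c • X + d • Y)
      = (a * d - b * c) ^ 2 * inner ℝ (R.toFun Y X X) Y := by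
    have e1 : R.toFun X Y = -R.toFun Y X := by
      ext Z; simpa using R.alternating X Y Z
    have e2 : inner ℝ (R.toFun Y X Y) X = -inner ℝ (R.toFun Y X X) Y := by
      rw [R.skew Y X Y X, real_inner_comm]
    have e3 : ∀ A : V, R.toFun A A = 0 := fun A => by ext Z; simpa using alt A Z
    simp only [map_add, map_smul, LinearMap.add_apply, LinearMap.smul_apply, e1, e3,
      inner_add_left, inner_add_right, real_inner_smul_left, real_inner_smul_right, smul_zero,
      LinearMap.neg_apply, inner_neg_left, skw, e2, smul_neg, zero_add, add_zero, mul_zero]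
    ring
  have hden : (inner ℝ (a • X + b • Y) (a • X + b • Y) * inner ℝ (c • X + d • Y) (c • X + d • Y)
      - inner ℝ (a • X + b • Y) (c • X + d • Y) ^ 2 : ℝ)
      = (a * d - b * c) ^ 2 * (inner ℝ X X * inner ℝ Y Y - inner ℝ X Y ^ 2) := by
    simp only [inner_add_left, inner_add_right, real_inner_smul_left, real_inner_smul_right,
      real_inner_comm X Y]
    ring
  unfold sectionalQuotient
  rw [hnum, hden, mul_div_mul_left _ _ (pow_ne_zero 2 hD)]

end AlgebraicCurvatureTensor

/-- The positive Laplace operator `Δ_g = - ∑_μ ∂²/∂x_μ²`. -/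
noncomputable def posLaplacian {V : Type*} [NormedAddCommGroup V] [InnerProductSpace ℝ V]
    [FiniteDimensional ℝ V] (f : V → ℝ) : V → ℝ :=
  fun X => -(Laplacian.laplacian f : V → ℝ) X

/-- `(-Δ_g)^k` applied to `f` and evaluated at `0`. -/
noncomputable def negLaplacianPowAtZero {V : Type*} [NormedAddCommGroup V] [InnerProductSpace ℝ V]
    [FiniteDimensional ℝ V] (k : ℕ) (f : V → ℝ) : ℝ :=
  ((fun h : V → ℝ => -posLaplacian h)^[k] f) 0

/-- The falling factorial `[x]_s = x (x - 1) ⋯ (x - s + 1)`. -/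
noncomputable def fallingFactorial (x : ℝ) (s : ℕ) : ℝ :=
  ∏ i ∈ Finset.range s, (x - i)

/-- A smooth local parametrization, by an open subset `source` of `ℝ^d`, of a `d`-dimensional
submanifold `X` of the normed space `E`, given by its inclusion `ι : X → E`: an immersion which is a
homeomorphism onto an open subset of `X`. -/
structure LocalParametrization {X E : Type*} [TopologicalSpace X] [NormedAddCommGroup E]
    [NormedSpace ℝ E] (d : ℕ) (ι : X → E) where
  source : Set (EuclideanSpace ℝ (Fin d))
  toFun : EuclideanSpace ℝ (Fin d) → X
  isOpen_source : IsOpen source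
  isOpenEmbedding : IsOpenEmbedding (source.domRestrict toFun)
  contDiffOn : ContDiffOn ℝ ∞ (ι ∘ toFun) source
  immersion : ∀ u ∈ source, Function.Injective (fderiv ℝ (ι ∘ toFun) u)

namespace LocalParametrization

variable {X E : Type*} [TopologicalSpace X] [NormedAddCommGroup E] [NormedSpace ℝ E] {d : ℕ}
  {ι : X → E}

/-- The Gram matrix `g_{ij} = g(∂φ/∂u_i, ∂φ/∂u_j)` of a metric in a local parametrization `φ`.
The metric at `x` is given as a function `g x` of two tangent vectors. -/
noncomputable def gram (φ : LocalParametrization d ι) (g : X → E → E → ℝ)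
    (u : EuclideanSpace ℝ (Fin d)) : Matrix (Fin d) (Fin d) ℝ :=
  Matrix.of fun i j => g (φ.toFun u)
    (fderiv ℝ (ι ∘ φ.toFun) u (EuclideanSpace.single i 1))
    (fderiv ℝ (ι ∘ φ.toFun) u (EuclideanSpace.single j 1))

/-- The volume `√(det g_{ij}) du_1 ⋯ du_d` on the image of a local parametrization, as a measure on
`X` (zero outside of the image). -/
noncomputable def localVolume [MeasurableSpace X] (φ : LocalParametrization d ι)
    (g : X → E → E → ℝ) : Measure X :=
  ((volume.restrict φ.source).withDensity
    (fun u => ENNReal.ofReal (Real.sqrt (φ.gram g u).det))).map φ.toFun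

end LocalParametrization

/-- The Riemannian volume measure of a `d`-dimensional submanifold `ι : X → E` with Riemannian
metric `g`: the smallest measure dominating the volume `√(det g_{ij}) du` of every local
parametrization. Since any two of these agree where the images overlap, it restricts to
`√(det g_{ij}) du` on the image of every local parametrization. -/
noncomputable def riemannianVolume {X E : Type*} [TopologicalSpace X] [MeasurableSpace X]
    [NormedAddCommGroup E] [NormedSpace ℝ E] (d : ℕ) (ι : X → E) (g : X → E → E → ℝ) :
    Measure X :=
  ⨆ φ : LocalParametrization d ι, φ.localVolume g

section Manifolds

variable (V : Type*) [NormedAddCommGroup V] [InnerProductSpace ℝ V]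

/-- The Stiefel manifold `St_2 V` of orthonormal `2`-frames `(X, Y)` in `V`. -/
structure Stiefel2 where
  X : V
  Y : V
  inner_X_X : inner ℝ X X = (1 : ℝ)
  inner_Y_Y : inner ℝ Y Y = (1 : ℝ)
  inner_X_Y : inner ℝ X Y = (0 : ℝ)

/-- The Grassmannian `Gr_2 V` of `2`-dimensional linear subspaces of `V`. -/
structure Grassmannian2 where
  plane : Submodule ℝ V
  finrank_eq : finrank ℝ plane = 2

variable {V}

namespace Stiefel2

/-- The inclusion `St_2 V ⊂ V × V`. -/
def incl (p : Stiefel2 V) : V × V := (p.X, p.Y)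

instance : TopologicalSpace (Stiefel2 V) := TopologicalSpace.induced incl inferInstance

instance : MeasurableSpace (Stiefel2 V) := borel _

instance : BorelSpace (Stiefel2 V) := ⟨rfl⟩

/-- The Fubini–Study metric
`g(Ẋ₁, Ẋ₂) + g(Ẏ₁, Ẏ₂) - g(Y, Ẋ₁) g(Y, Ẋ₂)` on the Stiefel manifold. -/
def fubiniStudy (p : Stiefel2 V) (v w : V × V) : ℝ :=
  inner ℝ v.1 w.1 + inner ℝ v.2 w.2 - inner ℝ p.Y v.1 * inner ℝ p.Y w.1

/-- The volume measure of the Fubini–Study metric on the Stiefel manifold, which is of dimension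
`2 m - 3` for `V` of dimension `m ≥ 2`. -/
noncomputable def volFS : Measure (Stiefel2 V) :=
  riemannianVolume (2 * finrank ℝ V - 3) incl fubiniStudy

theorem linearIndependent (p : Stiefel2 V) : LinearIndependent ℝ ![p.X, p.Y] := by
  refine LinearIndependent.pair_iff.2 fun s t h => ⟨?_, ?_⟩
  · have := congrArg (fun z => (inner ℝ p.X z : ℝ)) h
    simpa only [inner_add_right, real_inner_smul_right, p.inner_X_X, p.inner_X_Y, mul_one,
      mul_zero, add_zero, inner_zero_right] using this
  · have := congrArg (fun z => (inner ℝ z p.Y : ℝ)) h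
    simpa only [inner_add_left, real_inner_smul_left, p.inner_Y_Y, p.inner_X_Y, mul_one,
      mul_zero, zero_add, inner_zero_left] using this

/-- The projection `(X, Y) ↦ span {X, Y}` from the Stiefel manifold to the Grassmannian. -/
def toGrassmannian (p : Stiefel2 V) : Grassmannian2 V :=
  ⟨Submodule.span ℝ {p.X, p.Y}, by
    have h := finrank_span_eq_card p.linearIndependent
    rwa [Matrix.range_cons_cons_empty, Fintype.card_fin] at h⟩

/-- The function `sec_R (X, Y) = g(R_{Y,X} X, Y)` on the Stiefel manifold. -/
def sec (R : AlgebraicCurvatureTensor V) (p : Stiefel2 V) : ℝ :=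
  inner ℝ (R.toFun p.Y p.X p.X) p.Y

end Stiefel2

namespace Grassmannian2

theorem exists_basis (P : Grassmannian2 V) : ∃ p : V × V,
    LinearIndependent ℝ ![p.1, p.2] ∧ Submodule.span ℝ {p.1, p.2} = P.plane := by
  have : FiniteDimensional ℝ P.plane :=
    FiniteDimensional.of_finrank_pos (by rw [P.finrank_eq]; norm_num)
  let b := finBasisOfFinrankEq ℝ P.plane P.finrank_eq
  have hb : (P.plane.subtype ∘ b : Fin 2 → V) = ![((b 0 : P.plane) : V), ((b 1 : P.plane) : V)] := by
    ext i; fin_cases i <;> rfl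
  refine ⟨((b 0 : P.plane), (b 1 : P.plane)), ?_, ?_⟩
  · have h := b.linearIndependent.map' P.plane.subtype (Submodule.ker_subtype _)
    rwa [hb] at h
  · have h := congrArg (Submodule.map P.plane.subtype) b.span_eq
    rwa [Submodule.map_span, Submodule.map_top, Submodule.range_subtype, ← Set.range_comp, hb,
      Matrix.range_cons_cons_empty] at h

/-- The sectional curvature function `span {X, Y} ↦ g(R_{Y,X} X, Y) / (g(X,X) g(Y,Y) - g(X,Y)^2)`
on the Grassmannian, computed with some basis of the plane. -/
noncomputable def sec (R : AlgebraicCurvatureTensor V) (P : Grassmannian2 V) : ℝ :=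
  R.sectionalQuotient P.exists_basis.choose.1 P.exists_basis.choose.2

/-- The sectional curvature of a plane does not depend on the choice of the basis. -/
theorem sec_eq (R : AlgebraicCurvatureTensor V) (P : Grassmannian2 V) (X Y : V)
    (h : P.plane = Submodule.span ℝ {X, Y}) : sec R P = R.sectionalQuotient X Y :=
  R.sectionalQuotient_eq_of_span_eq P.exists_basis.choose_spec.1
    (P.exists_basis.choose_spec.2.trans h)

variable [FiniteDimensional ℝ V]

/-- The embedding `P ↦ pr_P` of the Grassmannian into the endomorphisms of `V`, sending a plane to
the orthogonal projection onto it. -/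
noncomputable def proj (P : Grassmannian2 V) : V →L[ℝ] V := P.plane.starProjection

noncomputable instance : TopologicalSpace (Grassmannian2 V) :=
  TopologicalSpace.induced proj inferInstance

noncomputable instance : MeasurableSpace (Grassmannian2 V) := borel _

instance : BorelSpace (Grassmannian2 V) := ⟨rfl⟩

/-- The Fubini–Study metric on the Grassmannian, induced by the scalar product
`h(F, F') = 1/2 tr (F F')` of endomorphisms. -/
noncomputable def fubiniStudy (_ : Grassmannian2 V) (F F' : V →L[ℝ] V) : ℝ :=
  1 / 2 * LinearMap.trace ℝ V ((F ∘L F' : V →L[ℝ] V) : V →ₗ[ℝ] V)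

/-- The volume measure of the Fubini–Study metric on the Grassmannian, which is of dimension
`2 (m - 2)` for `V` of dimension `m ≥ 2`. -/
noncomputable def volFS : Measure (Grassmannian2 V) :=
  riemannianVolume (2 * (finrank ℝ V - 2)) proj fubiniStudy

end Grassmannian2

end Manifolds

/-!
The average of `sec_R ^ k` over the frames, or over the planes, is computed with Gaussian integrals.

*Invariance.* The orthogonal group acts on `St₂ V` and on `Gr₂ V`, preserves both Fubini–Study
volumes (`map_volFS`; these are finite and positive by compactness and explicit charts) and acts
transitively on frames (`Stiefel2.exists_map_eq`). Averaging over the group with a right invariant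
probability measure therefore shows that the mean of `sec_R ^ k` over `St₂ V` and the mean over
`Gr₂ V` are both the mean `c` of `sec_R ^ k` over the rotations of one frame
(`integral_eq_integral_average`, `Stiefel2.integral_rotate_eq`).

*Gaussian means.* For linearly independent `X, Y` with Gram determinant `D(X, Y)` one has
`g(R_{Y,X} X, Y) = D(X, Y) sec_R(span {X, Y})`, while `g(R_{Y,X} X, Y) = 0 = D(X, Y)` otherwise.
The Gaussian measure on pairs is invariant under rotations as well, so that the Gaussian mean
of `g(R_{Y,X} X, Y) ^ k` is `c` times the Gaussian mean of `D ^ k`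
(`integral_sec_rotate_pow`). Since `D(X, ·)` is `‖X‖²` times the squared norm of the projection to
the complement of `X`, the latter is the falling factorial `[m + 2k - 2]_{2k}`
(`integral_integral_gram_det_pow`).

*The moment series.* For fixed `X` the operator `R_{·,X} X` is symmetric, and the moment generating
function of the quadratic form `g(R_{Y,X} X, Y) / 2` of a Gaussian vector `Y` is
`t ↦ det (1 - t R_{·,X} X) ^ (-1/2)` (`LinearMap.IsSymmetric.integral_exp_inner`), which at `t = 1` is
the exponential of the trace series. As `R_{·,sX} (sX) = s² R_{·,X} X`, comparing Taylor coefficients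
identifies the Gaussian mean over `Y` of `g(R_{Y,X} X, Y) ^ k` with `2 ^ k k!` times the homogeneous
part of degree `2 k` of the moment series at `X` (`momentSeries_coeff`). Finally, integration by parts
and Euler's identity show that the Gaussian mean of a homogeneous polynomial `p` of degree `2 k` is
`Δ ^ k p / (2 ^ k k!)`, with the analyst's Laplacian
(`SmoothHomogeneous.integral_eq_laplacian_iterate`), and `Δ ^ k` at the origin sees only the part of
degree `2 k` of a power series (`laplacian_iterate_eq_of_hasFPowerSeriesAt`).
-/

/-! ### Riemannian volumes of submanifolds -/

section

namespace LocalParametrization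

variable {X E : Type*} [TopologicalSpace X] [NormedAddCommGroup E] [NormedSpace ℝ E] {d : ℕ}
  {ι : X → E}

theorem continuousOn (φ : LocalParametrization d ι) : ContinuousOn φ.toFun φ.source :=
  continuousOn_iff_continuous_domRestrict.2 φ.isOpenEmbedding.continuous

theorem injOn (φ : LocalParametrization d ι) : Set.InjOn φ.toFun φ.source :=
  Set.injOn_iff_injective.2 φ.isOpenEmbedding.injective

/-- The image of an open subset of the parameter domain is open. -/
theorem isOpen_image (φ : LocalParametrization d ι) {N : Set (EuclideanSpace ℝ (Fin d))}
    (hN : IsOpen N) (hs : N ⊆ φ.source) : IsOpen (φ.toFun '' N) := by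
  have h := φ.isOpenEmbedding.isOpenMap _
    (hN.preimage (continuous_subtype_val : Continuous (Subtype.val : φ.source → _)))
  rwa [Set.image_domRestrict, Set.inter_eq_left.2 hs] at h

theorem hasFDerivAt (φ : LocalParametrization d ι) {u : EuclideanSpace ℝ (Fin d)}
    (hu : u ∈ φ.source) : HasFDerivAt (ι ∘ φ.toFun) (fderiv ℝ (ι ∘ φ.toFun) u) u :=
  ((φ.contDiffOn.contDiffAt (φ.isOpen_source.mem_nhds hu)).differentiableAt
    (by simp)).hasFDerivAt

/-- The transition map `ψ⁻¹ ∘ φ` between two local parametrizations. -/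
noncomputable def transition (φ ψ : LocalParametrization d ι) :
    EuclideanSpace ℝ (Fin d) → EuclideanSpace ℝ (Fin d) :=
  Function.invFunOn ψ.toFun ψ.source ∘ φ.toFun

theorem transition_mem (φ ψ : LocalParametrization d ι) {u : EuclideanSpace ℝ (Fin d)}
    (hu : φ.toFun u ∈ ψ.toFun '' ψ.source) : φ.transition ψ u ∈ ψ.source :=
  Function.invFunOn_mem hu

theorem toFun_transition (φ ψ : LocalParametrization d ι) {u : EuclideanSpace ℝ (Fin d)}
    (hu : φ.toFun u ∈ ψ.toFun '' ψ.source) : ψ.toFun (φ.transition ψ u) = φ.toFun u :=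
  Function.invFunOn_eq hu

theorem continuousAt_transition (φ ψ : LocalParametrization d ι) {u : EuclideanSpace ℝ (Fin d)}
    (hu : u ∈ φ.source) (hu' : φ.toFun u ∈ ψ.toFun '' ψ.source) :
    ContinuousAt (φ.transition ψ) u := by
  refine continuousAt_def.2 fun N hN => ?_
  obtain ⟨M, hMN, hMo, hM⟩ := mem_nhds_iff.1 hN
  have hopen := ψ.isOpen_image (hMo.inter ψ.isOpen_source) Set.inter_subset_right
  have hmem : φ.toFun u ∈ ψ.toFun '' (M ∩ ψ.source) :=
    ⟨_, ⟨hM, φ.transition_mem ψ hu'⟩, φ.toFun_transition ψ hu'⟩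
  have hc := φ.continuousOn.continuousAt (φ.isOpen_source.mem_nhds hu)
  filter_upwards [hc (hopen.mem_nhds hmem)] with w hw
  obtain ⟨v, ⟨hvM, hvs⟩, hv⟩ := hw
  have h1 : φ.toFun w ∈ ψ.toFun '' ψ.source := ⟨v, hvs, hv⟩
  have : φ.transition ψ w = v :=
    ψ.injOn (φ.transition_mem ψ h1) hvs (by rw [φ.toFun_transition ψ h1, hv])
  rw [Set.mem_preimage, this]
  exact hMN hvM

theorem eventually_mem_image (φ ψ : LocalParametrization d ι) {u : EuclideanSpace ℝ (Fin d)}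
    (hu : u ∈ φ.source) (hu' : φ.toFun u ∈ ψ.toFun '' ψ.source) :
    ∀ᶠ w in 𝓝 u, φ.toFun w ∈ ψ.toFun '' ψ.source :=
  (φ.continuousOn.continuousAt (φ.isOpen_source.mem_nhds hu))
    ((ψ.isOpen_image ψ.isOpen_source subset_rfl).mem_nhds hu')

/-- Transition maps are differentiable: near a point, the immersion `ι ∘ ψ` followed by a linear
left inverse of its derivative is a local diffeomorphism, so that `ψ⁻¹ ∘ φ` is expressed by its
local inverse. -/
theorem exists_hasFDerivAt_transition [FiniteDimensional ℝ E] (φ ψ : LocalParametrization d ι)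
    {u : EuclideanSpace ℝ (Fin d)} (hu : u ∈ φ.source)
    (hu' : φ.toFun u ∈ ψ.toFun '' ψ.source) :
    ∃ T : EuclideanSpace ℝ (Fin d) →L[ℝ] EuclideanSpace ℝ (Fin d),
      HasFDerivAt (φ.transition ψ) T u ∧
      fderiv ℝ (ι ∘ φ.toFun) u = (fderiv ℝ (ι ∘ ψ.toFun) (φ.transition ψ u)) ∘L T := by
  set v := φ.transition ψ u with hv
  have hvs : v ∈ ψ.source := φ.transition_mem ψ hu'
  set B := fderiv ℝ (ι ∘ ψ.toFun) v with hB
  obtain ⟨L, hL⟩ := (B : EuclideanSpace ℝ (Fin d) →ₗ[ℝ] E).exists_leftInverse_of_injective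
    (LinearMap.ker_eq_bot.2 (ψ.immersion v hvs))
  have hstrict : HasStrictFDerivAt (ι ∘ ψ.toFun) B v :=
    (ψ.contDiffOn.contDiffAt (ψ.isOpen_source.mem_nhds hvs)).hasStrictFDerivAt (by simp)
  let L' : E →L[ℝ] EuclideanSpace ℝ (Fin d) := LinearMap.toContinuousLinearMap L
  have hLB : L' ∘L B =
      (ContinuousLinearEquiv.refl ℝ (EuclideanSpace ℝ (Fin d)) :
        EuclideanSpace ℝ (Fin d) →L[ℝ] EuclideanSpace ℝ (Fin d)) := by
    ext1 x
    exact LinearMap.congr_fun hL x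
  have hh : HasStrictFDerivAt (L' ∘ (ι ∘ ψ.toFun))
      (ContinuousLinearEquiv.refl ℝ (EuclideanSpace ℝ (Fin d)) :
        EuclideanSpace ℝ (Fin d) →L[ℝ] EuclideanSpace ℝ (Fin d)) v := by
    rw [← hLB]
    exact L'.hasStrictFDerivAt.comp v hstrict
  have hinv := hh.to_localInverse.hasFDerivAt
  have hφ := φ.hasFDerivAt hu
  have hpt : (L' ∘ (ι ∘ ψ.toFun)) v = L' ((ι ∘ φ.toFun) u) := by
    simp only [Function.comp_apply, hv, φ.toFun_transition ψ hu']
  rw [hpt] at hinv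
  have hcomp := hinv.comp u (L'.hasFDerivAt.comp u hφ)
  have hev : φ.transition ψ =ᶠ[𝓝 u]
      (hh.localInverse _ _ _) ∘ (L' ∘ (ι ∘ φ.toFun)) := by
    have h1 := (φ.continuousAt_transition ψ hu hu').eventually hh.eventually_left_inverse
    filter_upwards [h1, φ.eventually_mem_image ψ hu hu'] with w hw hw'
    rw [Function.comp_apply, ← hw]
    simp only [Function.comp_apply, φ.toFun_transition ψ hw']
  have hT := hcomp.congr_of_eventuallyEq hev
  refine ⟨_, hT, ?_⟩
  have hc2 := (ψ.hasFDerivAt hvs).comp u hT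
  have hev2 : (ι ∘ ψ.toFun) ∘ φ.transition ψ =ᶠ[𝓝 u] ι ∘ φ.toFun := by
    filter_upwards [φ.eventually_mem_image ψ hu hu'] with w hw
    simp only [Function.comp_apply, φ.toFun_transition ψ hw]
  exact (hφ.congr_of_eventuallyEq hev2).unique hc2

section Metric

variable (g : X → E → E → ℝ)

/-- Bilinearity of a metric at every point. -/
def _root_.IsBilinearMetric (g : X → E → E → ℝ) : Prop :=
  ∃ b : X → E →ₗ[ℝ] E →ₗ[ℝ] ℝ, ∀ x v w, g x v w = b x v w

variable {g}

theorem det_gram_of_comp (hg : IsBilinearMetric g) (φ ψ : LocalParametrization d ι)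
    {u v : EuclideanSpace ℝ (Fin d)} (huv : φ.toFun u = ψ.toFun v)
    (T : EuclideanSpace ℝ (Fin d) →L[ℝ] EuclideanSpace ℝ (Fin d))
    (hT : fderiv ℝ (ι ∘ φ.toFun) u = (fderiv ℝ (ι ∘ ψ.toFun) v) ∘L T) :
    (φ.gram g u).det = T.det ^ 2 * (ψ.gram g v).det := by
  obtain ⟨b, hb⟩ := hg
  let basis := (EuclideanSpace.basisFun (Fin d) ℝ).toBasis
  let M := LinearMap.toMatrix basis basis (T : EuclideanSpace ℝ (Fin d) →ₗ[ℝ] _)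
  have hM : ∀ i, T (EuclideanSpace.single i 1) = ∑ k, M k i • EuclideanSpace.single k (1 : ℝ) := by
    intro i
    have := basis.sum_repr (T (EuclideanSpace.single i 1))
    rw [← this]
    simp [M, basis, LinearMap.toMatrix_apply]
  have hdet : M.det = T.det := LinearMap.det_toMatrix basis _
  have key : φ.gram g u = M.transpose * ψ.gram g v * M := by
    ext i j
    simp only [gram, Matrix.of_apply, Matrix.mul_apply, Matrix.transpose_apply, hT, huv, hb,
      ContinuousLinearMap.comp_apply, hM, map_sum, map_smul, LinearMap.sum_apply,
      LinearMap.smul_apply, smul_eq_mul, Finset.mul_sum, Finset.sum_mul]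
    refine Finset.sum_congr rfl fun k _ => Finset.sum_congr rfl fun l _ => ?_
    ring
  rw [key, Matrix.det_mul, Matrix.det_mul, Matrix.det_transpose, hdet]
  ring

/-- A metric depends continuously on its arguments. -/
def _root_.IsContinuousMetric (g : X → E → E → ℝ) : Prop :=
  Continuous fun p : X × E × E => g p.1 p.2.1 p.2.2

theorem continuousOn_det_gram (hg : IsContinuousMetric g) (φ : LocalParametrization d ι) :
    ContinuousOn (fun u => (φ.gram g u).det) φ.source := by
  have hD : ContinuousOn (fderiv ℝ (ι ∘ φ.toFun)) φ.source :=
    φ.contDiffOn.continuousOn_fderiv_of_isOpen φ.isOpen_source (by simp)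
  have hgram : ContinuousOn (fun u => φ.gram g u) φ.source := by
    refine continuousOn_pi.2 fun i => continuousOn_pi.2 fun j => ?_
    exact hg.comp_continuousOn (φ.continuousOn.prodMk
      ((hD.clm_apply continuousOn_const).prodMk (hD.clm_apply continuousOn_const)))
  exact (Continuous.matrix_det continuous_id).comp_continuousOn hgram

variable [MeasurableSpace X] [BorelSpace X]

theorem measurableSet_inter_preimage (φ : LocalParametrization d ι) {S : Set X}
    (hS : MeasurableSet S) : MeasurableSet (φ.toFun ⁻¹' S ∩ φ.source) := by
  have h := (φ.isOpenEmbedding.continuous.measurable hS)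
  have h2 := (MeasurableEmbedding.subtype_coe φ.isOpen_source.measurableSet).measurableSet_image.2 h
  convert h2 using 1
  ext u
  simp [Set.mem_image, and_comm]

theorem localVolume_apply (φ : LocalParametrization d ι) (g : X → E → E → ℝ) {S : Set X}
    (hS : MeasurableSet S) :
    φ.localVolume g S = ∫⁻ u in φ.toFun ⁻¹' S ∩ φ.source,
      ENNReal.ofReal (Real.sqrt (φ.gram g u).det) := by
  have hae : AEMeasurable φ.toFun ((volume.restrict φ.source).withDensity
      (fun u => ENNReal.ofReal (Real.sqrt (φ.gram g u).det))) :=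
    (φ.continuousOn.aemeasurable φ.isOpen_source.measurableSet).mono_ac
      (withDensity_absolutelyContinuous _ _)
  rw [localVolume, Measure.map_apply_of_aemeasurable hae hS, withDensity_apply',
    Measure.restrict_restrict' φ.isOpen_source.measurableSet]

/-- Change of variables: on the image of `ψ`, the volume of any other local parametrization is at
most the one of `ψ`. -/
theorem localVolume_le [FiniteDimensional ℝ E] (hg : IsBilinearMetric g)
    (φ ψ : LocalParametrization d ι) {S : Set X} (hS : MeasurableSet S)
    (hSψ : S ⊆ ψ.toFun '' ψ.source) : φ.localVolume g S ≤ ψ.localVolume g S := by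
  rw [localVolume_apply _ _ hS, localVolume_apply _ _ hS]
  set O := φ.toFun ⁻¹' S ∩ φ.source with hO
  have hOm : MeasurableSet O := φ.measurableSet_inter_preimage hS
  have hder : ∀ u : O, ∃ T : EuclideanSpace ℝ (Fin d) →L[ℝ] EuclideanSpace ℝ (Fin d),
      HasFDerivAt (φ.transition ψ) T u ∧
      fderiv ℝ (ι ∘ φ.toFun) u = (fderiv ℝ (ι ∘ ψ.toFun) (φ.transition ψ u)) ∘L T :=
    fun u => φ.exists_hasFDerivAt_transition ψ u.2.2 (hSψ u.2.1)
  choose! T hT1 hT2 using fun (u : EuclideanSpace ℝ (Fin d)) (hu : u ∈ O) => hder ⟨u, hu⟩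
  have hinj : Set.InjOn (φ.transition ψ) O := by
    intro u hu w hw huw
    refine φ.injOn hu.2 hw.2 ?_
    rw [← φ.toFun_transition ψ (hSψ hu.1), ← φ.toFun_transition ψ (hSψ hw.1), huw]
  have h1 : ∫⁻ u in O, ENNReal.ofReal (Real.sqrt (φ.gram g u).det) =
      ∫⁻ u in O, ENNReal.ofReal |(T u).det| *
        ENNReal.ofReal (Real.sqrt (ψ.gram g (φ.transition ψ u)).det) := by
    refine setLIntegral_congr_fun hOm fun u hu => ?_
    rw [det_gram_of_comp hg φ ψ (φ.toFun_transition ψ (hSψ hu.1)).symm (T u) (hT2 u hu),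
      Real.sqrt_mul (sq_nonneg _), Real.sqrt_sq_eq_abs, ENNReal.ofReal_mul (abs_nonneg _)]
  rw [h1, ← lintegral_image_eq_lintegral_abs_det_fderiv_mul volume hOm
    (fun u hu => (hT1 u hu).hasFDerivWithinAt) hinj
    (fun v => ENNReal.ofReal (Real.sqrt (ψ.gram g v).det))]
  refine lintegral_mono_set ?_
  rintro _ ⟨u, hu, rfl⟩
  refine ⟨?_, φ.transition_mem ψ (hSψ hu.1)⟩
  rw [Set.mem_preimage, φ.toFun_transition ψ (hSψ hu.1)]
  exact hu.1

theorem riemannianVolume_le [FiniteDimensional ℝ E] (hg : IsBilinearMetric g)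
    (ψ : LocalParametrization d ι) {S : Set X} (hS : MeasurableSet S)
    (hSψ : S ⊆ ψ.toFun '' ψ.source) : riemannianVolume d ι g S ≤ ψ.localVolume g S := by
  set I := ψ.toFun '' ψ.source with hI
  have hIm : MeasurableSet I := (ψ.isOpen_image ψ.isOpen_source subset_rfl).measurableSet
  -- a measure which agrees with the volume of `ψ` on its image and is infinite elsewhere
  let β : Measure X := (ψ.localVolume g).restrict I + (⊤ : Measure X).restrict Iᶜ
  have hle : riemannianVolume d ι g ≤ β := by
    refine iSup_le fun φ => Measure.le_iff.2 fun A hA => ?_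
    rw [Measure.add_apply, Measure.restrict_apply hA, Measure.restrict_apply hA,
      ← measure_inter_add_sdiff A hIm]
    refine add_le_add ?_ ?_
    · exact localVolume_le hg φ ψ (hA.inter hIm) Set.inter_subset_right
    · exact (Measure.le_iff.1 (le_top : φ.localVolume g ≤ ⊤)) _ (hA.diff hIm)
  refine (Measure.le_iff.1 hle S hS).trans ?_
  rw [Measure.add_apply, Measure.restrict_apply hS, Measure.restrict_apply hS,
    Set.inter_eq_left.2 hSψ, (Set.disjoint_compl_right_iff_subset.2 hSψ).inter_eq]
  simp

/-- The restriction of a local parametrization to a smaller open set. -/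
def restrict (φ : LocalParametrization d ι) (U : Set (EuclideanSpace ℝ (Fin d))) (hU : IsOpen U)
    (hs : U ⊆ φ.source) : LocalParametrization d ι where
  source := U
  toFun := φ.toFun
  isOpen_source := hU
  isOpenEmbedding := φ.isOpenEmbedding.comp
    (IsOpenEmbedding.inclusion hs (hU.preimage continuous_subtype_val))
  contDiffOn := φ.contDiffOn.mono hs
  immersion := fun u hu => φ.immersion u (hs hu)

theorem exists_nhds_localVolume_lt_top (hg : IsContinuousMetric g)
    (φ : LocalParametrization d ι) {u : EuclideanSpace ℝ (Fin d)} (hu : u ∈ φ.source) :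
    ∃ ψ : LocalParametrization d ι, ψ.toFun '' ψ.source ∈ 𝓝 (φ.toFun u) ∧
      ψ.localVolume g Set.univ < ⊤ := by
  have hc : ContinuousOn (fun u => Real.sqrt (φ.gram g u).det) φ.source :=
    (φ.continuousOn_det_gram hg).sqrt
  have hca := hc.continuousAt (φ.isOpen_source.mem_nhds hu)
  set c := Real.sqrt (φ.gram g u).det
  have h1 : ∀ᶠ v in 𝓝 u, Real.sqrt (φ.gram g v).det < c + 1 :=
    hca.eventually (gt_mem_nhds (lt_add_one c))
  obtain ⟨r, hr, hball⟩ := Metric.eventually_nhds_iff_ball.1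
    (h1.and (φ.isOpen_source.mem_nhds hu))
  refine ⟨φ.restrict (Metric.ball u r) Metric.isOpen_ball fun v hv => (hball v hv).2, ?_, ?_⟩
  · exact (φ.isOpen_image Metric.isOpen_ball fun v hv => (hball v hv).2).mem_nhds
      ⟨u, Metric.mem_ball_self hr, rfl⟩
  · rw [localVolume_apply _ _ MeasurableSet.univ, Set.preimage_univ, Set.univ_inter]
    calc ∫⁻ v in Metric.ball u r, ENNReal.ofReal (Real.sqrt (φ.gram g v).det)
        ≤ ∫⁻ _ in Metric.ball u r, ENNReal.ofReal (c + 1) :=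
          setLIntegral_mono' measurableSet_ball fun v hv =>
            ENNReal.ofReal_le_ofReal (hball v hv).1.le
      _ < ⊤ := by
          rw [setLIntegral_const]
          exact ENNReal.mul_lt_top ENNReal.ofReal_lt_top measure_ball_lt_top

theorem riemannianVolume_univ_lt_top [FiniteDimensional ℝ E] [CompactSpace X]
    (hb : IsBilinearMetric g) (hg : IsContinuousMetric g)
    (hX : ∀ x, ∃ φ : LocalParametrization d ι, x ∈ φ.toFun '' φ.source) :
    riemannianVolume d ι g Set.univ < ⊤ := by
  refine isCompact_univ.measure_lt_top_of_nhdsWithin fun x _ => ?_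
  obtain ⟨φ, u, hu, rfl⟩ := hX x
  obtain ⟨ψ, hψ, hfin⟩ := φ.exists_nhds_localVolume_lt_top hg hu
  refine ⟨_, mem_nhdsWithin_of_mem_nhds hψ, ?_⟩
  have hm := (ψ.isOpen_image ψ.isOpen_source subset_rfl).measurableSet
  exact (riemannianVolume_le hb ψ hm subset_rfl).trans_lt
    ((measure_mono (Set.subset_univ _)).trans_lt hfin)

/-- The volume is positive as soon as the metric is positive definite on one tangent space. -/
theorem riemannianVolume_univ_pos (hb : IsBilinearMetric g) (hg : IsContinuousMetric g)
    (hsymm : ∀ x v w, g x v w = g x w v)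
    (φ : LocalParametrization d ι) {u : EuclideanSpace ℝ (Fin d)} (hu : u ∈ φ.source)
    (hpos : ∀ c, fderiv ℝ (ι ∘ φ.toFun) u c ≠ 0 →
      0 < g (φ.toFun u) (fderiv ℝ (ι ∘ φ.toFun) u c) (fderiv ℝ (ι ∘ φ.toFun) u c)) :
    0 < riemannianVolume d ι g Set.univ := by
  have hdet : 0 < (φ.gram g u).det := by
    refine Matrix.PosDef.det_pos (Matrix.PosDef.of_dotProduct_mulVec_pos ?_ fun c hc => ?_)
    · ext i j
      simp [gram, hsymm (φ.toFun u) (fderiv ℝ (ι ∘ φ.toFun) u (EuclideanSpace.single j 1))]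
    · obtain ⟨b, hb⟩ := hb
      have hne : fderiv ℝ (ι ∘ φ.toFun) u (WithLp.toLp 2 c) ≠ 0 := by
        intro h0
        have := φ.immersion u hu (h0.trans (map_zero _).symm)
        exact hc (by simpa using congrArg WithLp.ofLp this)
      have hc' : WithLp.toLp 2 c = ∑ i, c i • EuclideanSpace.single i (1 : ℝ) := by
        ext j
        simp [Finset.sum_apply, Pi.single_apply]
      have := hpos _ hne
      rw [hc'] at this
      simp only [map_sum, map_smul, hb, LinearMap.sum_apply, LinearMap.smul_apply,
        smul_eq_mul, Finset.mul_sum] at this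
      rw [Finset.sum_comm] at this
      simpa [gram, dotProduct, Matrix.mulVec, hb, Finset.mul_sum, mul_left_comm, mul_comm] using this
  have hle : φ.localVolume g Set.univ ≤ riemannianVolume d ι g Set.univ :=
    Measure.le_iff.1 (le_iSup (fun φ : LocalParametrization d ι => φ.localVolume g) φ) _
      MeasurableSet.univ
  refine lt_of_lt_of_le ?_ hle
  rw [localVolume_apply _ _ MeasurableSet.univ, Set.preimage_univ, Set.univ_inter]
  have hca := (φ.continuousOn_det_gram hg).continuousAt (φ.isOpen_source.mem_nhds hu)
  have hev : ∀ᶠ v in 𝓝 u, (φ.gram g u).det / 2 < (φ.gram g v).det :=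
    hca.eventually (lt_mem_nhds (half_lt_self hdet))
  obtain ⟨r, hr, hball⟩ := Metric.eventually_nhds_iff_ball.1
    (hev.and (φ.isOpen_source.mem_nhds hu))
  calc (0 : ENNReal) < ENNReal.ofReal (Real.sqrt ((φ.gram g u).det / 2)) *
          volume (Metric.ball u r) :=
        ENNReal.mul_pos (ENNReal.ofReal_pos.2 (Real.sqrt_pos.2 (half_pos hdet))).ne'
          (Metric.measure_ball_pos volume u hr).ne'
    _ = ∫⁻ _ in Metric.ball u r, ENNReal.ofReal (Real.sqrt ((φ.gram g u).det / 2)) := by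
        rw [setLIntegral_const]
    _ ≤ ∫⁻ v in Metric.ball u r, ENNReal.ofReal (Real.sqrt (φ.gram g v).det) :=
        setLIntegral_mono' measurableSet_ball fun v hv =>
          ENNReal.ofReal_le_ofReal (Real.sqrt_le_sqrt (hball v hv).1.le)
    _ ≤ _ := lintegral_mono_set fun v hv => (hball v hv).2

/-- The image of a local parametrization under a homeomorphism of `X` which is the restriction of a
linear automorphism of `E`. -/
def mapHomeomorph (φ : LocalParametrization d ι) (h : X ≃ₜ X) (T : E ≃L[ℝ] E)
    (hT : ∀ x, ι (h x) = T (ι x)) : LocalParametrization d ι where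
  source := φ.source
  toFun := h ∘ φ.toFun
  isOpen_source := φ.isOpen_source
  isOpenEmbedding := h.isOpenEmbedding.comp φ.isOpenEmbedding
  contDiffOn := by
    have : ι ∘ h ∘ φ.toFun = T ∘ (ι ∘ φ.toFun) := by ext u; simp [hT]
    rw [this]
    exact T.contDiff.comp_contDiffOn φ.contDiffOn
  immersion := fun u hu => by
    have : ι ∘ h ∘ φ.toFun = T ∘ (ι ∘ φ.toFun) := by ext u; simp [hT]
    rw [this, T.comp_fderiv]
    exact T.injective.comp (φ.immersion u hu)

theorem localVolume_mapHomeomorph (φ : LocalParametrization d ι) (h : X ≃ₜ X) (T : E ≃L[ℝ] E)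
    (hT : ∀ x, ι (h x) = T (ι x)) (hgT : ∀ x v w, g (h x) (T v) (T w) = g x v w) :
    (φ.mapHomeomorph h T hT).localVolume g = (φ.localVolume g).map h := by
  ext S hS
  rw [Measure.map_apply h.continuous.measurable hS, localVolume_apply _ _ hS,
    localVolume_apply _ _ (h.continuous.measurable hS)]
  have : ι ∘ h ∘ φ.toFun = T ∘ (ι ∘ φ.toFun) := by ext u; simp [hT]
  have hgram : ∀ u, (φ.mapHomeomorph h T hT).gram g u = φ.gram g u := by
    intro u
    ext i j
    simp only [gram, mapHomeomorph, Matrix.of_apply, this, T.comp_fderiv]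
    exact hgT _ _ _
  simp only [hgram]
  rfl

theorem map_riemannianVolume (h : X ≃ₜ X) (T : E ≃L[ℝ] E)
    (hT : ∀ x, ι (h x) = T (ι x)) (hgT : ∀ x v w, g (h x) (T v) (T w) = g x v w) :
    (riemannianVolume d ι g).map h = riemannianVolume d ι g := by
  -- one inequality for every isometry; the other one follows by applying it to the inverse
  have key : ∀ (h : X ≃ₜ X) (T : E ≃L[ℝ] E), (∀ x, ι (h x) = T (ι x)) →
      (∀ x v w, g (h x) (T v) (T w) = g x v w) →
      riemannianVolume d ι g ≤ (riemannianVolume d ι g).map h := by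
    intro h T hT hgT
    have hs : ∀ x, ι (h.symm x) = T.symm (ι x) := fun x => by
      apply T.injective
      rw [← hT, h.apply_symm_apply, T.apply_symm_apply]
    have hgs : ∀ x v w, g (h.symm x) (T.symm v) (T.symm w) = g x v w := fun x v w => by
      rw [← hgT, h.apply_symm_apply, T.apply_symm_apply, T.apply_symm_apply]
    refine iSup_le fun φ => ?_
    have h1 : (φ.localVolume g).map h.symm ≤ riemannianVolume d ι g := by
      rw [← φ.localVolume_mapHomeomorph h.symm T.symm hs hgs]
      exact le_iSup (fun φ : LocalParametrization d ι => φ.localVolume g) _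
    have h2 := Measure.map_mono h1 h.continuous.measurable
    rw [Measure.map_map h.continuous.measurable h.symm.continuous.measurable] at h2
    simpa using h2
  refine le_antisymm ?_ (key h T hT hgT)
  have hs : ∀ x, ι (h.symm x) = T.symm (ι x) := fun x => by
    apply T.injective
    rw [← hT, h.apply_symm_apply, T.apply_symm_apply]
  have hgs : ∀ x v w, g (h.symm x) (T.symm v) (T.symm w) = g x v w := fun x v w => by
    rw [← hgT, h.apply_symm_apply, T.apply_symm_apply, T.apply_symm_apply]
  have h2 := Measure.map_mono (key h.symm T.symm hs hgs) h.continuous.measurable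
  rw [Measure.map_map h.continuous.measurable h.symm.continuous.measurable] at h2
  simpa using h2

end Metric

/-- A local parametrization obtained from a map `φ` defined on an open subset of a
`d`-dimensional space `W` with open image in `X`, for which `ι ∘ φ` has a differentiable left
inverse `r` on the ambient space. -/
noncomputable def ofLeftInverse {W : Type*} [NormedAddCommGroup W] [NormedSpace ℝ W]
    [FiniteDimensional ℝ W] (hW : finrank ℝ W = d) (hι : IsInducing ι) (U : Set W) (hU : IsOpen U)
    (φ : W → X) (hφ : ContDiffOn ℝ ∞ (ι ∘ φ) U) (himage : IsOpen (φ '' U)) (r : E → W)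
    (hr : ∀ u ∈ U, r (ι (φ u)) = u) (hrd : ∀ u ∈ U, DifferentiableAt ℝ r (ι (φ u))) :
    LocalParametrization d ι :=
  let e : EuclideanSpace ℝ (Fin d) ≃L[ℝ] W :=
    ContinuousLinearEquiv.ofFinrankEq (by rw [finrank_euclideanSpace_fin, hW])
  have hsm : ContDiffOn ℝ ∞ (ι ∘ φ ∘ e) (e ⁻¹' U) :=
    hφ.comp e.contDiff.contDiffOn (Set.mapsTo_preimage _ _)
  { source := e ⁻¹' U
    toFun := φ ∘ e
    isOpen_source := hU.preimage e.continuous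
    isOpenEmbedding := by
      have hleft : ∀ u : e ⁻¹' U, (e.symm ∘ r ∘ ι) ((e ⁻¹' U).domRestrict (φ ∘ e) u) = u := by
        intro u
        simp [hr _ u.2]
      refine ⟨⟨isInducing_iff_nhds.2 fun u => le_antisymm ?_ ?_, ?_⟩, ?_⟩
      · have hc : Continuous ((e ⁻¹' U).domRestrict (φ ∘ e)) := by
          rw [hι.continuous_iff]
          exact continuousOn_iff_continuous_domRestrict.1 hsm.continuousOn
        exact hc.continuousAt.le_comap
      · have hca : Tendsto (e.symm ∘ r ∘ ι) (𝓝 ((e ⁻¹' U).domRestrict (φ ∘ e) u))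
            (𝓝 (u : EuclideanSpace ℝ (Fin d))) := by
          have h1 : ContinuousAt (e.symm ∘ r ∘ ι) ((e ⁻¹' U).domRestrict (φ ∘ e) u) :=
            e.symm.continuous.continuousAt.comp
              ((hrd _ u.2).continuousAt.comp hι.continuous.continuousAt)
          have h2 := h1.tendsto
          rwa [hleft u] at h2
        have h3 := comap_mono (m := (e ⁻¹' U).domRestrict (φ ∘ e)) hca.le_comap
        rw [comap_comap] at h3
        refine h3.trans ?_
        have h4 : (e.symm ∘ r ∘ ι) ∘ (e ⁻¹' U).domRestrict (φ ∘ e) = Subtype.val := funext hleft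
        rw [h4, nhds_subtype_eq_comap]
      · intro u v huv
        exact Subtype.ext (by rw [← hleft u, ← hleft v, huv])
      · rwa [Set.range_domRestrict, Set.image_comp, Set.image_preimage_eq _ e.surjective]
    contDiffOn := hsm
    immersion := fun u hu => by
      have h1 : HasFDerivAt (ι ∘ φ ∘ e) (fderiv ℝ (ι ∘ φ ∘ e) u) u :=
        ((hsm.contDiffAt ((hU.preimage e.continuous).mem_nhds hu)).differentiableAt
          (by simp)).hasFDerivAt
      have h2 : HasFDerivAt (r ∘ ι ∘ φ ∘ e) _ u :=
        HasFDerivAt.comp u (hrd _ hu).hasFDerivAt h1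
      have h3 : r ∘ ι ∘ φ ∘ e =ᶠ[𝓝 u] e := by
        filter_upwards [(hU.preimage e.continuous).mem_nhds hu] with v hv
        exact hr _ hv
      have h4 := (e.hasFDerivAt.congr_of_eventuallyEq h3).unique h2
      intro a b hab
      apply e.injective
      have h5 := congrArg (fun T => T (a - b)) h4
      have h6 : fderiv ℝ (ι ∘ φ ∘ e) u (a - b) = 0 := by
        rw [map_sub, sub_eq_zero]
        exact hab
      simp only [ContinuousLinearMap.comp_apply, h6, ContinuousLinearEquiv.coe_coe] at h5
      rw [map_zero, map_sub] at h5
      exact sub_eq_zero.1 h5 }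

theorem image_ofLeftInverse {W : Type*} [NormedAddCommGroup W] [NormedSpace ℝ W]
    [FiniteDimensional ℝ W] (hW : finrank ℝ W = d) (hι : IsInducing ι) (U : Set W) (hU : IsOpen U)
    (φ : W → X) (hφ : ContDiffOn ℝ ∞ (ι ∘ φ) U) (himage : IsOpen (φ '' U)) (r : E → W)
    (hr : ∀ u ∈ U, r (ι (φ u)) = u) (hrd : ∀ u ∈ U, DifferentiableAt ℝ r (ι (φ u))) :
    (ofLeftInverse hW hι U hU φ hφ himage r hr hrd).toFun ''
      (ofLeftInverse hW hι U hU φ hφ himage r hr hrd).source = φ '' U := by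
  simp only [ofLeftInverse]
  rw [Set.image_comp, Set.image_preimage_eq _ (ContinuousLinearEquiv.surjective _)]

end LocalParametrization

end

/-! ### The Stiefel manifold -/

section

variable {V : Type*} [NormedAddCommGroup V] [InnerProductSpace ℝ V]

theorem normalize_smul {c : ℝ} (hc : 0 < c) {X : V} (hX : ‖X‖ = 1) :
    ‖c • X‖⁻¹ • (c • X) = X := by
  rw [norm_smul, hX, mul_one, Real.norm_of_nonneg hc.le, smul_smul, inv_mul_cancel₀ hc.ne',
    one_smul]

theorem inner_normalize_self {u : V} (hu : u ≠ 0) :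
    (inner ℝ (‖u‖⁻¹ • u) (‖u‖⁻¹ • u) : ℝ) = 1 := by
  have := norm_ne_zero_iff.2 hu
  rw [real_inner_smul_left, real_inner_smul_right, real_inner_self_eq_norm_sq]
  field_simp

namespace Stiefel2

theorem isInducing_incl : IsInducing (incl : Stiefel2 V → V × V) := ⟨rfl⟩

theorem incl_injective : Function.Injective (incl : Stiefel2 V → V × V) := by
  rintro ⟨X, Y, _, _, _⟩ ⟨X', Y', _, _, _⟩ h
  simp only [incl, Prod.mk.injEq] at h
  obtain ⟨rfl, rfl⟩ := h
  rfl

theorem norm_X (p : Stiefel2 V) : ‖p.X‖ = 1 := by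
  have := p.inner_X_X
  rwa [real_inner_self_eq_norm_sq, pow_eq_one_iff_of_nonneg (norm_nonneg p.X) two_ne_zero] at this

theorem norm_Y (p : Stiefel2 V) : ‖p.Y‖ = 1 := by
  have := p.inner_Y_Y
  rwa [real_inner_self_eq_norm_sq, pow_eq_one_iff_of_nonneg (norm_nonneg p.Y) two_ne_zero] at this

theorem continuous_X : Continuous (X : Stiefel2 V → V) :=
  continuous_fst.comp isInducing_incl.continuous

theorem continuous_Y : Continuous (Y : Stiefel2 V → V) :=
  continuous_snd.comp isInducing_incl.continuous

theorem continuous_mk {α : Type*} [TopologicalSpace α] {f : α → Stiefel2 V}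
    (hX : Continuous fun a => (f a).X) (hY : Continuous fun a => (f a).Y) : Continuous f :=
  isInducing_incl.continuous_iff.2 (hX.prodMk hY)

instance [FiniteDimensional ℝ V] : SecondCountableTopology (Stiefel2 V) :=
  isInducing_incl.secondCountableTopology

instance [FiniteDimensional ℝ V] : CompactSpace (Stiefel2 V) := by
  refine ⟨isInducing_incl.isCompact_iff.2 ?_⟩
  refine Metric.isCompact_of_isClosed_isBounded ?_ ?_
  · have : (incl '' (Set.univ : Set (Stiefel2 V))) = {q : V × V | inner ℝ q.1 q.1 = (1 : ℝ)} ∩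
        {q : V × V | inner ℝ q.2 q.2 = (1 : ℝ)} ∩ {q : V × V | inner ℝ q.1 q.2 = (0 : ℝ)} := by
      ext ⟨x, y⟩
      constructor
      · rintro ⟨p, -, h⟩
        rw [← h]
        exact ⟨⟨p.inner_X_X, p.inner_Y_Y⟩, p.inner_X_Y⟩
      · rintro ⟨⟨h1, h2⟩, h3⟩
        exact ⟨⟨x, y, h1, h2, h3⟩, trivial, rfl⟩
    rw [this]
    refine (IsClosed.inter ?_ ?_).inter ?_ <;>
      exact isClosed_eq (by fun_prop) continuous_const
  · refine Metric.isBounded_closedBall (x := (0 : V × V)) (r := 1) |>.subset ?_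
    rintro _ ⟨p, -, rfl⟩
    simp [incl, Prod.norm_def, p.norm_X, p.norm_Y]

/-- The Gram–Schmidt orthonormalization of a linearly independent pair. -/
noncomputable def gramSchmidt (u v : V) (h : LinearIndependent ℝ ![u, v]) : Stiefel2 V :=
  have hu : u ≠ 0 := by simpa using h.ne_zero 0
  have hw : v - (inner ℝ (‖u‖⁻¹ • u) v : ℝ) • (‖u‖⁻¹ • u) ≠ 0 := by
    intro h0
    rw [LinearIndependent.pair_iff] at h
    have := h (-(inner ℝ (‖u‖⁻¹ • u) v * ‖u‖⁻¹)) 1 (by rw [← h0]; module)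
    exact one_ne_zero this.2
  have hX : (inner ℝ (‖u‖⁻¹ • u) (‖u‖⁻¹ • u) : ℝ) = 1 := inner_normalize_self hu
  { X := ‖u‖⁻¹ • u
    Y := ‖v - (inner ℝ (‖u‖⁻¹ • u) v : ℝ) • (‖u‖⁻¹ • u)‖⁻¹ •
      (v - (inner ℝ (‖u‖⁻¹ • u) v : ℝ) • (‖u‖⁻¹ • u))
    inner_X_X := hX
    inner_Y_Y := inner_normalize_self hw
    inner_X_Y := by
      rw [inner_smul_right, inner_sub_right, inner_smul_right, hX]
      simp }

theorem span_gramSchmidt (u v : V) (h : LinearIndependent ℝ ![u, v]) :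
    Submodule.span ℝ {(gramSchmidt u v h).X, (gramSchmidt u v h).Y} =
      Submodule.span ℝ {u, v} := by
  have h1 : Submodule.span ℝ {(gramSchmidt u v h).X, (gramSchmidt u v h).Y} ≤
      Submodule.span ℝ {u, v} := by
    have hu : u ∈ Submodule.span ℝ {u, v} := Submodule.subset_span (by simp)
    have hv : v ∈ Submodule.span ℝ {u, v} := Submodule.subset_span (by simp)
    have hX : (gramSchmidt u v h).X ∈ Submodule.span ℝ {u, v} := Submodule.smul_mem _ _ hu
    rw [Submodule.span_le, Set.insert_subset_iff, Set.singleton_subset_iff]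
    exact ⟨hX, Submodule.smul_mem _ _ (Submodule.sub_mem _ hv (Submodule.smul_mem _ _ hX))⟩
  have hf : FiniteDimensional ℝ (Submodule.span ℝ {u, v}) :=
    FiniteDimensional.span_of_finite ℝ (Set.toFinite _)
  refine Submodule.eq_of_le_of_finrank_eq h1 ?_
  have h2 := finrank_span_eq_card (gramSchmidt u v h).linearIndependent
  have h3 := finrank_span_eq_card h
  rw [Matrix.range_cons_cons_empty] at h2 h3
  rw [h2, h3]

/-- The action of a linear isometry on orthonormal frames. -/
def map (e : V ≃ₗᵢ[ℝ] V) (p : Stiefel2 V) : Stiefel2 V where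
  X := e p.X
  Y := e p.Y
  inner_X_X := by rw [e.inner_map_map, p.inner_X_X]
  inner_Y_Y := by rw [e.inner_map_map, p.inner_Y_Y]
  inner_X_Y := by rw [e.inner_map_map, p.inner_X_Y]

theorem continuous_map (e : V ≃ₗᵢ[ℝ] V) : Continuous (map e) :=
  continuous_mk (e.continuous.comp continuous_X) (e.continuous.comp continuous_Y)

/-- The action of a linear isometry on orthonormal frames, as a homeomorphism. -/
def mapHomeomorph (e : V ≃ₗᵢ[ℝ] V) : Stiefel2 V ≃ₜ Stiefel2 V where
  toFun := map e
  invFun := map e.symm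
  left_inv p := incl_injective (by simp [incl, map])
  right_inv p := incl_injective (by simp [incl, map])
  continuous_toFun := continuous_map e
  continuous_invFun := continuous_map e.symm

theorem isBilinearMetric_fubiniStudy : IsBilinearMetric (fubiniStudy (V := V)) := by
  refine ⟨fun p => LinearMap.mk₂ ℝ (fubiniStudy p) ?_ ?_ ?_ ?_, fun _ _ _ => rfl⟩
  · intro a b c
    simp only [fubiniStudy, Prod.fst_add, Prod.snd_add, inner_add_left, inner_add_right]
    ring
  · intro c a b
    simp only [fubiniStudy, Prod.smul_fst, Prod.smul_snd, real_inner_smul_left,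
      real_inner_smul_right, smul_eq_mul]
    ring
  · intro a b c
    simp only [fubiniStudy, Prod.fst_add, Prod.snd_add, inner_add_right]
    ring
  · intro c a b
    simp only [fubiniStudy, Prod.smul_fst, Prod.smul_snd, real_inner_smul_right, smul_eq_mul]
    ring

theorem isContinuousMetric_fubiniStudy : IsContinuousMetric (fubiniStudy (V := V)) := by
  have := continuous_Y (V := V)
  unfold IsContinuousMetric fubiniStudy
  fun_prop

/-- The Fubini–Study volume on the Stiefel manifold is invariant under the orthogonal group. -/
theorem map_volFS (e : V ≃ₗᵢ[ℝ] V) : (volFS : Measure (Stiefel2 V)).map (map e) = volFS := by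
  refine LocalParametrization.map_riemannianVolume (mapHomeomorph e)
    (e.toContinuousLinearEquiv.prodCongr e.toContinuousLinearEquiv) (fun p => rfl) ?_
  intro p v w
  simp [fubiniStudy, mapHomeomorph, map]

/-- The parameter space of a chart of the Stiefel manifold around the frame `p = (X, Y)`: a vector
orthogonal to `X` and a vector orthogonal to `X` and `Y`. -/
abbrev ChartSpace (p : Stiefel2 V) : Type _ :=
  (Submodule.span ℝ {p.X})ᗮ × (Submodule.span ℝ {p.X, p.Y})ᗮ

theorem inner_X_fst (p : Stiefel2 V) (q : p.ChartSpace) : inner ℝ p.X (q.1 : V) = (0 : ℝ) :=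
  q.1.2 _ (Submodule.mem_span_singleton_self _)

theorem inner_X_snd (p : Stiefel2 V) (q : p.ChartSpace) : inner ℝ p.X (q.2 : V) = (0 : ℝ) :=
  q.2.2 _ (Submodule.subset_span (by simp))

theorem inner_Y_snd (p : Stiefel2 V) (q : p.ChartSpace) : inner ℝ p.Y (q.2 : V) = (0 : ℝ) :=
  q.2.2 _ (Submodule.subset_span (by simp))

theorem linearIndependent_chart (p : Stiefel2 V) (q : p.ChartSpace) :
    LinearIndependent ℝ ![p.X + q.1, p.Y + q.2] := by
  refine LinearIndependent.pair_iff.2 fun s t h => ?_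
  have h1 := congrArg (fun z => (inner ℝ p.X z : ℝ)) h
  simp only [inner_add_right, real_inner_smul_right, p.inner_X_X, p.inner_X_fst, p.inner_X_Y,
    p.inner_X_snd, inner_zero_right] at h1
  have hs : s = 0 := by linarith
  have h2 := congrArg (fun z => (inner ℝ p.Y z : ℝ)) h
  simp only [hs, inner_add_right, real_inner_smul_right, p.inner_Y_Y, p.inner_Y_snd,
    inner_zero_right] at h2
  exact ⟨hs, by linarith⟩

/-- The chart of the Stiefel manifold around `p = (X, Y)`, orthonormalizing the pair
`(X + a, Y + b)`. -/
noncomputable def chart (p : Stiefel2 V) (q : p.ChartSpace) : Stiefel2 V :=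
  gramSchmidt (p.X + q.1) (p.Y + q.2) (p.linearIndependent_chart q)

theorem contDiff_chart (p : Stiefel2 V) : ContDiff ℝ ∞ (incl ∘ p.chart) := by
  have h1 : ContDiff ℝ ∞ fun q : p.ChartSpace => p.X + (q.1 : V) :=
    contDiff_const.add ((Submodule.subtypeL (Submodule.span ℝ {p.X})ᗮ).contDiff.comp contDiff_fst)
  have h2 : ContDiff ℝ ∞ fun q : p.ChartSpace => p.Y + (q.2 : V) :=
    contDiff_const.add
      ((Submodule.subtypeL (Submodule.span ℝ {p.X, p.Y})ᗮ).contDiff.comp contDiff_snd)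
  have hX : ContDiff ℝ ∞ fun q : p.ChartSpace => ‖p.X + (q.1 : V)‖⁻¹ • (p.X + (q.1 : V)) := by
    have hne : ∀ q : p.ChartSpace, p.X + (q.1 : V) ≠ 0 := fun q => by
      simpa using (p.linearIndependent_chart q).ne_zero 0
    exact ((h1.norm ℝ hne).inv fun q => norm_ne_zero_iff.2 (hne q)).smul h1
  have hw := h2.sub ((hX.inner ℝ h2).smul hX)
  have hwne : ∀ q : p.ChartSpace, p.Y + (q.2 : V) -
      (inner ℝ (‖p.X + (q.1 : V)‖⁻¹ • (p.X + (q.1 : V))) (p.Y + (q.2 : V)) : ℝ) •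
        (‖p.X + (q.1 : V)‖⁻¹ • (p.X + (q.1 : V))) ≠ 0 := by
    intro q h0
    have := (p.chart q).norm_Y
    simp only [chart, gramSchmidt, h0] at this
    simp at this
  exact hX.prodMk (((hw.norm ℝ hwne).inv fun q => norm_ne_zero_iff.2 (hwne q)).smul hw)

theorem exists_chart_eq (p : Stiefel2 V) (q : p.ChartSpace) : ∃ c d s : ℝ, 0 < c ∧ 0 < d ∧
    (p.chart q).X = c • (p.X + (q.1 : V)) ∧
    (p.chart q).Y = d • (p.Y + (q.2 : V)) - s • (p.X + (q.1 : V)) := by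
  set w := p.Y + (q.2 : V) -
      (inner ℝ (‖p.X + (q.1 : V)‖⁻¹ • (p.X + (q.1 : V))) (p.Y + (q.2 : V)) : ℝ) •
        (‖p.X + (q.1 : V)‖⁻¹ • (p.X + (q.1 : V))) with hw
  have hY : (p.chart q).Y = ‖w‖⁻¹ • w := rfl
  have hX : (p.chart q).X = ‖p.X + (q.1 : V)‖⁻¹ • (p.X + (q.1 : V)) := rfl
  refine ⟨‖p.X + (q.1 : V)‖⁻¹, ‖w‖⁻¹, ‖w‖⁻¹ *
    (inner ℝ (‖p.X + (q.1 : V)‖⁻¹ • (p.X + (q.1 : V))) (p.Y + (q.2 : V)) *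
      ‖p.X + (q.1 : V)‖⁻¹), ?_, ?_, hX, ?_⟩
  · refine inv_pos.2 (norm_pos_iff.2 fun h => ?_)
    have := (p.chart q).norm_X
    simp [hX, h] at this
  · refine inv_pos.2 (norm_pos_iff.2 fun h => ?_)
    have := (p.chart q).norm_Y
    simp [hY, h] at this
  · rw [hY, hw]
    module

/-- A tangent vector at `(X, Y)` is annihilated by the derivative of `g(X, Y)`. -/
theorem inner_fderiv_add {d : ℕ} (φ : LocalParametrization d (incl : Stiefel2 V → V × V))
    {u : EuclideanSpace ℝ (Fin d)} (hu : u ∈ φ.source) (c : EuclideanSpace ℝ (Fin d)) :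
    (inner ℝ (φ.toFun u).X (fderiv ℝ (incl ∘ φ.toFun) u c).2 +
      inner ℝ (fderiv ℝ (incl ∘ φ.toFun) u c).1 (φ.toFun u).Y : ℝ) = 0 := by
  have h := φ.hasFDerivAt hu
  have h1 := h.fst.inner ℝ h.snd
  have h2 : (fun w => (inner ℝ ((incl ∘ φ.toFun) w).1 ((incl ∘ φ.toFun) w).2 : ℝ)) =
      fun _ => 0 := funext fun w => (φ.toFun w).inner_X_Y
  rw [h2] at h1
  have h3 := congrArg (fun T => T c) (h1.unique (hasFDerivAt_const (0 : ℝ) u))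
  simpa [fderivInnerCLM_apply, incl] using h3

/-- The image of the chart around `p`. -/
theorem image_chart (p : Stiefel2 V) : p.chart '' Set.univ = {q : Stiefel2 V |
    0 < (inner ℝ p.X q.X : ℝ) ∧
    0 < (inner ℝ p.X q.X * inner ℝ p.Y q.Y - inner ℝ p.X q.Y * inner ℝ p.Y q.X : ℝ)} := by
  apply Set.Subset.antisymm
  · rintro _ ⟨q, -, rfl⟩
    obtain ⟨c, d, s, hc, hd, hX, hY⟩ := p.exists_chart_eq q
    have hXX : (inner ℝ p.X (p.X + q.1) : ℝ) = 1 := by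
      rw [inner_add_right, p.inner_X_X, p.inner_X_fst, add_zero]
    have hXY : (inner ℝ p.X (p.Y + q.2) : ℝ) = 0 := by
      rw [inner_add_right, p.inner_X_Y, p.inner_X_snd, add_zero]
    have hYY : (inner ℝ p.Y (p.Y + q.2) : ℝ) = 1 := by
      rw [inner_add_right, p.inner_Y_Y, p.inner_Y_snd, add_zero]
    simp only [Set.mem_ofPred_eq, hX, hY, inner_sub_right, real_inner_smul_right, hXX, hXY, hYY]
    refine ⟨by linarith, ?_⟩
    ring_nf
    positivity
  · rintro q ⟨hα, hΔ⟩
    set α : ℝ := inner ℝ p.X q.X with hαd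
    set β : ℝ := inner ℝ p.X q.Y with hβd
    set Δ : ℝ := α * inner ℝ p.Y q.Y - β * inner ℝ p.Y q.X with hΔd
    have ha : α⁻¹ • q.X - p.X ∈ (Submodule.span ℝ {p.X})ᗮ := by
      rw [Submodule.mem_orthogonal_singleton_iff_inner_right, inner_sub_right,
        real_inner_smul_right, p.inner_X_X, ← hαd, inv_mul_cancel₀ hα.ne', sub_self]
    have hb : Δ⁻¹ • (α • q.Y - β • q.X) - p.Y ∈ (Submodule.span ℝ {p.X, p.Y})ᗮ := by
      rw [Submodule.mem_orthogonal]
      intro z hz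
      obtain ⟨s, t, rfl⟩ := Submodule.mem_span_pair.1 hz
      have h1 : (inner ℝ p.X (Δ⁻¹ • (α • q.Y - β • q.X) - p.Y) : ℝ) = 0 := by
        rw [inner_sub_right, real_inner_smul_right, inner_sub_right, real_inner_smul_right,
          real_inner_smul_right, p.inner_X_Y, ← hαd, ← hβd]
        ring
      have h2 : (inner ℝ p.Y (Δ⁻¹ • (α • q.Y - β • q.X) - p.Y) : ℝ) = 0 := by
        rw [inner_sub_right, real_inner_smul_right, inner_sub_right, real_inner_smul_right,
          real_inner_smul_right, p.inner_Y_Y, ← hΔd, inv_mul_cancel₀ hΔ.ne', sub_self]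
      rw [inner_add_left, real_inner_smul_left, real_inner_smul_left, h1, h2]
      ring
    refine ⟨(⟨_, ha⟩, ⟨_, hb⟩), trivial, incl_injective ?_⟩
    have hX : ‖α⁻¹ • q.X‖⁻¹ • (α⁻¹ • q.X) = q.X := normalize_smul (inv_pos.2 hα) q.norm_X
    have hw : Δ⁻¹ • (α • q.Y - β • q.X) -
        (inner ℝ q.X (Δ⁻¹ • (α • q.Y - β • q.X)) : ℝ) • q.X = (Δ⁻¹ * α) • q.Y := by
      rw [real_inner_smul_right, inner_sub_right, real_inner_smul_right, real_inner_smul_right,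
        q.inner_X_X, q.inner_X_Y]
      module
    simp only [incl, chart, gramSchmidt, add_sub_cancel, hX, hw]
    rw [normalize_smul (mul_pos (inv_pos.2 hΔ) hα) q.norm_Y]

theorem isOpen_image_chart (p : Stiefel2 V) : IsOpen (p.chart '' Set.univ) := by
  have := continuous_X (V := V)
  have := continuous_Y (V := V)
  rw [image_chart]
  refine IsOpen.and (isOpen_lt continuous_const ?_) (isOpen_lt continuous_const ?_) <;> fun_prop

theorem chart_mem (p : Stiefel2 V) (q : p.ChartSpace) :
    0 < (inner ℝ p.X (p.chart q).X : ℝ) ∧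
    0 < (inner ℝ p.X (p.chart q).X * inner ℝ p.Y (p.chart q).Y -
      inner ℝ p.X (p.chart q).Y * inner ℝ p.Y (p.chart q).X : ℝ) := by
  have : p.chart q ∈ p.chart '' Set.univ := ⟨q, trivial, rfl⟩
  rwa [image_chart] at this

section FiniteDimensional

variable [FiniteDimensional ℝ V]

/-- Orthonormal frames are permuted transitively by the orthogonal group. -/
theorem exists_map_eq (p q : Stiefel2 V) : ∃ e : V ≃ₗᵢ[ℝ] V, map e p = q := by
  have key : ∀ p : Stiefel2 V, ∃ b : OrthonormalBasis (Fin (finrank ℝ V)) ℝ V,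
      ∃ h : 2 ≤ finrank ℝ V, b ⟨0, by lia⟩ = p.X ∧ b ⟨1, by lia⟩ = p.Y := by
    intro p
    have h2 : 2 ≤ finrank ℝ V := by
      simpa using p.linearIndependent.fintype_card_le_finrank
    let v : Fin (finrank ℝ V) → V := fun i => if (i : ℕ) = 0 then p.X else p.Y
    let s : Set (Fin (finrank ℝ V)) := {⟨0, by lia⟩, ⟨1, by lia⟩}
    have hv : Orthonormal ℝ (s.domRestrict v) := by
      constructor
      · rintro ⟨i, hi⟩
        rcases hi with rfl | rfl
        · simp [v, p.norm_X]
        · simp [v, p.norm_Y]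
      · rintro ⟨i, hi⟩ ⟨j, hj⟩ hij
        rcases hi with rfl | rfl <;> rcases hj with rfl | rfl
        · exact absurd rfl hij
        · simp [v, p.inner_X_Y]
        · simp [v, real_inner_comm, p.inner_X_Y]
        · exact absurd rfl hij
    obtain ⟨b, hb⟩ := hv.exists_orthonormalBasis_extension_of_card_eq (by simp)
    refine ⟨b, h2, ?_, ?_⟩
    · rw [hb _ (by simp [s])]; simp [v]
    · rw [hb _ (by simp [s])]; simp [v]
  obtain ⟨b, h, hb0, hb1⟩ := key p
  obtain ⟨b', h', hb0', hb1'⟩ := key q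
  refine ⟨b.equiv b' (Equiv.refl _), incl_injective ?_⟩
  simp [incl, map, ← hb0, ← hb1, ← hb0', ← hb1']

theorem finrank_chartSpace (p : Stiefel2 V) :
    finrank ℝ p.ChartSpace = 2 * finrank ℝ V - 3 := by
  have h1 := (Submodule.span ℝ {p.X}).finrank_add_finrank_orthogonal
  have h2 := (Submodule.span ℝ {p.X, p.Y}).finrank_add_finrank_orthogonal
  have h3 : finrank ℝ (Submodule.span ℝ {p.X}) = 1 :=
    finrank_span_singleton (by rw [← norm_ne_zero_iff, p.norm_X]; exact one_ne_zero)
  have h4 : finrank ℝ (Submodule.span ℝ {p.X, p.Y}) = 2 := p.toGrassmannian.finrank_eq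
  rw [finrank_prod]
  lia

/-- The left inverse of the chart around `p`. -/
noncomputable def chartInv (p : Stiefel2 V) (q : V × V) : p.ChartSpace :=
  ((Submodule.span ℝ {p.X})ᗮ.orthogonalProjectionOnto ((inner ℝ p.X q.1 : ℝ)⁻¹ • q.1),
    (Submodule.span ℝ {p.X, p.Y})ᗮ.orthogonalProjectionOnto
      ((inner ℝ p.X q.1 * inner ℝ p.Y q.2 - inner ℝ p.X q.2 * inner ℝ p.Y q.1 : ℝ)⁻¹ •
        ((inner ℝ p.X q.1 : ℝ) • q.2 - (inner ℝ p.X q.2 : ℝ) • q.1)))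

theorem differentiableAt_chartInv (p : Stiefel2 V) (q : V × V) (h1 : inner ℝ p.X q.1 ≠ (0 : ℝ))
    (h2 : (inner ℝ p.X q.1 * inner ℝ p.Y q.2 - inner ℝ p.X q.2 * inner ℝ p.Y q.1 : ℝ) ≠ 0) :
    DifferentiableAt ℝ p.chartInv q := by
  unfold chartInv
  have e1 : ∀ v : V, DifferentiableAt ℝ (fun q : V × V => (inner ℝ v q.1 : ℝ)) q := fun v =>
    (innerSL ℝ v).differentiableAt.comp q differentiableAt_fst
  have e2 : ∀ v : V, DifferentiableAt ℝ (fun q : V × V => (inner ℝ v q.2 : ℝ)) q := fun v =>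
    (innerSL ℝ v).differentiableAt.comp q differentiableAt_snd
  refine DifferentiableAt.prodMk ?_ ?_
  · exact (ContinuousLinearMap.differentiableAt _).comp q
      (((e1 p.X).inv h1).smul differentiableAt_fst)
  · exact (ContinuousLinearMap.differentiableAt _).comp q
      (((((e1 p.X).mul (e2 p.Y)).sub ((e2 p.X).mul (e1 p.Y))).inv h2).smul
        (((e1 p.X).smul differentiableAt_snd).sub ((e2 p.X).smul differentiableAt_fst)))

theorem chartInv_chart (p : Stiefel2 V) (q : p.ChartSpace) : p.chartInv (incl (p.chart q)) = q := by
  obtain ⟨c, d, s, hc, hd, hX, hY⟩ := p.exists_chart_eq q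
  have hXX : (inner ℝ p.X (p.X + q.1) : ℝ) = 1 := by
    rw [inner_add_right, p.inner_X_X, p.inner_X_fst, add_zero]
  have hXY : (inner ℝ p.X (p.Y + q.2) : ℝ) = 0 := by
    rw [inner_add_right, p.inner_X_Y, p.inner_X_snd, add_zero]
  have hYY : (inner ℝ p.Y (p.Y + q.2) : ℝ) = 1 := by
    rw [inner_add_right, p.inner_Y_Y, p.inner_Y_snd, add_zero]
  set u := p.X + (q.1 : V) with hu
  set v := p.Y + (q.2 : V) with hv
  have h1 : (inner ℝ p.X (c • u) : ℝ) = c := by rw [real_inner_smul_right, hXX, mul_one]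
  have h2 : (inner ℝ p.X (d • v - s • u) : ℝ) = -s := by
    rw [inner_sub_right, real_inner_smul_right, real_inner_smul_right, hXX, hXY]; ring
  have h3 : (c * inner ℝ p.Y (d • v - s • u) - -s * inner ℝ p.Y (c • u) : ℝ) = c * d := by
    rw [inner_sub_right, real_inner_smul_right, real_inner_smul_right, real_inner_smul_right, hYY]
    ring
  simp only [chartInv, incl, hX, hY, h1, h2, h3]
  refine Prod.ext ?_ ?_
  · rw [smul_smul, inv_mul_cancel₀ hc.ne', one_smul, hu, map_add,
      Submodule.orthogonalProjectionOnto_mem_subspace_eq_self,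
      Submodule.orthogonalProjectionOnto_orthogonal_apply_eq_zero, zero_add]
    exact Submodule.mem_span_singleton_self _
  · have : c • (d • v - s • u) - -s • (c • u) = (c * d) • v := by module
    dsimp only
    rw [this, smul_smul, inv_mul_cancel₀ (mul_pos hc hd).ne', one_smul, hv, map_add,
      Submodule.orthogonalProjectionOnto_mem_subspace_eq_self,
      Submodule.orthogonalProjectionOnto_orthogonal_apply_eq_zero, zero_add]
    exact Submodule.subset_span (by simp)

/-- The local parametrization of the Stiefel manifold around the frame `p`. -/
noncomputable def localParametrization (p : Stiefel2 V) :
    LocalParametrization (2 * finrank ℝ V - 3) (incl : Stiefel2 V → V × V) :=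
  LocalParametrization.ofLeftInverse p.finrank_chartSpace isInducing_incl Set.univ isOpen_univ
    p.chart p.contDiff_chart.contDiffOn p.isOpen_image_chart p.chartInv
    (fun q _ => p.chartInv_chart q)
    (fun q _ => p.differentiableAt_chartInv _ (p.chart_mem q).1.ne' (p.chart_mem q).2.ne')

theorem mem_image_localParametrization (p : Stiefel2 V) :
    p ∈ p.localParametrization.toFun '' p.localParametrization.source := by
  rw [localParametrization, LocalParametrization.image_ofLeftInverse, image_chart]
  simp only [Set.mem_ofPred_eq, p.inner_X_X, p.inner_X_Y, p.inner_Y_Y]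
  norm_num

theorem volFS_univ_lt_top : (volFS : Measure (Stiefel2 V)) Set.univ < ⊤ :=
  LocalParametrization.riemannianVolume_univ_lt_top isBilinearMetric_fubiniStudy
    isContinuousMetric_fubiniStudy fun p => ⟨_, p.mem_image_localParametrization⟩

theorem volFS_univ_pos (p : Stiefel2 V) : 0 < (volFS : Measure (Stiefel2 V)) Set.univ := by
  obtain ⟨u, hu, -⟩ := p.mem_image_localParametrization
  refine LocalParametrization.riemannianVolume_univ_pos isBilinearMetric_fubiniStudy
    isContinuousMetric_fubiniStudy ?_ p.localParametrization hu ?_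
  · intro q v w
    simp only [fubiniStudy, real_inner_comm w.1, real_inner_comm w.2]
    ring
  · intro c hc
    have htan := inner_fderiv_add p.localParametrization hu c
    set D := fderiv ℝ (incl ∘ p.localParametrization.toFun) u c
    set q := p.localParametrization.toFun u
    have hCS : (inner ℝ q.Y D.1 : ℝ) ^ 2 ≤ ‖D.1‖ ^ 2 := by
      have := abs_real_inner_le_norm q.Y D.1
      rw [q.norm_Y, one_mul] at this
      exact sq_le_sq' (by linarith [neg_abs_le (inner ℝ q.Y D.1 : ℝ)]) ((le_abs_self _).trans this)
    simp only [fubiniStudy, real_inner_self_eq_norm_sq]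
    by_cases h2 : D.2 = 0
    · have h1 : D.1 ≠ 0 := fun h1 => hc (Prod.ext h1 h2)
      rw [h2, inner_zero_right, zero_add, real_inner_comm] at htan
      rw [htan, h2]
      have := norm_pos_iff.2 h1
      simp only [norm_zero]
      nlinarith [pow_pos this 2]
    · have := norm_pos_iff.2 h2
      nlinarith [sq_nonneg ‖D.2‖, pow_pos this 2]

end FiniteDimensional

end Stiefel2

end

/-! ### The Grassmannian -/

section

variable {V : Type*} [NormedAddCommGroup V] [InnerProductSpace ℝ V]

namespace Grassmannian2

theorem plane_injective : Function.Injective (plane : Grassmannian2 V → Submodule ℝ V) := by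
  rintro ⟨P, _⟩ ⟨Q, _⟩ h
  simp only at h
  subst h
  rfl

theorem exists_toGrassmannian_eq (P : Grassmannian2 V) : ∃ p : Stiefel2 V, p.toGrassmannian = P := by
  obtain ⟨⟨u, v⟩, h, hspan⟩ := P.exists_basis
  exact ⟨Stiefel2.gramSchmidt u v h,
    plane_injective ((Stiefel2.span_gramSchmidt u v h).trans hspan)⟩

/-- The sectional curvature of a plane computed in an orthonormal frame. -/
theorem sec_toGrassmannian (R : AlgebraicCurvatureTensor V) (p : Stiefel2 V) :
    sec R p.toGrassmannian = Stiefel2.sec R p := by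
  rw [sec_eq R p.toGrassmannian p.X p.Y rfl, AlgebraicCurvatureTensor.sectionalQuotient,
    p.inner_X_X, p.inner_Y_Y, p.inner_X_Y, Stiefel2.sec]
  norm_num

/-- The action of a linear isometry on planes. -/
def map (e : V ≃ₗᵢ[ℝ] V) (P : Grassmannian2 V) : Grassmannian2 V where
  plane := P.plane.map (e.toLinearEquiv : V →ₗ[ℝ] V)
  finrank_eq := by rw [LinearEquiv.finrank_map_eq, P.finrank_eq]

theorem map_toGrassmannian (e : V ≃ₗᵢ[ℝ] V) (p : Stiefel2 V) :
    map e p.toGrassmannian = (p.map e).toGrassmannian := by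
  apply plane_injective
  simp [map, Stiefel2.toGrassmannian, Stiefel2.map, Submodule.map_span, Set.image_pair]

/-- The operator `Z ↦ g(X, Z) X + g(Y, Z) Y`. -/
noncomputable def frameOperator (q : V × V) : V →L[ℝ] V :=
  (innerSL ℝ q.1).smulRight q.1 + (innerSL ℝ q.2).smulRight q.2

theorem frameOperator_apply (q : V × V) (x : V) :
    frameOperator q x = (inner ℝ q.1 x : ℝ) • q.1 + (inner ℝ q.2 x : ℝ) • q.2 := rfl

theorem contDiff_frameOperator : ContDiff ℝ ∞ (frameOperator (V := V)) := by
  have h1 : ContDiff ℝ ∞ fun q : V × V => (innerSL ℝ q.1).smulRight q.1 :=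
    (((innerSL ℝ).contDiff.comp contDiff_fst).smulRight contDiff_fst)
  have h2 : ContDiff ℝ ∞ fun q : V × V => (innerSL ℝ q.2).smulRight q.2 :=
    (((innerSL ℝ).contDiff.comp contDiff_snd).smulRight contDiff_snd)
  exact h1.add h2

theorem isBilinearMetric_fubiniStudy : IsBilinearMetric (fubiniStudy (V := V)) := by
  refine ⟨fun P => LinearMap.mk₂ ℝ (fubiniStudy P) ?_ ?_ ?_ ?_, fun _ _ _ => rfl⟩
  · intro a b c
    simp [fubiniStudy, mul_add]
  · intro c a b
    simp [fubiniStudy]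
    ring
  · intro a b c
    simp [fubiniStudy, mul_add]
  · intro c a b
    simp [fubiniStudy]
    ring

variable [FiniteDimensional ℝ V]

theorem isInducing_proj : IsInducing (proj : Grassmannian2 V → V →L[ℝ] V) := ⟨rfl⟩

theorem proj_injective : Function.Injective (proj : Grassmannian2 V → V →L[ℝ] V) := by
  intro P Q h
  apply plane_injective
  have h2 := congrArg (fun F : V →L[ℝ] V => (F : V →ₗ[ℝ] V).range) h
  simpa [proj] using h2

instance : T2Space (Grassmannian2 V) :=
  T2Space.of_injective_continuous proj_injective isInducing_proj.continuous

instance : SecondCountableTopology (Grassmannian2 V) :=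
  isInducing_proj.secondCountableTopology

theorem proj_toGrassmannian (p : Stiefel2 V) :
    proj p.toGrassmannian = frameOperator (Stiefel2.incl p) := by
  ext x
  refine Submodule.eq_starProjection_of_mem_of_inner_eq_zero
    (K := p.toGrassmannian.plane) (u := x) ?_ ?_
  · exact Submodule.mem_span_pair.2 ⟨_, _, rfl⟩
  · intro w hw
    obtain ⟨s, t, rfl⟩ := Submodule.mem_span_pair.1 hw
    have hYX : (inner ℝ p.Y p.X : ℝ) = 0 := by rw [real_inner_comm, p.inner_X_Y]
    simp only [frameOperator_apply, Stiefel2.incl, inner_sub_left, inner_add_left, inner_add_right,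
      real_inner_smul_left, real_inner_smul_right, p.inner_X_X, p.inner_X_Y, p.inner_Y_Y, hYX,
      real_inner_comm p.X x, real_inner_comm p.Y x]
    ring

theorem continuous_toGrassmannian :
    Continuous (Stiefel2.toGrassmannian : Stiefel2 V → Grassmannian2 V) := by
  rw [isInducing_proj.continuous_iff]
  have : proj ∘ Stiefel2.toGrassmannian = frameOperator ∘ (Stiefel2.incl : Stiefel2 V → V × V) :=
    funext proj_toGrassmannian
  rw [this]
  exact contDiff_frameOperator.continuous.comp Stiefel2.isInducing_incl.continuous

theorem isQuotientMap_toGrassmannian :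
    IsQuotientMap (Stiefel2.toGrassmannian : Stiefel2 V → Grassmannian2 V) :=
  continuous_toGrassmannian.isClosedMap.isQuotientMap continuous_toGrassmannian
    exists_toGrassmannian_eq

instance : CompactSpace (Grassmannian2 V) := by
  refine ⟨?_⟩
  rw [← Set.range_eq_univ.2 (exists_toGrassmannian_eq (V := V))]
  exact isCompact_range continuous_toGrassmannian

theorem continuous_map (e : V ≃ₗᵢ[ℝ] V) : Continuous (map e) := by
  rw [isQuotientMap_toGrassmannian.continuous_iff]
  have : map e ∘ Stiefel2.toGrassmannian = Stiefel2.toGrassmannian ∘ Stiefel2.map e :=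
    funext (map_toGrassmannian e)
  rw [this]
  exact continuous_toGrassmannian.comp (Stiefel2.continuous_map e)

/-- The action of a linear isometry on planes, as a homeomorphism. -/
def mapHomeomorph (e : V ≃ₗᵢ[ℝ] V) : Grassmannian2 V ≃ₜ Grassmannian2 V where
  toFun := map e
  invFun := map e.symm
  left_inv P := plane_injective (by
    simp only [map, ← Submodule.map_comp]
    convert Submodule.map_id _
    ext x
    simp)
  right_inv P := plane_injective (by
    simp only [map, ← Submodule.map_comp]
    convert Submodule.map_id _
    ext x
    simp)
  continuous_toFun := continuous_map e
  continuous_invFun := continuous_map e.symm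

theorem proj_map (e : V ≃ₗᵢ[ℝ] V) (P : Grassmannian2 V) :
    proj (map e P) =
      e.toContinuousLinearEquiv.arrowCongr e.toContinuousLinearEquiv (proj P) := by
  ext x
  exact Submodule.starProjection_map_apply e P.plane x

theorem isContinuousMetric_fubiniStudy : IsContinuousMetric (fubiniStudy (V := V)) := by
  unfold IsContinuousMetric fubiniStudy
  have h : Continuous fun F : V →L[ℝ] V => LinearMap.trace ℝ V (F : V →ₗ[ℝ] V) :=
    LinearMap.continuous_of_finiteDimensional
      ((LinearMap.trace ℝ V).comp (ContinuousLinearMap.coeLM ℝ))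
  exact continuous_const.mul (h.comp (by fun_prop))

/-- The Fubini–Study volume on the Grassmannian is invariant under the orthogonal group. -/
theorem map_volFS (e : V ≃ₗᵢ[ℝ] V) :
    (volFS : Measure (Grassmannian2 V)).map (map e) = volFS := by
  refine LocalParametrization.map_riemannianVolume (mapHomeomorph e)
    (e.toContinuousLinearEquiv.arrowCongr e.toContinuousLinearEquiv) (proj_map e) ?_
  intro P F F'
  have : ((e.toContinuousLinearEquiv.arrowCongr e.toContinuousLinearEquiv F ∘L
      e.toContinuousLinearEquiv.arrowCongr e.toContinuousLinearEquiv F' : V →L[ℝ] V) :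
        V →ₗ[ℝ] V) = e.toLinearEquiv.conj ((F ∘L F' : V →L[ℝ] V) : V →ₗ[ℝ] V) := by
    ext x
    simp [LinearEquiv.conj_apply]
  rw [fubiniStudy, this, LinearMap.trace_conj', fubiniStudy]

end Grassmannian2

namespace Stiefel2

/-- The parameter space of a chart of the Grassmannian around the plane spanned by a frame: pairs
of vectors orthogonal to the plane. -/
abbrev PlaneChartSpace (p : Stiefel2 V) : Type _ :=
  (Submodule.span ℝ {p.X, p.Y})ᗮ × (Submodule.span ℝ {p.X, p.Y})ᗮ

theorem finrank_planeChartSpace [FiniteDimensional ℝ V] (p : Stiefel2 V) :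
    finrank ℝ p.PlaneChartSpace = 2 * (finrank ℝ V - 2) := by
  have h2 := (Submodule.span ℝ {p.X, p.Y}).finrank_add_finrank_orthogonal
  have h4 : finrank ℝ (Submodule.span ℝ {p.X, p.Y}) = 2 := p.toGrassmannian.finrank_eq
  rw [finrank_prod]
  lia

theorem orthogonal_span_le (p : Stiefel2 V) :
    (Submodule.span ℝ {p.X, p.Y})ᗮ ≤ (Submodule.span ℝ {p.X})ᗮ :=
  Submodule.orthogonal_le (Submodule.span_mono (by simp))

/-- The parameter space of the chart of the Grassmannian as a subspace of the parameter space of the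
chart of the Stiefel manifold. -/
noncomputable def planeChartIncl (p : Stiefel2 V) (q : p.PlaneChartSpace) : p.ChartSpace :=
  (⟨q.1, p.orthogonal_span_le q.1.2⟩, q.2)

/-- The frame obtained by orthonormalizing `(X + a, Y + b)`. -/
noncomputable def planeChartFrame (p : Stiefel2 V) (q : p.PlaneChartSpace) : Stiefel2 V :=
  p.chart (p.planeChartIncl q)

theorem contDiff_planeChartFrame (p : Stiefel2 V) : ContDiff ℝ ∞ (incl ∘ p.planeChartFrame) := by
  refine p.contDiff_chart.comp (ContDiff.prodMk ?_ contDiff_snd)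
  exact ((Submodule.subtypeL (Submodule.span ℝ {p.X, p.Y})ᗮ).codRestrict
    (Submodule.span ℝ {p.X})ᗮ fun x => p.orthogonal_span_le x.2).contDiff.comp contDiff_fst

/-- The chart of the Grassmannian around the plane spanned by the frame `p = (X, Y)`, mapping
`(a, b)` to the plane spanned by `X + a` and `Y + b`. -/
noncomputable def planeChart (p : Stiefel2 V) (q : p.PlaneChartSpace) : Grassmannian2 V :=
  (p.planeChartFrame q).toGrassmannian

theorem plane_planeChart (p : Stiefel2 V) (q : p.PlaneChartSpace) :
    (p.planeChart q).plane = Submodule.span ℝ {p.X + (q.1 : V), p.Y + (q.2 : V)} :=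
  span_gramSchmidt _ _ (p.linearIndependent_chart (p.planeChartIncl q))

/-- The Gram determinant of the projections of `X` and `Y` to a plane with projection `F`. It does
not vanish exactly for the planes which project isomorphically to the plane spanned by `X, Y`. -/
noncomputable def planeDet (p : Stiefel2 V) (F : V →L[ℝ] V) : ℝ :=
  inner ℝ p.X (F p.X) * inner ℝ p.Y (F p.Y) - inner ℝ p.X (F p.Y) * inner ℝ p.Y (F p.X)

/-- A vector in the plane spanned by `X + a` and `Y + b` is determined by its projection to the
plane spanned by `X` and `Y`. -/
theorem eq_of_mem_planeChart (p : Stiefel2 V) (q : p.PlaneChartSpace) {z : V}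
    (hz : z ∈ (p.planeChart q).plane) :
    z = (inner ℝ p.X z : ℝ) • (p.X + (q.1 : V)) + (inner ℝ p.Y z : ℝ) • (p.Y + (q.2 : V)) := by
  rw [plane_planeChart] at hz
  obtain ⟨s, t, rfl⟩ := Submodule.mem_span_pair.1 hz
  have hX1 : (inner ℝ p.X (q.1 : V) : ℝ) = 0 := q.1.2 _ (Submodule.subset_span (by simp))
  have hX2 : (inner ℝ p.X (q.2 : V) : ℝ) = 0 := q.2.2 _ (Submodule.subset_span (by simp))
  have hY1 : (inner ℝ p.Y (q.1 : V) : ℝ) = 0 := q.1.2 _ (Submodule.subset_span (by simp))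
  have hY2 : (inner ℝ p.Y (q.2 : V) : ℝ) = 0 := q.2.2 _ (Submodule.subset_span (by simp))
  have hYX : (inner ℝ p.Y p.X : ℝ) = 0 := by rw [real_inner_comm, p.inner_X_Y]
  simp only [inner_add_right, real_inner_smul_right, hX1, hX2, hY1, hY2, hYX, p.inner_X_X,
    p.inner_X_Y, p.inner_Y_Y]
  simp

variable [FiniteDimensional ℝ V]

/-- The left inverse of the chart of the Grassmannian around the plane spanned by `p = (X, Y)`: by
Cramer's rule one finds the combinations `X + a` and `Y + b` of the projections of `X` and `Y`. -/
noncomputable def planeChartInv (p : Stiefel2 V) (F : V →L[ℝ] V) : p.PlaneChartSpace :=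
  ((Submodule.span ℝ {p.X, p.Y})ᗮ.orthogonalProjectionOnto ((p.planeDet F)⁻¹ •
      ((inner ℝ p.Y (F p.Y) : ℝ) • F p.X - (inner ℝ p.Y (F p.X) : ℝ) • F p.Y)),
    (Submodule.span ℝ {p.X, p.Y})ᗮ.orthogonalProjectionOnto ((p.planeDet F)⁻¹ •
      ((inner ℝ p.X (F p.X) : ℝ) • F p.Y - (inner ℝ p.X (F p.Y) : ℝ) • F p.X)))

theorem differentiableAt_planeChartInv (p : Stiefel2 V) (F : V →L[ℝ] V) (h : p.planeDet F ≠ 0) :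
    DifferentiableAt ℝ p.planeChartInv F := by
  have e0 : ∀ v : V, DifferentiableAt ℝ (fun F : V →L[ℝ] V => F v) F := fun v => by fun_prop
  have e1 : ∀ v w : V, DifferentiableAt ℝ (fun F : V →L[ℝ] V => (inner ℝ w (F v) : ℝ)) F :=
    fun v w => (innerSL ℝ w).differentiableAt.comp F (e0 v)
  have e2 : DifferentiableAt ℝ p.planeDet F :=
    ((e1 _ _).mul (e1 _ _)).sub ((e1 _ _).mul (e1 _ _))
  refine DifferentiableAt.prodMk ?_ ?_
  · exact (ContinuousLinearMap.differentiableAt _).comp F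
      ((e2.inv h).smul (((e1 _ _).smul (e0 _)).sub ((e1 _ _).smul (e0 _))))
  · exact (ContinuousLinearMap.differentiableAt _).comp F
      ((e2.inv h).smul (((e1 _ _).smul (e0 _)).sub ((e1 _ _).smul (e0 _))))

theorem contDiff_planeChart (p : Stiefel2 V) :
    ContDiff ℝ ∞ (Grassmannian2.proj ∘ p.planeChart) := by
  have : Grassmannian2.proj ∘ p.planeChart =
      Grassmannian2.frameOperator ∘ (incl ∘ p.planeChartFrame) :=
    funext fun q => Grassmannian2.proj_toGrassmannian _
  rw [this]
  exact Grassmannian2.contDiff_frameOperator.comp p.contDiff_planeChartFrame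

theorem planeDet_toGrassmannian (p q : Stiefel2 V) : p.planeDet q.toGrassmannian.proj =
    (inner ℝ p.X q.X * inner ℝ p.Y q.Y - inner ℝ p.X q.Y * inner ℝ p.Y q.X) ^ 2 := by
  simp only [planeDet, Grassmannian2.proj_toGrassmannian, Grassmannian2.frameOperator_apply, incl,
    inner_add_right, real_inner_smul_right, real_inner_comm p.X q.X, real_inner_comm p.X q.Y,
    real_inner_comm p.Y q.X, real_inner_comm p.Y q.Y]
  ring

theorem planeDet_planeChart_ne_zero (p : Stiefel2 V) (q : p.PlaneChartSpace) :
    p.planeDet (p.planeChart q).proj ≠ 0 := by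
  rw [planeChart, planeDet_toGrassmannian]
  exact pow_ne_zero 2 (p.chart_mem _).2.ne'

theorem planeChartInv_planeChart (p : Stiefel2 V) (q : p.PlaneChartSpace) :
    p.planeChartInv (p.planeChart q).proj = q := by
  have hdet := p.planeDet_planeChart_ne_zero q
  set F := (p.planeChart q).proj with hF
  have hFX := p.eq_of_mem_planeChart q (z := F p.X) (Submodule.starProjection_apply_mem _ _)
  have hFY := p.eq_of_mem_planeChart q (z := F p.Y) (Submodule.starProjection_apply_mem _ _)
  have h1 : (inner ℝ p.Y (F p.Y) : ℝ) • F p.X - (inner ℝ p.Y (F p.X) : ℝ) • F p.Y =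
      p.planeDet F • (p.X + (q.1 : V)) := by
    calc _ = (inner ℝ p.Y (F p.Y) : ℝ) • ((inner ℝ p.X (F p.X) : ℝ) • (p.X + (q.1 : V)) +
            (inner ℝ p.Y (F p.X) : ℝ) • (p.Y + (q.2 : V))) -
          (inner ℝ p.Y (F p.X) : ℝ) • ((inner ℝ p.X (F p.Y) : ℝ) • (p.X + (q.1 : V)) +
            (inner ℝ p.Y (F p.Y) : ℝ) • (p.Y + (q.2 : V))) := by rw [← hFX, ← hFY]
      _ = _ := by rw [planeDet]; module
  have h2 : (inner ℝ p.X (F p.X) : ℝ) • F p.Y - (inner ℝ p.X (F p.Y) : ℝ) • F p.X =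
      p.planeDet F • (p.Y + (q.2 : V)) := by
    calc _ = (inner ℝ p.X (F p.X) : ℝ) • ((inner ℝ p.X (F p.Y) : ℝ) • (p.X + (q.1 : V)) +
            (inner ℝ p.Y (F p.Y) : ℝ) • (p.Y + (q.2 : V))) -
          (inner ℝ p.X (F p.Y) : ℝ) • ((inner ℝ p.X (F p.X) : ℝ) • (p.X + (q.1 : V)) +
            (inner ℝ p.Y (F p.X) : ℝ) • (p.Y + (q.2 : V))) := by rw [← hFX, ← hFY]
      _ = _ := by rw [planeDet]; module
  have hX : p.X ∈ Submodule.span ℝ {p.X, p.Y} := Submodule.subset_span (by simp)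
  have hY : p.Y ∈ Submodule.span ℝ {p.X, p.Y} := Submodule.subset_span (by simp)
  rw [planeChartInv, h1, h2, smul_smul, smul_smul, inv_mul_cancel₀ hdet, one_smul, one_smul,
    map_add, map_add, Submodule.orthogonalProjectionOnto_mem_subspace_eq_self,
    Submodule.orthogonalProjectionOnto_mem_subspace_eq_self,
    Submodule.orthogonalProjectionOnto_orthogonal_apply_eq_zero hX,
    Submodule.orthogonalProjectionOnto_orthogonal_apply_eq_zero hY, zero_add, zero_add]

theorem image_planeChart (p : Stiefel2 V) :
    p.planeChart '' Set.univ = {P : Grassmannian2 V | p.planeDet P.proj ≠ 0} := by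
  apply Set.Subset.antisymm
  · rintro _ ⟨q, -, rfl⟩
    exact p.planeDet_planeChart_ne_zero q
  · intro P hP
    simp only [Set.mem_ofPred_eq] at hP
    set F := P.proj with hF
    set u := (p.planeDet F)⁻¹ •
      ((inner ℝ p.Y (F p.Y) : ℝ) • F p.X - (inner ℝ p.Y (F p.X) : ℝ) • F p.Y) with hu
    set v := (p.planeDet F)⁻¹ •
      ((inner ℝ p.X (F p.X) : ℝ) • F p.Y - (inner ℝ p.X (F p.Y) : ℝ) • F p.X) with hv
    have hXmem : F p.X ∈ P.plane := Submodule.starProjection_apply_mem _ _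
    have hYmem : F p.Y ∈ P.plane := Submodule.starProjection_apply_mem _ _
    have huP : u ∈ P.plane := Submodule.smul_mem _ _
      (Submodule.sub_mem _ (Submodule.smul_mem _ _ hXmem) (Submodule.smul_mem _ _ hYmem))
    have hvP : v ∈ P.plane := Submodule.smul_mem _ _
      (Submodule.sub_mem _ (Submodule.smul_mem _ _ hYmem) (Submodule.smul_mem _ _ hXmem))
    have hYX : (inner ℝ p.Y p.X : ℝ) = 0 := by rw [real_inner_comm, p.inner_X_Y]
    have huX : (inner ℝ p.X u : ℝ) = 1 := by
      rw [hu, real_inner_smul_right, inner_sub_right, real_inner_smul_right, real_inner_smul_right,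
        ← inv_mul_cancel₀ hP, planeDet]
      ring
    have huY : (inner ℝ p.Y u : ℝ) = 0 := by
      rw [hu, real_inner_smul_right, inner_sub_right, real_inner_smul_right, real_inner_smul_right]
      ring
    have hvX : (inner ℝ p.X v : ℝ) = 0 := by
      rw [hv, real_inner_smul_right, inner_sub_right, real_inner_smul_right, real_inner_smul_right]
      ring
    have hvY : (inner ℝ p.Y v : ℝ) = 1 := by
      rw [hv, real_inner_smul_right, inner_sub_right, real_inner_smul_right, real_inner_smul_right,
        ← inv_mul_cancel₀ hP, planeDet]
    have ha : u - p.X ∈ (Submodule.span ℝ {p.X, p.Y})ᗮ := by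
      rw [Submodule.mem_orthogonal]
      intro z hz
      obtain ⟨s, t, rfl⟩ := Submodule.mem_span_pair.1 hz
      simp only [inner_add_left, real_inner_smul_left, inner_sub_right, huX, huY, p.inner_X_X, hYX]
      ring
    have hb : v - p.Y ∈ (Submodule.span ℝ {p.X, p.Y})ᗮ := by
      rw [Submodule.mem_orthogonal]
      intro z hz
      obtain ⟨s, t, rfl⟩ := Submodule.mem_span_pair.1 hz
      simp only [inner_add_left, real_inner_smul_left, inner_sub_right, hvX, hvY, p.inner_X_Y,
        p.inner_Y_Y]
      ring
    refine ⟨(⟨_, ha⟩, ⟨_, hb⟩), trivial, Grassmannian2.plane_injective ?_⟩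
    refine Submodule.eq_of_le_of_finrank_eq ?_
      ((p.planeChart _).finrank_eq.trans P.finrank_eq.symm)
    rw [plane_planeChart, Submodule.span_le, Set.insert_subset_iff, Set.singleton_subset_iff]
    simp only [add_sub_cancel]
    exact ⟨huP, hvP⟩

theorem isOpen_image_planeChart (p : Stiefel2 V) : IsOpen (p.planeChart '' Set.univ) := by
  have := Grassmannian2.isInducing_proj (V := V) |>.continuous
  rw [image_planeChart]
  refine isOpen_ne_fun ?_ continuous_const
  unfold planeDet
  fun_prop

/-- The local parametrization of the Grassmannian around the plane spanned by the frame `p`. -/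
noncomputable def planeParametrization (p : Stiefel2 V) :
    LocalParametrization (2 * (finrank ℝ V - 2)) (Grassmannian2.proj : Grassmannian2 V → V →L[ℝ] V) :=
  LocalParametrization.ofLeftInverse p.finrank_planeChartSpace Grassmannian2.isInducing_proj
    Set.univ isOpen_univ p.planeChart p.contDiff_planeChart.contDiffOn p.isOpen_image_planeChart
    p.planeChartInv (fun q _ => p.planeChartInv_planeChart q)
    (fun q _ => p.differentiableAt_planeChartInv _ (p.planeDet_planeChart_ne_zero q))

theorem mem_image_planeParametrization (p : Stiefel2 V) :
    p.toGrassmannian ∈ p.planeParametrization.toFun '' p.planeParametrization.source := by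
  rw [planeParametrization, LocalParametrization.image_ofLeftInverse, image_planeChart,
    Set.mem_ofPred_eq, planeDet_toGrassmannian, p.inner_X_X, p.inner_X_Y, p.inner_Y_Y]
  norm_num

end Stiefel2

namespace Grassmannian2

variable [FiniteDimensional ℝ V]

theorem volFS_univ_lt_top : (volFS : Measure (Grassmannian2 V)) Set.univ < ⊤ :=
  LocalParametrization.riemannianVolume_univ_lt_top isBilinearMetric_fubiniStudy
    isContinuousMetric_fubiniStudy fun P => by
      obtain ⟨p, rfl⟩ := P.exists_toGrassmannian_eq
      exact ⟨_, p.mem_image_planeParametrization⟩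

/-- Tangent vectors of the Grassmannian are symmetric endomorphisms. -/
theorem inner_fderiv_eq {d : ℕ}
    (φ : LocalParametrization d (proj : Grassmannian2 V → V →L[ℝ] V))
    {u : EuclideanSpace ℝ (Fin d)} (hu : u ∈ φ.source) (c : EuclideanSpace ℝ (Fin d)) (x y : V) :
    (inner ℝ x (fderiv ℝ (proj ∘ φ.toFun) u c y) : ℝ) =
      inner ℝ y (fderiv ℝ (proj ∘ φ.toFun) u c x) := by
  let L : (V →L[ℝ] V) →L[ℝ] ℝ :=
    (innerSL ℝ x).comp (ContinuousLinearMap.apply ℝ V y) -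
      (innerSL ℝ y).comp (ContinuousLinearMap.apply ℝ V x)
  have hL : ∀ F, L F = inner ℝ x (F y) - inner ℝ y (F x) := fun F => rfl
  have h1 := L.hasFDerivAt.comp u (φ.hasFDerivAt hu)
  have h2 : L ∘ proj ∘ φ.toFun = fun _ => 0 := by
    ext w
    rw [Function.comp_apply, hL, sub_eq_zero]
    exact (Submodule.inner_starProjection_left_eq_right (φ.toFun w).plane x y).symm.trans
      (real_inner_comm _ _)
  rw [h2] at h1
  have h3 := congrArg (fun T => T c) (h1.unique (hasFDerivAt_const (0 : ℝ) u))
  exact sub_eq_zero.1 h3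

theorem volFS_univ_pos (P : Grassmannian2 V) :
    0 < (volFS : Measure (Grassmannian2 V)) Set.univ := by
  obtain ⟨p, rfl⟩ := P.exists_toGrassmannian_eq
  obtain ⟨u, hu, -⟩ := p.mem_image_planeParametrization
  refine LocalParametrization.riemannianVolume_univ_pos isBilinearMetric_fubiniStudy
    isContinuousMetric_fubiniStudy ?_ p.planeParametrization hu ?_
  · intro Q F F'
    simp only [fubiniStudy, ContinuousLinearMap.toLinearMap_comp]
    rw [LinearMap.trace_comp_comm']
  · intro c hc
    have hsymm := inner_fderiv_eq p.planeParametrization hu c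
    set D := fderiv ℝ (proj ∘ p.planeParametrization.toFun) u c
    rw [fubiniStudy, LinearMap.trace_eq_sum_inner _ (stdOrthonormalBasis ℝ V)]
    refine mul_pos (by norm_num) ?_
    have hsq : ∀ i, (inner ℝ (stdOrthonormalBasis ℝ V i)
        (((D ∘L D : V →L[ℝ] V) : V →ₗ[ℝ] V) (stdOrthonormalBasis ℝ V i)) : ℝ) =
        ‖D (stdOrthonormalBasis ℝ V i)‖ ^ 2 := by
      intro i
      rw [← real_inner_self_eq_norm_sq]
      exact hsymm _ _
    simp only [hsq]
    refine lt_of_le_of_ne (Finset.sum_nonneg fun i _ => by positivity) fun h0 => hc ?_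
    rw [eq_comm, Finset.sum_eq_zero_iff_of_nonneg fun i _ => by positivity] at h0
    have : (D : V →ₗ[ℝ] V) = 0 := (stdOrthonormalBasis ℝ V).toBasis.ext fun i => by
      simpa using h0 i (Finset.mem_univ i)
    ext x
    exact LinearMap.congr_fun this x

end Grassmannian2

end

/-! ### Gaussian integrals of homogeneous functions -/

section

variable {V : Type*} [NormedAddCommGroup V] [InnerProductSpace ℝ V]

theorem laplacian_eq_sum_fderiv [FiniteDimensional ℝ V] {ι : Type*} [Fintype ι]
    (b : OrthonormalBasis ι ℝ V) {f : V → ℝ} {x : V} (hf : DifferentiableAt ℝ (fderiv ℝ f) x) :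
    (Laplacian.laplacian f : V → ℝ) x =
      ∑ i, fderiv ℝ (fun y => fderiv ℝ f y (b i)) x (b i) := by
  rw [InnerProductSpace.laplacian_eq_iteratedFDeriv_orthonormalBasis f b]
  refine Finset.sum_congr rfl fun i _ => ?_
  rw [iteratedFDeriv_two_apply, fderiv_clm_apply hf (differentiableAt_const _)]
  simp

/-- A smooth function on `V` which is positively homogeneous of degree `z`. -/
structure SmoothHomogeneous (z : ℤ) (f : V → ℝ) : Prop where
  contDiff : ContDiff ℝ ∞ f
  map_smul : ∀ t : ℝ, 0 < t → ∀ x, f (t • x) = t ^ z * f x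

namespace SmoothHomogeneous

variable {z z' : ℤ} {f g : V → ℝ}

theorem mul (hf : SmoothHomogeneous z f) (hg : SmoothHomogeneous z' g) :
    SmoothHomogeneous (z + z') fun x => f x * g x where
  contDiff := hf.contDiff.mul hg.contDiff
  map_smul t ht x := by
    rw [hf.map_smul t ht, hg.map_smul t ht, zpow_add₀ ht.ne']
    ring

theorem sum {ι : Type*} (s : Finset ι) {f : ι → V → ℝ} (hf : ∀ i ∈ s, SmoothHomogeneous z (f i)) :
    SmoothHomogeneous z fun x => ∑ i ∈ s, f i x where
  contDiff := ContDiff.sum fun i hi => (hf i hi).contDiff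
  map_smul t ht x := by
    rw [Finset.mul_sum]
    exact Finset.sum_congr rfl fun i hi => (hf i hi).map_smul t ht x

theorem pow (hf : SmoothHomogeneous z f) (n : ℕ) :
    SmoothHomogeneous (n * z) fun x => f x ^ n where
  contDiff := hf.contDiff.pow n
  map_smul t ht x := by
    rw [hf.map_smul t ht, mul_pow, mul_comm (n : ℤ), zpow_mul, zpow_natCast]

theorem linear (L : V →L[ℝ] ℝ) : SmoothHomogeneous 1 fun x => L x where
  contDiff := L.contDiff
  map_smul t _ x := by simp

theorem differentiable (hf : SmoothHomogeneous z f) : Differentiable ℝ f :=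
  hf.contDiff.differentiable (by simp)

theorem fderiv_apply (hf : SmoothHomogeneous z f) (v : V) :
    SmoothHomogeneous (z - 1) fun x => fderiv ℝ f x v where
  contDiff := (hf.contDiff.fderiv_right (by simp)).clm_apply contDiff_const
  map_smul t ht x := by
    have h1 : HasFDerivAt (fun y => f (t • y)) (t • fderiv ℝ f (t • x)) x := by
      have h : HasFDerivAt (fun y => f (t • y)) _ x :=
        (hf.differentiable (t • x)).hasFDerivAt.comp x ((hasFDerivAt_id x).const_smul t)
      refine h.congr_fderiv ?_
      ext y
      simp
    have h2 : HasFDerivAt (fun y => f (t • y)) (t ^ z • fderiv ℝ f x) x := by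
      rw [funext (hf.map_smul t ht)]
      exact (hf.differentiable x).hasFDerivAt.const_mul (t ^ z)
    have h3 := congrArg (fun T => T v) (h1.unique h2)
    simp only [_root_.smul_apply, smul_eq_mul] at h3
    rw [zpow_sub_one₀ ht.ne', mul_right_comm, ← h3]
    field_simp

theorem differentiable_fderiv (hf : SmoothHomogeneous z f) : Differentiable ℝ (fderiv ℝ f) :=
  (hf.contDiff.fderiv_right (m := ∞) (by simp)).differentiable (by simp)

/-- Euler's identity. -/
theorem fderiv_self (hf : SmoothHomogeneous z f) (x : V) : fderiv ℝ f x x = z * f x := by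
  have h1 : HasDerivAt (fun t : ℝ => f (t • x)) (fderiv ℝ f x x) 1 := by
    have h : HasDerivAt (fun t : ℝ => f (t • x)) _ 1 :=
      (hf.differentiable ((1 : ℝ) • x)).hasFDerivAt.comp_hasDerivAt 1
        ((hasDerivAt_id (1 : ℝ)).smul_const x)
    simpa using h
  have h2 : HasDerivAt (fun t : ℝ => f (t • x)) (z * f x) 1 := by
    have h := (hasDerivAt_zpow z (1 : ℝ) (Or.inl one_ne_zero)).mul_const (f x)
    simp only [one_zpow, mul_one] at h
    refine h.congr_of_eventuallyEq ?_
    filter_upwards [lt_mem_nhds (zero_lt_one (α := ℝ))] with t ht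
    exact hf.map_smul t ht x
  exact h1.unique h2

theorem eq_const (hf : SmoothHomogeneous 0 f) (x : V) : f x = f 0 := by
  have h1 : Tendsto (fun t : ℝ => f (t • x)) (𝓝[>] 0) (𝓝 (f 0)) := by
    have hc : Continuous fun t : ℝ => f (t • x) :=
      hf.contDiff.continuous.comp (continuous_id.smul continuous_const)
    have := hc.tendsto 0
    rw [zero_smul] at this
    exact this.mono_left nhdsWithin_le_nhds
  refine tendsto_nhds_unique (tendsto_const_nhds.congr' ?_) h1
  filter_upwards [self_mem_nhdsWithin] with t ht
  rw [hf.map_smul t ht, zpow_zero, one_mul]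

variable [FiniteDimensional ℝ V]

theorem laplacian (hf : SmoothHomogeneous z f) :
    SmoothHomogeneous (z - 2) (Laplacian.laplacian f : V → ℝ) := by
  have h : (Laplacian.laplacian f : V → ℝ) = _ := funext fun x =>
    laplacian_eq_sum_fderiv (stdOrthonormalBasis ℝ V) (hf.differentiable_fderiv x)
  rw [h, show z - 2 = z - 1 - 1 by ring]
  exact sum _ fun i _ => (hf.fderiv_apply _).fderiv_apply _

theorem laplacian_iterate (hf : SmoothHomogeneous z f) (k : ℕ) :
    SmoothHomogeneous (z - 2 * k) ((fun h : V → ℝ => (Laplacian.laplacian h : V → ℝ))^[k] f) := by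
  induction k with
  | zero => simpa using hf
  | succ k ih =>
    rw [Function.iterate_succ_apply', show z - 2 * ((k + 1 : ℕ) : ℤ) = z - 2 * k - 2 by
      push_cast; ring]
    exact ih.laplacian

/-- A homogeneous function is bounded by a multiple of a power of `1 + ‖x‖`. -/
theorem exists_bound (hf : SmoothHomogeneous z f) :
    ∃ (C : ℝ) (n : ℕ), 0 ≤ C ∧ ∀ x, |f x| ≤ C * (1 + ‖x‖) ^ n := by
  obtain ⟨C, hC⟩ := (isCompact_closedBall (0 : V) 1).exists_bound_of_continuousOn
    hf.contDiff.continuous.continuousOn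
  have hC0 : 0 ≤ C := (norm_nonneg _).trans (hC 0 (by simp))
  refine ⟨C, z.natAbs, hC0, fun x => ?_⟩
  have h1 : (1 : ℝ) ≤ (1 + ‖x‖) ^ z.natAbs := one_le_pow₀ (by linarith [norm_nonneg x])
  rcases le_or_gt ‖x‖ 1 with hx | hx
  · exact (hC x (by simpa using hx)).trans (le_mul_of_one_le_right hC0 h1)
  · have hx0 : 0 < ‖x‖ := by linarith
    have h2 := hf.map_smul ‖x‖ hx0 (‖x‖⁻¹ • x)
    rw [smul_smul, mul_inv_cancel₀ hx0.ne', one_smul] at h2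
    have h3 : |f (‖x‖⁻¹ • x)| ≤ C := hC _ (by
      simp [norm_smul, inv_mul_cancel₀ hx0.ne'])
    have h4 : ‖x‖ ^ z ≤ (1 + ‖x‖) ^ z.natAbs := by
      calc ‖x‖ ^ z ≤ ‖x‖ ^ (z.natAbs : ℤ) := zpow_le_zpow_right₀ hx.le Int.le_natAbs
        _ = ‖x‖ ^ z.natAbs := zpow_natCast _ _
        _ ≤ _ := by gcongr; linarith
    rw [h2, abs_mul, abs_of_pos (zpow_pos hx0 z), mul_comm]
    exact mul_le_mul h3 h4 (zpow_pos hx0 z).le hC0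

end SmoothHomogeneous

/-- The Gaussian weight `exp (-‖x‖² / 2)`. -/
noncomputable def gaussianWeight (x : V) : ℝ := Real.exp (-(‖x‖ ^ 2 / 2))

theorem gaussianWeight_pos {V : Type*} [NormedAddCommGroup V] (x : V) : 0 < gaussianWeight x := Real.exp_pos _

theorem contDiff_gaussianWeight : ContDiff ℝ ∞ (gaussianWeight (V := V)) :=
  Real.contDiff_exp.comp ((contDiff_norm_sq ℝ).div_const 2).neg

theorem hasFDerivAt_gaussianWeight (x : V) :
    HasFDerivAt (gaussianWeight (V := V)) (-(gaussianWeight x) • innerSL ℝ x) x := by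
  have h := ((hasStrictFDerivAt_norm_sq x).hasFDerivAt.const_mul (-(1 / 2 : ℝ))).exp
  convert h using 1
  · ext y
    rw [gaussianWeight]
    ring_nf
  · rw [gaussianWeight, show -(1 / 2 : ℝ) * ‖x‖ ^ 2 = -(‖x‖ ^ 2 / 2) by ring]
    ext y
    simp

theorem measurable_gaussianWeight [MeasurableSpace V] [BorelSpace V] :
    Measurable (gaussianWeight (V := V)) :=
  contDiff_gaussianWeight.continuous.measurable

variable [FiniteDimensional ℝ V] [MeasurableSpace V] [BorelSpace V]

/-- The Gaussian measure with density `exp (-‖x‖² / 2)`, without normalization. -/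
noncomputable def gaussianVolume (V : Type*) [NormedAddCommGroup V] [InnerProductSpace ℝ V]
    [FiniteDimensional ℝ V] [MeasurableSpace V] [BorelSpace V] : Measure V :=
  volume.withDensity fun x => ENNReal.ofReal (gaussianWeight x)

theorem integral_gaussianVolume (f : V → ℝ) :
    ∫ x, f x ∂(gaussianVolume V) = ∫ x, f x * gaussianWeight x := by
  rw [gaussianVolume, integral_withDensity_eq_integral_toReal_smul
    measurable_gaussianWeight.ennreal_ofReal (by simp)]
  refine integral_congr_ae (Eventually.of_forall fun x => ?_)
  simp only [smul_eq_mul]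
  rw [ENNReal.toReal_ofReal (gaussianWeight_pos x).le, mul_comm]

theorem integrable_gaussianVolume_iff (f : V → ℝ) :
    Integrable f (gaussianVolume V) ↔ Integrable fun x => f x * gaussianWeight x := by
  rw [gaussianVolume, integrable_withDensity_iff_integrable_smul'
    measurable_gaussianWeight.ennreal_ofReal (by simp)]
  refine integrable_congr (Eventually.of_forall fun x => ?_)
  simp only [smul_eq_mul]
  rw [ENNReal.toReal_ofReal (gaussianWeight_pos x).le, mul_comm]

/-- The Gaussian measure is invariant under linear isometries. -/
theorem measurePreserving_gaussianVolume (e : V ≃ₗᵢ[ℝ] V) :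
    MeasurePreserving e (gaussianVolume V) (gaussianVolume V) := by
  refine ⟨e.continuous.measurable, ?_⟩
  ext S hS
  rw [Measure.map_apply e.continuous.measurable hS, gaussianVolume,
    withDensity_apply _ (e.continuous.measurable hS), withDensity_apply _ hS]
  have h := e.measurePreserving.setLIntegral_comp_preimage hS
    (measurable_gaussianWeight.ennreal_ofReal)
  rw [← h]
  simp [gaussianWeight]

/-- Gaussian integrals factorize in an orthonormal basis. -/
theorem integral_exp_neg_sum {ι : Type*} [Fintype ι] (b : OrthonormalBasis ι ℝ V) (a : ι → ℝ)
    (ha : ∀ i, 0 < a i) :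
    Integrable (fun x : V => Real.exp (-∑ i, a i * (inner ℝ (b i) x : ℝ) ^ 2)) ∧
      ∫ x : V, Real.exp (-∑ i, a i * (inner ℝ (b i) x : ℝ) ^ 2) = ∏ i, √(Real.pi / a i) := by
  have hmp : MeasurePreserving (fun x : V => WithLp.ofLp (b.repr x)) volume volume :=
    (PiLp.volume_preserving_ofLp ι).comp b.measurePreserving_repr
  have hemb : MeasurableEmbedding (fun x : V => WithLp.ofLp (b.repr x)) :=
    (MeasurableEquiv.toLp 2 (ι → ℝ)).symm.measurableEmbedding.comp
      b.measurableEquiv.measurableEmbedding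
  have hfun : (fun x : V => Real.exp (-∑ i, a i * (inner ℝ (b i) x : ℝ) ^ 2)) =
      (fun y : ι → ℝ => ∏ i, Real.exp (-a i * y i ^ 2)) ∘ fun x : V => WithLp.ofLp (b.repr x) := by
    ext x
    simp [← Real.exp_sum, b.repr_apply_apply]
  rw [hfun]
  refine ⟨(hmp.integrable_comp_emb hemb).2 (Integrable.fintype_prod fun i =>
    integrable_exp_neg_mul_sq (ha i)), ?_⟩
  have h := hmp.integral_comp hemb (fun y : ι → ℝ => ∏ i, Real.exp (-a i * y i ^ 2))
  simp only [Function.comp_def]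
  rw [h, integral_fintype_prod_volume_eq_prod fun i y => Real.exp (-a i * y ^ 2)]
  exact Finset.prod_congr rfl fun i _ => integral_gaussian (a i)

theorem integrable_exp_neg_mul_norm_sq {a : ℝ} (ha : 0 < a) :
    Integrable fun x : V => Real.exp (-(a * ‖x‖ ^ 2)) := by
  have h := (integral_exp_neg_sum (stdOrthonormalBasis ℝ V) (fun _ => a) fun _ => ha).1
  convert h using 4 with x
  rw [← Finset.mul_sum, OrthonormalBasis.sum_sq_inner_right]

theorem integrable_pow_gaussianWeight (n : ℕ) :
    Integrable fun x : V => (1 + ‖x‖) ^ n * gaussianWeight x := by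
  have hmeas : AEStronglyMeasurable (fun x : V => (1 + ‖x‖) ^ n * gaussianWeight x) volume :=
    Continuous.aestronglyMeasurable
      (((continuous_const.add continuous_norm).pow n).mul contDiff_gaussianWeight.continuous)
  refine ((integrable_exp_neg_mul_norm_sq (V := V) (a := 1 / 4) (by norm_num)).const_mul
    (n.factorial * Real.exp 2)).mono' hmeas (Eventually.of_forall fun x => ?_)
  have hx := norm_nonneg x
  have h1 : (1 + ‖x‖) ^ n ≤ n.factorial * Real.exp (1 + ‖x‖) := by
    have := Real.pow_div_factorial_le_exp (1 + ‖x‖) (by linarith) n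
    rwa [div_le_iff₀ (by positivity), mul_comm] at this
  have h2 : Real.exp (1 + ‖x‖) * gaussianWeight x ≤ Real.exp 2 * Real.exp (-(1 / 4 * ‖x‖ ^ 2)) := by
    rw [gaussianWeight, ← Real.exp_add, ← Real.exp_add]
    -- `1 + t ≤ 2 + t² / 4`
    exact Real.exp_le_exp.2 (by nlinarith [sq_nonneg (‖x‖ - 2)])
  have hpos := gaussianWeight_pos x
  rw [Real.norm_of_nonneg (by positivity)]
  calc (1 + ‖x‖) ^ n * gaussianWeight x
      ≤ n.factorial * Real.exp (1 + ‖x‖) * gaussianWeight x := by gcongr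
    _ = n.factorial * (Real.exp (1 + ‖x‖) * gaussianWeight x) := by ring
    _ ≤ n.factorial * (Real.exp 2 * Real.exp (-(1 / 4 * ‖x‖ ^ 2))) := by gcongr
    _ = _ := by ring

/-- A continuous function of polynomial growth is integrable for the Gaussian measure. -/
theorem integrable_gaussianVolume_of_bound {f : V → ℝ} (hf : Continuous f) {C : ℝ} {n : ℕ}
    (h : ∀ x, |f x| ≤ C * (1 + ‖x‖) ^ n) : Integrable f (gaussianVolume V) := by
  rw [integrable_gaussianVolume_iff]
  refine ((integrable_pow_gaussianWeight (V := V) n).const_mul C).mono'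
    (hf.mul contDiff_gaussianWeight.continuous).aestronglyMeasurable
    (Eventually.of_forall fun x => ?_)
  have hpos := gaussianWeight_pos x
  rw [norm_mul, Real.norm_of_nonneg hpos.le, ← mul_assoc]
  exact mul_le_mul_of_nonneg_right (h x) hpos.le

instance : IsFiniteMeasure (gaussianVolume V) := by
  have h : Integrable (fun _ : V => (1 : ℝ)) (gaussianVolume V) :=
    integrable_gaussianVolume_of_bound continuous_const (C := 1) (n := 0) (by simp)
  exact (integrable_const_iff_isFiniteMeasure one_ne_zero).1 h

theorem gaussianVolume_real_univ_pos : 0 < (gaussianVolume V).real Set.univ := by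
  have h : (gaussianVolume V).real Set.univ = ∫ _, (1 : ℝ) ∂(gaussianVolume V) := by simp
  rw [h, integral_gaussianVolume]
  have h2 := (integral_exp_neg_sum (stdOrthonormalBasis ℝ V) (fun _ => 1 / 2)
    fun _ => by norm_num).2
  have h3 : ∀ x : V, (1 : ℝ) * gaussianWeight x = Real.exp (-∑ i, 1 / 2 *
      (inner ℝ (stdOrthonormalBasis ℝ V i) x : ℝ) ^ 2) := by
    intro x
    rw [← Finset.mul_sum, OrthonormalBasis.sum_sq_inner_right, gaussianWeight]
    ring_nf
  simp only [h3, h2]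
  exact Finset.prod_pos fun i _ => Real.sqrt_pos.2 (by positivity)

namespace SmoothHomogeneous

variable {z z' : ℤ} {f g : V → ℝ}

theorem integrable (hf : SmoothHomogeneous z f) : Integrable f (gaussianVolume V) := by
  obtain ⟨C, n, -, h⟩ := hf.exists_bound
  exact integrable_gaussianVolume_of_bound hf.contDiff.continuous h

/-- Gaussian integration by parts. -/
theorem integral_fderiv (hf : SmoothHomogeneous z f) (v : V) :
    ∫ x, fderiv ℝ f x v ∂(gaussianVolume V) = ∫ x, inner ℝ v x * f x ∂(gaussianVolume V) := by
  have hlin : SmoothHomogeneous 1 fun x : V => (inner ℝ v x : ℝ) := linear (innerSL ℝ v)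
  have h1 := (integrable_gaussianVolume_iff _).1 (hf.fderiv_apply v).integrable
  have h2 := (integrable_gaussianVolume_iff _).1 (hlin.mul hf).integrable
  have h3 := (integrable_gaussianVolume_iff _).1 hf.integrable
  have hd : ∀ x, f x * fderiv ℝ gaussianWeight x v = -(inner ℝ v x * f x * gaussianWeight x) := by
    intro x
    rw [(hasFDerivAt_gaussianWeight x).fderiv]
    simp only [_root_.smul_apply, innerSL_apply_apply, smul_eq_mul,
      real_inner_comm x v]
    ring
  have h := integral_mul_fderiv_eq_neg_fderiv_mul_of_integrable (μ := volume) (f := f)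
    (g := gaussianWeight) (v := v) h1 (by simp only [hd]; exact h2.neg) h3
    (fun x _ => hf.differentiable x) (fun x _ => (hasFDerivAt_gaussianWeight x).differentiableAt)
  simp only [hd, integral_neg, neg_inj] at h
  rw [integral_gaussianVolume, integral_gaussianVolume, h]

/-- Gaussian integration by parts for the vector field `f A`, where `A` is linear. -/
theorem integral_inner_mul (hf : SmoothHomogeneous z f) (A : V →L[ℝ] V) :
    ∫ x, inner ℝ (A x) x * f x ∂(gaussianVolume V) =
      LinearMap.trace ℝ V A * ∫ x, f x ∂(gaussianVolume V) +
        ∫ x, fderiv ℝ f x (A x) ∂(gaussianVolume V) := by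
  set b := stdOrthonormalBasis ℝ V
  have hlin : ∀ i, SmoothHomogeneous 1 fun x : V => (inner ℝ (b i) (A x) : ℝ) := fun i =>
    linear ((innerSL ℝ (b i)).comp A)
  have hb : ∀ i, SmoothHomogeneous 1 fun x : V => (inner ℝ (b i) x : ℝ) := fun i =>
    linear (innerSL ℝ (b i))
  have hder : ∀ i x, fderiv ℝ (fun x => inner ℝ (b i) (A x) * f x) x (b i) =
      inner ℝ (b i) (A (b i)) * f x + inner ℝ (b i) (A x) * fderiv ℝ f x (b i) := by
    intro i x
    have h1 : HasFDerivAt (fun x => (inner ℝ (b i) (A x) : ℝ)) ((innerSL ℝ (b i)).comp A) x :=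
      ((innerSL ℝ (b i)).comp A).hasFDerivAt
    have h2 : HasFDerivAt (fun x => inner ℝ (b i) (A x) * f x) _ x :=
      h1.mul (hf.differentiable x).hasFDerivAt
    rw [h2.fderiv]
    simp
    ring
  have h1 : ∀ i, ∫ x, inner ℝ (b i) x * (inner ℝ (b i) (A x) * f x) ∂(gaussianVolume V) =
      inner ℝ (b i) (A (b i)) * ∫ x, f x ∂(gaussianVolume V) +
        ∫ x, inner ℝ (b i) (A x) * fderiv ℝ f x (b i) ∂(gaussianVolume V) := by
    intro i
    rw [← ((hlin i).mul hf).integral_fderiv (b i)]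
    simp only [hder]
    rw [integral_add (hf.integrable.const_mul _)
      ((hlin i).mul (hf.fderiv_apply (b i))).integrable, integral_const_mul]
  have e1 : ∀ x, inner ℝ (A x) x * f x =
      ∑ i, inner ℝ (b i) x * (inner ℝ (b i) (A x) * f x) := by
    intro x
    rw [← b.sum_inner_mul_inner (A x) x, Finset.sum_mul]
    refine Finset.sum_congr rfl fun i _ => ?_
    rw [real_inner_comm]
    ring
  have e2 : ∀ x, fderiv ℝ f x (A x) = ∑ i, inner ℝ (b i) (A x) * fderiv ℝ f x (b i) := by
    intro x
    conv_lhs => rw [← b.sum_repr' (A x)]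
    simp
  simp only [e1, e2]
  rw [integral_finsetSum _ fun i _ =>
      ((hb i).mul ((hlin i).mul hf)).integrable,
    integral_finsetSum _ fun i _ => ((hlin i).mul (hf.fderiv_apply (b i))).integrable,
    LinearMap.trace_eq_sum_inner _ b, Finset.sum_mul, ← Finset.sum_add_distrib]
  exact Finset.sum_congr rfl fun i _ => h1 i

/-- By Gaussian integration by parts and Euler's identity, the Laplacian multiplies the Gaussian
mean of a homogeneous function by its degree. -/
theorem integral_laplacian (hf : SmoothHomogeneous z f) :
    ∫ x, (Laplacian.laplacian f : V → ℝ) x ∂(gaussianVolume V) =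
      z * ∫ x, f x ∂(gaussianVolume V) := by
  set b := stdOrthonormalBasis ℝ V
  have h := funext fun x => laplacian_eq_sum_fderiv b (hf.differentiable_fderiv x)
  rw [h, integral_finsetSum _ fun i _ => ((hf.fderiv_apply _).fderiv_apply _).integrable,
    ← integral_const_mul]
  simp only [← hf.fderiv_self]
  have hb : ∀ i, SmoothHomogeneous 1 fun x : V => (inner ℝ (b i) x : ℝ) := fun i =>
    linear (innerSL ℝ (b i))
  have e2 : ∀ x, fderiv ℝ f x x = ∑ i, inner ℝ (b i) x * fderiv ℝ f x (b i) := by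
    intro x
    calc fderiv ℝ f x x = fderiv ℝ f x (∑ i, (inner ℝ (b i) x : ℝ) • b i) := by
          rw [b.sum_repr' x]
      _ = _ := by simp
  simp only [e2]
  rw [integral_finsetSum _ fun i _ =>
    ((hb i).mul (hf.fderiv_apply (b i))).integrable]
  exact Finset.sum_congr rfl fun i _ => (hf.fderiv_apply _).integral_fderiv _

/-- The Gaussian mean of a homogeneous function of degree `2 k` is determined by the `k`-th power
of the Laplacian. -/
theorem integral_eq_laplacian_iterate {k : ℕ} (hf : SmoothHomogeneous (2 * k) f) :
    2 ^ k * (k.factorial : ℝ) * ∫ x, f x ∂(gaussianVolume V) =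
      (gaussianVolume V).real Set.univ *
        ((fun h : V → ℝ => (Laplacian.laplacian h : V → ℝ))^[k] f) 0 := by
  have key : ∀ j ≤ k, ∫ x, ((fun h : V → ℝ => (Laplacian.laplacian h : V → ℝ))^[j] f) x
      ∂(gaussianVolume V) =
      2 ^ j * (k.descFactorial j : ℝ) * ∫ x, f x ∂(gaussianVolume V) := by
    intro j hj
    induction j with
    | zero => simp
    | succ j ih =>
      rw [Function.iterate_succ_apply', (hf.laplacian_iterate j).integral_laplacian,
        ih (by lia), Nat.descFactorial_succ]
      push_cast [Nat.cast_sub (show j ≤ k by lia)]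
      ring
  have h1 := key k le_rfl
  rw [Nat.descFactorial_self] at h1
  have h2 := hf.laplacian_iterate k
  rw [sub_self] at h2
  rw [← h1]
  simp only [h2.eq_const]
  simp

end SmoothHomogeneous

end

/-! ### Gaussian moments of quadratic forms and power series -/

section

variable {V : Type*} [NormedAddCommGroup V] [InnerProductSpace ℝ V]

namespace LinearMap.IsSymmetric

variable [FiniteDimensional ℝ V] {A : V →ₗ[ℝ] V} {n : ℕ}

theorem abs_eigenvalues_le (hA : A.IsSymmetric) (hn : finrank ℝ V = n) {c : ℝ}
    (hc : ∀ x, ‖A x‖ ≤ c * ‖x‖) (i : Fin n) : |hA.eigenvalues hn i| ≤ c := by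
  have h := hc (hA.eigenvectorBasis hn i)
  rw [hA.apply_eigenvectorBasis hn i, norm_smul] at h
  simpa using h

theorem pow_apply_eigenvectorBasis (hA : A.IsSymmetric) (hn : finrank ℝ V = n) (r : ℕ)
    (i : Fin n) : (A ^ r) (hA.eigenvectorBasis hn i) =
      hA.eigenvalues hn i ^ r • hA.eigenvectorBasis hn i := by
  induction r with
  | zero => simp
  | succ r ih =>
    rw [pow_succ, Module.End.mul_apply, hA.apply_eigenvectorBasis hn i, map_smul, ih, smul_smul,
      pow_succ, mul_comm]
    simp

theorem trace_pow (hA : A.IsSymmetric) (hn : finrank ℝ V = n) (r : ℕ) :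
    LinearMap.trace ℝ V (A ^ r) = ∑ i, hA.eigenvalues hn i ^ r := by
  rw [LinearMap.trace_eq_sum_inner _ (hA.eigenvectorBasis hn)]
  refine Finset.sum_congr rfl fun i _ => ?_
  rw [hA.pow_apply_eigenvectorBasis hn, real_inner_smul_right, real_inner_self_eq_norm_sq]
  simp

theorem det_one_sub_smul (hA : A.IsSymmetric) (hn : finrank ℝ V = n) (t : ℝ) :
    LinearMap.det (1 - t • A) = ∏ i, (1 - t * hA.eigenvalues hn i) := by
  let b := (hA.eigenvectorBasis hn).toBasis
  rw [← LinearMap.det_toMatrix b, ← Matrix.det_diagonal]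
  congr 1
  ext i j
  have h : (1 - t • A) (hA.eigenvectorBasis hn j) =
      (1 - t * hA.eigenvalues hn j) • hA.eigenvectorBasis hn j := by
    rw [LinearMap.sub_apply, LinearMap.smul_apply, hA.apply_eigenvectorBasis hn j,
      Module.End.one_apply, sub_smul, one_smul, smul_smul]
    simp
  rcases eq_or_ne i j with rfl | hij
  · simp [b, LinearMap.toMatrix_apply, h]
  · simp [b, LinearMap.toMatrix_apply, h, hij]

theorem inner_apply_self (hA : A.IsSymmetric) (hn : finrank ℝ V = n) (x : V) :
    (inner ℝ (A x) x : ℝ) =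
      ∑ i, hA.eigenvalues hn i * (inner ℝ (hA.eigenvectorBasis hn i) x : ℝ) ^ 2 := by
  rw [← (hA.eigenvectorBasis hn).sum_inner_mul_inner (A x) x]
  refine Finset.sum_congr rfl fun i _ => ?_
  rw [hA x, hA.apply_eigenvectorBasis hn i, real_inner_comm]
  simp [real_inner_smul_left]
  ring

/-- The identity `log det = tr log` for `1 - A`, as a convergent power series. -/
theorem hasSum_trace_pow (hA : A.IsSymmetric) {c : ℝ} (hc1 : c < 1)
    (hc : ∀ x, ‖A x‖ ≤ c * ‖x‖) :
    0 < LinearMap.det (1 - A) ∧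
    HasSum (fun r : ℕ => 1 / (2 * ((r : ℝ) + 1)) * LinearMap.trace ℝ V (A ^ (r + 1)))
      (-(1 / 2) * Real.log (LinearMap.det (1 - A))) := by
  have hlt : ∀ i, |hA.eigenvalues rfl i| < 1 := fun i =>
    (hA.abs_eigenvalues_le rfl hc i).trans_lt hc1
  have hpos : ∀ i, 0 < 1 - hA.eigenvalues rfl i := fun i => by
    linarith [(abs_lt.1 (hlt i)).2]
  have hdet : LinearMap.det (1 - A) = ∏ i, (1 - hA.eigenvalues rfl i) := by
    have := hA.det_one_sub_smul rfl 1
    simpa using this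
  rw [hdet]
  refine ⟨Finset.prod_pos fun i _ => hpos i, ?_⟩
  rw [Real.log_prod fun i _ => (hpos i).ne', Finset.mul_sum]
  have h := hasSum_sum (s := Finset.univ) fun (i : Fin (finrank ℝ V)) _ =>
    (Real.hasSum_pow_div_log_of_abs_lt_one (hlt i)).mul_left (1 / 2 : ℝ)
  have e1 : (fun r : ℕ => 1 / (2 * ((r : ℝ) + 1)) * LinearMap.trace ℝ V (A ^ (r + 1))) =
      fun r : ℕ => ∑ i, 1 / 2 * (hA.eigenvalues rfl i ^ (r + 1) / ((r : ℝ) + 1)) := by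
    ext r
    rw [hA.trace_pow rfl, Finset.mul_sum]
    refine Finset.sum_congr rfl fun i _ => ?_
    field_simp
  have e2 : ∑ i, -(1 / 2) * Real.log (1 - hA.eigenvalues rfl i) =
      ∑ i, 1 / 2 * -Real.log (1 - hA.eigenvalues rfl i) :=
    Finset.sum_congr rfl fun i _ => by ring
  rw [e1, e2]
  exact h

variable [MeasurableSpace V] [BorelSpace V]

/-- The Gaussian moment generating function of a quadratic form is the inverse square root of a
characteristic determinant. -/
theorem integral_exp_inner (hA : A.IsSymmetric) {c t : ℝ} (hc1 : |t| * c < 1)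
    (hc : ∀ x, ‖A x‖ ≤ c * ‖x‖) :
    Integrable (fun x => Real.exp (t * (inner ℝ (A x) x / 2))) (gaussianVolume V) ∧
    ∫ x, Real.exp (t * (inner ℝ (A x) x / 2)) ∂(gaussianVolume V) =
      (gaussianVolume V).real Set.univ * LinearMap.det (1 - t • A) ^ (-(1 / 2) : ℝ) := by
  set b := hA.eigenvectorBasis rfl
  have hweight : ∀ (s : ℝ) (x : V), Real.exp (s * (inner ℝ (A x) x / 2)) * gaussianWeight x =
      Real.exp (-∑ i, (1 - s * hA.eigenvalues rfl i) / 2 * (inner ℝ (b i) x : ℝ) ^ 2) := by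
    intro s x
    rw [gaussianWeight, ← Real.exp_add, hA.inner_apply_self rfl, ← b.sum_sq_inner_right x,
      Finset.sum_div, Finset.sum_div, Finset.mul_sum, ← Finset.sum_neg_distrib,
      ← Finset.sum_neg_distrib, ← Finset.sum_add_distrib]
    congr 1
    refine Finset.sum_congr rfl fun i _ => ?_
    ring
  have hpos : ∀ i, 0 < 1 - t * hA.eigenvalues rfl i := fun i => by
    have h1 : |t * hA.eigenvalues rfl i| < 1 := by
      rw [abs_mul]
      exact (mul_le_mul_of_nonneg_left (hA.abs_eigenvalues_le rfl hc i) (abs_nonneg t)).trans_lt hc1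
    linarith [(abs_lt.1 h1).2]
  have h1 := integral_exp_neg_sum b (fun i => (1 - t * hA.eigenvalues rfl i) / 2)
    fun i => half_pos (hpos i)
  have h0 := integral_exp_neg_sum b (fun i => (1 - 0 * hA.eigenvalues rfl i) / 2)
    fun i => by norm_num
  have hZ : (gaussianVolume V).real Set.univ = ∫ x, (1 : ℝ) ∂(gaussianVolume V) := by simp
  have hZ' : ∀ x : V, (1 : ℝ) = Real.exp (0 * (inner ℝ (A x) x / 2)) := by simp
  rw [integrable_gaussianVolume_iff, integral_gaussianVolume, hZ, integral_gaussianVolume]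
  conv in (1 : ℝ) * _ => rw [hZ' x]
  simp only [hweight]
  refine ⟨h1.1, ?_⟩
  rw [h1.2, h0.2, hA.det_one_sub_smul rfl, ← Real.finsetProd_rpow _ _ fun i _ => (hpos i).le,
    ← Finset.prod_mul_distrib]
  refine Finset.prod_congr rfl fun i _ => ?_
  rw [zero_mul, sub_zero, Real.rpow_neg (hpos i).le, ← Real.sqrt_eq_rpow, ← div_eq_mul_inv,
    ← Real.sqrt_div (by positivity)]
  congr 1
  field_simp

end LinearMap.IsSymmetric

section GaussianMoments

theorem SmoothHomogeneous.inner_clm (A : V →L[ℝ] V) :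
    SmoothHomogeneous 2 fun x : V => (inner ℝ (A x) x : ℝ) where
  contDiff := A.contDiff.inner ℝ contDiff_id
  map_smul t ht x := by
    rw [A.map_smul, real_inner_smul_left, real_inner_smul_right, zpow_ofNat]
    ring

variable [FiniteDimensional ℝ V] [MeasurableSpace V] [BorelSpace V]

/-- The Gaussian moments of the quadratic form of a multiple `A` of an orthogonal projection. -/
theorem integral_inner_pow_of_sq_eq (A : V →L[ℝ] V) (hA : (A : V →ₗ[ℝ] V).IsSymmetric) {c : ℝ}
    (hc : ∀ x, A (A x) = c • A x) (k : ℕ) :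
    ∫ x, inner ℝ (A x) x ^ k ∂(gaussianVolume V) =
      (∏ j ∈ Finset.range k, (LinearMap.trace ℝ V A + 2 * j * c)) *
        (gaussianVolume V).real Set.univ := by
  induction k with
  | zero => simp
  | succ k ih =>
    have hq := (SmoothHomogeneous.inner_clm A).pow k
    have h := hq.integral_inner_mul A
    have hd : ∀ x, fderiv ℝ (fun x => inner ℝ (A x) x ^ k) x (A x) =
        2 * k * c * inner ℝ (A x) x ^ k := by
      intro x
      have h1 : HasFDerivAt (fun x => (inner ℝ (A x) x : ℝ)) _ x :=
        A.hasFDerivAt.inner ℝ (hasFDerivAt_id x)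
      have h2 := h1.pow k
      rw [h2.fderiv]
      have h3 : (inner ℝ (A x) (A x) : ℝ) = c * inner ℝ (A x) x := by
        rw [← real_inner_smul_left, ← hc]
        exact (hA (A x) x).symm
      have h4 : (inner ℝ (A (A x)) x : ℝ) = c * inner ℝ (A x) x := by
        rw [hc, real_inner_smul_left]
      rcases k with _ | k
      · simp
      · simp only [_root_.smul_apply, ContinuousLinearMap.comp_apply,
          ContinuousLinearMap.prod_apply, ContinuousLinearMap.id_apply, fderivInnerCLM_apply, h3, h4,
          Nat.add_sub_cancel, smul_eq_mul, nsmul_eq_mul]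
        push_cast
        ring
    simp only [hd] at h
    rw [integral_const_mul, ih] at h
    rw [Finset.prod_range_succ]
    simp only [pow_succ']
    rw [h]
    ring

end GaussianMoments

section PowerSeries

variable {F : Type*} [NormedAddCommGroup F] [NormedSpace ℝ F]

/-- The function `f` is analytic at `0` and its homogeneous part of degree `n` vanishes. -/
def VanishingTerm (n : ℕ) (f : V → F) : Prop :=
  ∃ p : FormalMultilinearSeries ℝ V F, HasFPowerSeriesAt f p 0 ∧ p n = 0

namespace VanishingTerm

variable {n : ℕ}

theorem zero : VanishingTerm n (0 : V → F) := by
  refine ⟨0, ?_, rfl⟩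
  rw [← constFormalMultilinearSeries_zero]
  exact (hasFPowerSeriesOnBall_const (c := (0 : F)) (e := (0 : V))).hasFPowerSeriesAt

theorem analyticAt {f : V → F} (hf : VanishingTerm n f) : AnalyticAt ℝ f 0 := by
  obtain ⟨p, hp, -⟩ := hf
  exact hp.analyticAt

theorem add {f g : V → F} (hf : VanishingTerm n f) (hg : VanishingTerm n g) :
    VanishingTerm n (f + g) := by
  obtain ⟨p, hp, hp0⟩ := hf
  obtain ⟨q, hq, hq0⟩ := hg
  exact ⟨p + q, hp.add hq, by simp [hp0, hq0]⟩

theorem congr {f g : V → F} (hf : VanishingTerm n f) (hfg : f =ᶠ[𝓝 0] g) : VanishingTerm n g := by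
  obtain ⟨p, hp, hp0⟩ := hf
  exact ⟨p, hp.congr hfg, hp0⟩

theorem fderiv_apply {f : V → ℝ} (hf : VanishingTerm (n + 1) f) (v : V) :
    VanishingTerm n fun x => fderiv ℝ f x v := by
  obtain ⟨p, ⟨r, hp⟩, hp0⟩ := hf
  refine ⟨_, ⟨r, (ContinuousLinearMap.apply ℝ ℝ v).comp_hasFPowerSeriesOnBall hp.fderiv⟩, ?_⟩
  ext w
  simp [FormalMultilinearSeries.derivSeries_eq_zero p hp0]

theorem apply_zero {f : V → F} (hf : VanishingTerm 0 f) : f 0 = 0 := by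
  obtain ⟨p, hp, hp0⟩ := hf
  rw [← hp.coeff_zero (fun _ => 0), hp0]
  rfl

variable [FiniteDimensional ℝ V]

theorem laplacian {f : V → ℝ} (hf : VanishingTerm (n + 2) f) :
    VanishingTerm n (Laplacian.laplacian f : V → ℝ) := by
  set b := stdOrthonormalBasis ℝ V
  have h : ∀ s : Finset (Fin (finrank ℝ V)), VanishingTerm n
      (∑ i ∈ s, fun x => fderiv ℝ (fun y => fderiv ℝ f y (b i)) x (b i)) := by
    intro s
    induction s using Finset.induction_on with
    | empty => exact zero
    | insert i s hi ih =>
      rw [Finset.sum_insert hi]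
      exact ((hf.fderiv_apply _).fderiv_apply _).add ih
  refine (h Finset.univ).congr ?_
  filter_upwards [hf.analyticAt.eventually_analyticAt] with x hx
  rw [laplacian_eq_sum_fderiv b hx.fderiv.differentiableAt, Finset.sum_apply]

theorem laplacian_iterate {f : V → ℝ} {k : ℕ} (hf : VanishingTerm (n + 2 * k) f) :
    VanishingTerm n ((fun h : V → ℝ => (Laplacian.laplacian h : V → ℝ))^[k] f) := by
  induction k generalizing f with
  | zero => simpa using hf
  | succ k ih =>
    rw [Function.iterate_succ_apply]
    exact ih (laplacian (by rwa [show n + 2 * k + 2 = n + 2 * (k + 1) by ring]))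

end VanishingTerm

theorem AnalyticAt.laplacian [FiniteDimensional ℝ V] {f : V → ℝ} {x : V} (hf : AnalyticAt ℝ f x) :
    AnalyticAt ℝ (Laplacian.laplacian f : V → ℝ) x := by
  set b := stdOrthonormalBasis ℝ V
  have hd : ∀ (g : V → ℝ) (v : V), AnalyticAt ℝ g x → AnalyticAt ℝ (fun y => fderiv ℝ g y v) x :=
    fun g v hg => ((ContinuousLinearMap.apply ℝ ℝ v).analyticAt (fderiv ℝ g x)).comp hg.fderiv
  have h : AnalyticAt ℝ (fun x => ∑ i, fderiv ℝ (fun y => fderiv ℝ f y (b i)) x (b i)) x :=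
    Finset.analyticAt_fun_sum _ fun i _ => hd _ _ (hd _ _ hf)
  refine h.congr ?_
  filter_upwards [hf.eventually_analyticAt] with y hy
  rw [laplacian_eq_sum_fderiv b hy.fderiv.differentiableAt]

theorem laplacian_iterate_add [FiniteDimensional ℝ V] {f g : V → ℝ} {x : V}
    (hf : AnalyticAt ℝ f x) (hg : AnalyticAt ℝ g x) (k : ℕ) :
    (fun h : V → ℝ => (Laplacian.laplacian h : V → ℝ))^[k] (f + g) =ᶠ[𝓝 x]
      (fun h : V → ℝ => (Laplacian.laplacian h : V → ℝ))^[k] f +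
        (fun h : V → ℝ => (Laplacian.laplacian h : V → ℝ))^[k] g := by
  have han : ∀ (k : ℕ) (f : V → ℝ), AnalyticAt ℝ f x →
      AnalyticAt ℝ ((fun h : V → ℝ => (Laplacian.laplacian h : V → ℝ))^[k] f) x := by
    intro k f hf
    induction k with
    | zero => exact hf
    | succ k ih => rw [Function.iterate_succ_apply']; exact ih.laplacian
  induction k with
  | zero => exact Eventually.of_forall fun _ => rfl
  | succ k ih =>
    simp only [Function.iterate_succ_apply']
    exact (InnerProductSpace.laplacian_congr_nhds ih).trans
      ((han k f hf).contDiffAt.laplacian_add_nhds (han k g hg).contDiffAt)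

/-- The homogeneous part of degree `n` of a formal power series. -/
def homogeneousPart (p : FormalMultilinearSeries ℝ V F) (n : ℕ) : FormalMultilinearSeries ℝ V F :=
  fun j => if j = n then p j else 0

theorem homogeneousPart_self (p : FormalMultilinearSeries ℝ V F) (n : ℕ) :
    homogeneousPart p n n = p n := if_pos rfl

theorem homogeneousPart_of_ne (p : FormalMultilinearSeries ℝ V F) {n j : ℕ} (h : j ≠ n) :
    homogeneousPart p n j = 0 := if_neg h

theorem hasFPowerSeriesAt_homogeneousPart (p : FormalMultilinearSeries ℝ V F) (n : ℕ) :
    HasFPowerSeriesAt (fun x => p n fun _ => x) (homogeneousPart p n) 0 := by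
  refine ⟨⊤, ?_, ENNReal.zero_lt_top, fun {y} _ => ?_⟩
  · rw [FormalMultilinearSeries.radius_eq_top_of_forall_image_add_eq_zero _ (n + 1)
      fun m => homogeneousPart_of_ne p (by lia)]
  · rw [zero_add]
    have h := hasSum_single (f := fun j => homogeneousPart p n j fun _ => y) n fun j hj => by
      rw [homogeneousPart_of_ne p hj]
      rfl
    rwa [homogeneousPart_self] at h

/-- The value at `0` of the `k`-th power of the Laplacian of an analytic function only depends on
the homogeneous part of degree `2 k`. -/
theorem laplacian_iterate_eq_of_hasFPowerSeriesAt [FiniteDimensional ℝ V] {f : V → ℝ}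
    {p : FormalMultilinearSeries ℝ V ℝ} (hp : HasFPowerSeriesAt f p 0) (k : ℕ) :
    ((fun h : V → ℝ => (Laplacian.laplacian h : V → ℝ))^[k] f) 0 =
      ((fun h : V → ℝ => (Laplacian.laplacian h : V → ℝ))^[k] fun x => p (2 * k) fun _ => x) 0 := by
  have hs := hasFPowerSeriesAt_homogeneousPart p (2 * k)
  have hv : VanishingTerm (0 + 2 * k) (f - fun x => p (2 * k) fun _ => x) :=
    ⟨_, hp.sub hs, by
      rw [zero_add, FormalMultilinearSeries.sub_apply, homogeneousPart_self, sub_self]⟩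
  have h := (laplacian_iterate_add hv.analyticAt hs.analyticAt k).eq_of_nhds
  rw [sub_add_cancel, Pi.add_apply, hv.laplacian_iterate.apply_zero, zero_add] at h
  exact h

end PowerSeries

end

/-! ### The moment series of a curvature tensor -/

section

variable {V : Type*} [NormedAddCommGroup V] [InnerProductSpace ℝ V]

-- the operator norm of trilinear maps needs nested instance synthesis
set_option maxSynthPendingDepth 3

namespace AlgebraicCurvatureTensor

theorem jacobi_apply (R : AlgebraicCurvatureTensor V) (X Y : V) :
    R.jacobi X Y = R.toFun Y X X := rfl

theorem inner_toFun_self (R : AlgebraicCurvatureTensor V) (X Y Z : V) :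
    (inner ℝ Z (R.toFun X Y Z) : ℝ) = 0 := by
  have h := R.skew X Y Z Z
  rw [real_inner_comm] at h
  linarith

/-- The Jacobi operators are symmetric, by the first Bianchi identity. -/
theorem isSymmetric_jacobi (R : AlgebraicCurvatureTensor V) (X : V) : (R.jacobi X).IsSymmetric := by
  intro Y Z
  rw [jacobi_apply, jacobi_apply, R.skew, real_inner_comm _ Y, R.skew Z X X Y]
  have h := congrArg (fun W => (inner ℝ X W : ℝ)) (R.bianchi Y X Z)
  simp only [inner_add_right, R.inner_toFun_self, inner_zero_right, R.alternating X Z Y,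
    inner_neg_right] at h
  linarith

theorem jacobi_smul (R : AlgebraicCurvatureTensor V) (s : ℝ) (X : V) :
    R.jacobi (s • X) = s ^ 2 • R.jacobi X := by
  ext Y
  simp only [jacobi_apply, map_smul, LinearMap.smul_apply, smul_smul, pow_two]

variable [FiniteDimensional ℝ V] (R : AlgebraicCurvatureTensor V)

/-- The curvature tensor as a continuous trilinear map. -/
noncomputable def toCLM : V →L[ℝ] V →L[ℝ] V →L[ℝ] V :=
  LinearMap.toContinuousLinearMap
    ((LinearMap.toContinuousLinearMap : (V →ₗ[ℝ] V →L[ℝ] V) ≃ₗ[ℝ] _).toLinearMap ∘ₗ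
      (LinearMap.compRight ℝ
        (LinearMap.toContinuousLinearMap : (V →ₗ[ℝ] V) ≃ₗ[ℝ] _).toLinearMap) ∘ₗ R.toFun)

theorem toCLM_apply (X Y Z : V) : R.toCLM X Y Z = R.toFun X Y Z := rfl

theorem norm_jacobi_le (X Y : V) : ‖R.jacobi X Y‖ ≤ ‖R.toCLM‖ * ‖X‖ ^ 2 * ‖Y‖ := by
  rw [jacobi_apply, ← toCLM_apply]
  calc ‖R.toCLM Y X X‖ ≤ ‖R.toCLM Y X‖ * ‖X‖ := (R.toCLM Y X).le_opNorm X
    _ ≤ ‖R.toCLM‖ * ‖Y‖ * ‖X‖ * ‖X‖ := by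
        gcongr
        exact R.toCLM.le_opNorm₂ Y X
    _ = _ := by ring

theorem eventually_norm_lt : ∀ᶠ X in 𝓝 (0 : V), ‖R.toCLM‖ * ‖X‖ ^ 2 < 1 := by
  have h : Continuous fun X : V => ‖R.toCLM‖ * ‖X‖ ^ 2 := by fun_prop
  exact h.continuousAt.eventually (gt_mem_nhds (by simp))

theorem summable_momentSeries {X : V} (hX : ‖R.toCLM‖ * ‖X‖ ^ 2 < 1) :
    Summable fun r : ℕ =>
      1 / (2 * ((r : ℝ) + 1)) * LinearMap.trace ℝ V (R.jacobi X ^ (r + 1)) :=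
  ((R.isSymmetric_jacobi X).hasSum_trace_pow hX (R.norm_jacobi_le X)).2.summable

theorem det_pos {X : V} (hX : ‖R.toCLM‖ * ‖X‖ ^ 2 < 1) : 0 < LinearMap.det (1 - R.jacobi X) :=
  ((R.isSymmetric_jacobi X).hasSum_trace_pow hX (R.norm_jacobi_le X)).1

theorem momentSeries_eq {X : V} (hX : ‖R.toCLM‖ * ‖X‖ ^ 2 < 1) :
    R.momentSeries X = LinearMap.det (1 - R.jacobi X) ^ (-(1 / 2) : ℝ) := by
  rw [momentSeries, ((R.isSymmetric_jacobi X).hasSum_trace_pow hX (R.norm_jacobi_le X)).2.tsum_eq,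
    Real.rpow_def_of_pos (R.det_pos hX), mul_comm]

theorem analyticAt_det (X : V) : AnalyticAt ℝ (fun X => LinearMap.det (1 - R.jacobi X)) X := by
  let b := stdOrthonormalBasis ℝ V
  have h : (fun X => LinearMap.det (1 - R.jacobi X)) = fun X => ∑ σ : Equiv.Perm (Fin (finrank ℝ V)),
      (Equiv.Perm.sign σ : ℝ) * ∏ i, (inner ℝ (b (σ i)) (b i) -
        inner ℝ (b (σ i)) (R.toCLM (b i) X X)) := by
    ext X
    rw [← LinearMap.det_toMatrix b.toBasis, Matrix.det_apply']
    refine Finset.sum_congr rfl fun σ _ => ?_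
    congr 1
    refine Finset.prod_congr rfl fun i _ => ?_
    simp only [LinearMap.toMatrix_apply, OrthonormalBasis.coe_toBasis,
      OrthonormalBasis.coe_toBasis_repr_apply, OrthonormalBasis.repr_apply_apply,
      LinearMap.sub_apply, Module.End.one_apply, inner_sub_right]
    rfl
  rw [h]
  refine Finset.analyticAt_fun_sum _ fun σ _ => analyticAt_const.mul
    (Finset.analyticAt_fun_prod _ fun i _ => analyticAt_const.sub ?_)
  have h2 : AnalyticAt ℝ (fun X => R.toCLM (b i) X X) X :=
    (ContinuousLinearMap.analyticAt_bilinear (R.toCLM (b i)) (X, X)).comp₂ analyticAt_id analyticAt_id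
  exact ((innerSL ℝ (b (σ i))).analyticAt _).comp h2

theorem analyticAt_momentSeries : AnalyticAt ℝ R.momentSeries 0 := by
  have h : AnalyticAt ℝ
      (fun X => Real.exp (Real.log (LinearMap.det (1 - R.jacobi X)) * (-(1 / 2) : ℝ))) 0 :=
    ((AnalyticAt.comp (f := fun X => LinearMap.det (1 - R.jacobi X))
      (analyticAt_log (R.det_pos (X := 0) (by simp))) (R.analyticAt_det 0)).mul
        analyticAt_const).rexp'
  refine h.congr ?_
  filter_upwards [R.eventually_norm_lt] with X hX
  rw [R.momentSeries_eq hX, Real.rpow_def_of_pos (R.det_pos hX)]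

variable [MeasurableSpace V] [BorelSpace V]

/-- The homogeneous parts of the moment series are Gaussian moments of the quadratic forms of the
Jacobi operators: restricted to a line, both sides are Taylor coefficients of the moment generating
function of the quadratic form, evaluated at `s²`. -/
theorem momentSeries_coeff {p : FormalMultilinearSeries ℝ V ℝ}
    (hp : HasFPowerSeriesAt R.momentSeries p 0) (X : V) (k : ℕ) :
    (∫ Y, inner ℝ (R.toFun Y X X) Y ^ k ∂(gaussianVolume V)) =
      2 ^ k * (k.factorial : ℝ) * (gaussianVolume V).real Set.univ * p (2 * k) fun _ => X := by
  set Z := (gaussianVolume V).real Set.univ with hZ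
  have hZ0 : Z ≠ 0 := gaussianVolume_real_univ_pos.ne'
  set q : V → ℝ := fun Y => inner ℝ (R.jacobi X Y) Y / 2 with hq
  have hint : ∀ᶠ t in 𝓝 (0 : ℝ), |t| * (‖R.toCLM‖ * ‖X‖ ^ 2) < 1 := by
    have h : Continuous fun t : ℝ => |t| * (‖R.toCLM‖ * ‖X‖ ^ 2) := by fun_prop
    exact h.continuousAt.eventually (gt_mem_nhds (by simp))
  have hmem : (0 : ℝ) ∈ interior (ProbabilityTheory.integrableExpSet q (gaussianVolume V)) := by
    rw [mem_interior_iff_mem_nhds]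
    filter_upwards [hint] with t ht
    exact ((R.isSymmetric_jacobi X).integral_exp_inner ht (R.norm_jacobi_le X)).1
  have hsq : Tendsto (fun s : ℝ => s ^ 2) (𝓝 0) (𝓝 0) := by
    have : Continuous fun s : ℝ => s ^ 2 := by fun_prop
    simpa using this.tendsto 0
  have hsX : Tendsto (fun s : ℝ => s • X) (𝓝 0) (𝓝 0) := by
    have : Continuous fun s : ℝ => s • X := by fun_prop
    simpa using this.tendsto 0
  -- the moment series on the line through `X` in terms of the moment generating function
  have hline : ∀ᶠ s in 𝓝 (0 : ℝ), R.momentSeries (s • X) =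
      Z⁻¹ * ProbabilityTheory.mgf q (gaussianVolume V) (s ^ 2) := by
    filter_upwards [hsq.eventually hint, hsX.eventually R.eventually_norm_lt] with s hs hs'
    rw [R.momentSeries_eq hs', jacobi_smul, ProbabilityTheory.mgf]
    rw [((R.isSymmetric_jacobi X).integral_exp_inner hs (R.norm_jacobi_le X)).2, ← hZ, ← mul_assoc,
      inv_mul_cancel₀ hZ0, one_mul]
  have h1 : HasFPowerSeriesAt (fun s : ℝ => R.momentSeries (s • X))
      (FormalMultilinearSeries.ofScalars ℝ fun n => p n fun _ => X) 0 := by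
    rw [hasFPowerSeriesAt_iff]
    filter_upwards [hsX.eventually hp.eventually_hasSum] with s hs
    simp only [zero_add] at hs ⊢
    convert hs using 2 with n
    rw [FormalMultilinearSeries.coeff_ofScalars, (p n).map_smul_univ]
    simp
  have h2 : HasFPowerSeriesAt (fun s : ℝ => R.momentSeries (s • X))
      (FormalMultilinearSeries.ofScalars ℝ fun n => if Even n then
        Z⁻¹ * ((∫ Y, q Y ^ (n / 2) ∂(gaussianVolume V)) / (n / 2).factorial) else 0) 0 := by
    rw [hasFPowerSeriesAt_iff]
    have hm := hasFPowerSeriesAt_iff.1 (ProbabilityTheory.hasFPowerSeriesAt_mgf hmem)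
    filter_upwards [hsq.eventually hm, hline] with s hs hs'
    rw [zero_add] at hs ⊢
    rw [hs']
    have hinj : Function.Injective fun n : ℕ => 2 * n := fun a b h => by simpa using h
    rw [← hinj.hasSum_iff]
    · have hfun : ((fun n => s ^ n • (FormalMultilinearSeries.ofScalars ℝ fun n => if Even n then
          Z⁻¹ * ((∫ Y, q Y ^ (n / 2) ∂(gaussianVolume V)) / (n / 2).factorial) else 0).coeff n) ∘
          fun n => 2 * n) = fun n => Z⁻¹ * ((s ^ 2) ^ n • (FormalMultilinearSeries.ofScalars ℝ
            fun n => (∫ x, q x ^ n * Real.exp (0 * q x) ∂gaussianVolume V) / n.factorial).coeff n) := by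
        ext n
        simp only [Function.comp_apply, FormalMultilinearSeries.coeff_ofScalars, even_two_mul,
          if_true, Nat.mul_div_cancel_left n two_pos, zero_mul, Real.exp_zero, mul_one, smul_eq_mul,
          pow_mul]
        ring
      rw [hfun]
      exact hs.mul_left Z⁻¹
    · intro n hn
      have : ¬ Even n := fun ⟨a, ha⟩ => hn ⟨a, by simp only; lia⟩
      simp [FormalMultilinearSeries.coeff_ofScalars, this]
  have h3 := congrArg (fun S => FormalMultilinearSeries.coeff S (2 * k))
    (h1.eq_formalMultilinearSeries h2)
  simp only [FormalMultilinearSeries.coeff_ofScalars, even_two_mul, if_true,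
    Nat.mul_div_cancel_left k two_pos] at h3
  rw [h3]
  have hk : (k.factorial : ℝ) ≠ 0 := Nat.cast_ne_zero.2 k.factorial_ne_zero
  simp only [hq, div_pow, integral_div]
  field_simp
  rfl

/-- The Gaussian mean of the `k`-th power of the curvature over both arguments. -/
theorem integral_integral_pow (k : ℕ) :
    ∫ X, ∫ Y, inner ℝ (R.toFun Y X X) Y ^ k ∂(gaussianVolume V) ∂(gaussianVolume V) =
      (gaussianVolume V).real Set.univ ^ 2 * negLaplacianPowAtZero k R.momentSeries := by
  obtain ⟨p, hp⟩ := R.analyticAt_momentSeries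
  have hneg : (fun h : V → ℝ => -posLaplacian h) =
      fun h : V → ℝ => (Laplacian.laplacian h : V → ℝ) := by
    ext h x
    simp [posLaplacian]
  have hP : SmoothHomogeneous (2 * k) fun X => p (2 * k) fun _ => X := by
    refine ⟨(p (2 * k)).contDiff.comp (contDiff_pi.2 fun _ => contDiff_id), fun t ht x => ?_⟩
    rw [(p (2 * k)).map_smul_univ]
    rw [Finset.prod_const, Finset.card_univ, Fintype.card_fin, smul_eq_mul]
    congr 1
  rw [negLaplacianPowAtZero, hneg, laplacian_iterate_eq_of_hasFPowerSeriesAt hp]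
  simp only [R.momentSeries_coeff hp]
  rw [integral_const_mul, mul_right_comm, hP.integral_eq_laplacian_iterate]
  ring

end AlgebraicCurvatureTensor

end

/-! ### Averages over the orthogonal group -/

section

variable {V : Type*} [NormedAddCommGroup V] [InnerProductSpace ℝ V]

-- the operator norm of trilinear maps needs nested instance synthesis
set_option maxSynthPendingDepth 3

section InvariantAverage

/-- Averaging an integrable function over a group of measure preserving transformations does not
change its integral. -/
theorem integral_eq_integral_average {G X : Type*} [MeasurableSpace G] [MeasurableSpace X]
    {η : Measure G} [IsProbabilityMeasure η] {μ : Measure X} [SFinite μ] {act : G → X → X}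
    (hact : Measurable (Function.uncurry act)) (hμ : ∀ g, μ.map (act g) = μ) {F : X → ℝ}
    (hFm : Measurable F) (hF : Integrable F μ) :
    ∫ x, F x ∂μ = ∫ x, ∫ g, F (act g x) ∂η ∂μ := by
  have hg : ∀ g, MeasurePreserving (act g) μ μ := fun g =>
    ⟨hact.comp measurable_prodMk_left, hμ g⟩
  have hcomp : ∀ {H : X → ℝ}, Measurable H → ∀ g, ∫ x, H (act g x) ∂μ = ∫ x, H x ∂μ := by
    intro H hH g
    conv_rhs => rw [← hμ g]
    exact (integral_map (hg g).measurable.aemeasurable hH.aestronglyMeasurable).symm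
  have hint : Integrable (Function.uncurry fun g x => F (act g x)) (η.prod μ) := by
    have hm : AEStronglyMeasurable (Function.uncurry fun g x => F (act g x)) (η.prod μ) :=
      (hFm.comp hact).aestronglyMeasurable
    rw [integrable_prod_iff hm]
    refine ⟨Eventually.of_forall fun g => (hg g).integrable_comp_of_integrable hF, ?_⟩
    have : (fun g => ∫ x, ‖Function.uncurry (fun g x => F (act g x)) (g, x)‖ ∂μ) =
        fun _ => ∫ x, ‖F x‖ ∂μ := funext fun g => hcomp hFm.norm g
    rw [this]
    exact integrable_const _
  rw [← integral_integral_swap hint]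
  simp only [hcomp hFm]
  simp

variable [FiniteDimensional ℝ V]

instance : CompactSpace (unitary (V →L[ℝ] V)) := by
  refine isCompact_iff_compactSpace.1 (Metric.isCompact_of_isClosed_isBounded isClosed_unitary ?_)
  refine (Metric.isBounded_closedBall (x := 0) (r := 1)).subset fun u hu => ?_
  rw [mem_closedBall_zero_iff]
  refine ContinuousLinearMap.opNorm_le_bound _ zero_le_one fun x => ?_
  have := (Unitary.linearIsometryEquiv (𝕜 := ℝ) (H := V) ⟨u, hu⟩).norm_map x
  rw [one_mul]
  exact this.le

variable (V) in
/-- The orthogonal group of a euclidean vector space carries a right invariant probability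
measure. -/
theorem exists_isMulRightInvariant : ∃ η : Measure (unitary (V →L[ℝ] V)),
    IsProbabilityMeasure η ∧ η.IsMulRightInvariant := by
  let μ : Measure (unitary (V →L[ℝ] V)) := Measure.haarMeasure ⊤
  have hμ : IsProbabilityMeasure μ := ⟨Measure.haarMeasure_self⟩
  refine ⟨μ.inv, ⟨?_⟩, inferInstance⟩
  rw [Measure.inv_apply]
  simp

end InvariantAverage

namespace AlgebraicCurvatureTensor

variable (R : AlgebraicCurvatureTensor V)

theorem inner_toFun_comm (x y : V) :
    (inner ℝ (R.toFun y x x) y : ℝ) = inner ℝ (R.toFun x y y) x := by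
  rw [R.skew, R.alternating y x y, inner_neg_right, neg_neg, real_inner_comm]

theorem continuous_inner_toFun [FiniteDimensional ℝ V] :
    Continuous fun q : V × V => (inner ℝ (R.toFun q.2 q.1 q.1) q.2 : ℝ) := by
  simp only [← toCLM_apply]
  fun_prop

theorem gram_det_ne_zero {x y : V} (h : LinearIndependent ℝ ![x, y]) :
    (inner ℝ x x * inner ℝ y y - inner ℝ x y ^ 2 : ℝ) ≠ 0 := by
  intro h0
  have hw : (inner ℝ x x : ℝ) • y - (inner ℝ x y : ℝ) • x = 0 := by
    rw [← _root_.inner_self_eq_zero (𝕜 := ℝ)]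
    simp only [inner_sub_left, inner_sub_right, real_inner_smul_left, real_inner_smul_right,
      real_inner_comm x y]
    linear_combination (inner ℝ x x : ℝ) * h0
  rw [LinearIndependent.pair_iff] at h
  have hx := (h (-inner ℝ x y) (inner ℝ x x) (by rw [← hw]; module)).2
  rw [_root_.inner_self_eq_zero] at hx
  have := h 1 0 (by simp [hx])
  exact one_ne_zero this.1

/-- The curvature of a pair of vectors moved by an isometry, in terms of the sectional curvature of
a moved orthonormal frame. -/
theorem exists_inner_toFun_eq (x y : V) :
    (inner ℝ x x * inner ℝ y y - inner ℝ x y ^ 2 : ℝ) = 0 ∧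
        (∀ e : V ≃ₗᵢ[ℝ] V, (inner ℝ (R.toFun (e y) (e x) (e x)) (e y) : ℝ) = 0) ∨
      ∃ p : Stiefel2 V, ∀ e : V ≃ₗᵢ[ℝ] V, (inner ℝ (R.toFun (e y) (e x) (e x)) (e y) : ℝ) =
        (inner ℝ x x * inner ℝ y y - inner ℝ x y ^ 2) * Stiefel2.sec R (p.map e) := by
  by_cases h : LinearIndependent ℝ ![x, y]
  · refine Or.inr ⟨Stiefel2.gramSchmidt x y h, fun e => ?_⟩
    set p := Stiefel2.gramSchmidt x y h with hp
    have hplane : (p.map e).toGrassmannian.plane = Submodule.span ℝ {e x, e y} := by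
      rw [← Grassmannian2.map_toGrassmannian]
      have h1 : p.toGrassmannian.plane = Submodule.span ℝ {x, y} := Stiefel2.span_gramSchmidt x y h
      simp [Grassmannian2.map, h1, Submodule.map_span, Set.image_pair]
    have hsec := Grassmannian2.sec_eq R _ _ _ hplane
    rw [Grassmannian2.sec_toGrassmannian] at hsec
    rw [hsec, sectionalQuotient, e.inner_map_map, e.inner_map_map, e.inner_map_map,
      mul_div_cancel₀ _ (gram_det_ne_zero h)]
  · -- for linearly dependent vectors both sides vanish
    left
    by_cases hx : x = 0
    · simp [hx]
    · have hy : ∃ s : ℝ, s • x = y := by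
        by_contra! hs
        exact h ((LinearIndependent.pair_iff' hx).2 hs)
      obtain ⟨s, rfl⟩ := hy
      have alt : ∀ A Z : V, R.toFun A A Z = 0 := fun A Z => by
        have h2 : (2 : ℝ) • R.toFun A A Z = 0 := by
          rw [two_smul]
          nth_rewrite 1 [R.alternating A A Z]
          simp
        exact (smul_eq_zero.1 h2).resolve_left two_ne_zero
      refine ⟨?_, fun e => ?_⟩
      · simp only [real_inner_smul_left, real_inner_smul_right]
        ring
      · simp [alt]

end AlgebraicCurvatureTensor

namespace Stiefel2

variable [FiniteDimensional ℝ V]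

theorem continuous_sec (R : AlgebraicCurvatureTensor V) : Continuous (sec R) :=
  R.continuous_inner_toFun.comp isInducing_incl.continuous

theorem integrable_sec_pow (R : AlgebraicCurvatureTensor V) (k : ℕ) :
    Integrable (fun p : Stiefel2 V => sec R p ^ k) volFS := by
  have : IsFiniteMeasure (volFS : Measure (Stiefel2 V)) := ⟨volFS_univ_lt_top⟩
  exact ((continuous_sec R).pow k).integrable_of_hasCompactSupport (HasCompactSupport.of_compactSpace _)

theorem continuous_rotate : Continuous (Function.uncurry fun (g : unitary (V →L[ℝ] V))
    (p : Stiefel2 V) => p.map (Unitary.linearIsometryEquiv g)) := by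
  rw [isInducing_incl.continuous_iff]
  have := continuous_X (V := V)
  have := continuous_Y (V := V)
  change Continuous fun q : unitary (V →L[ℝ] V) × Stiefel2 V =>
    ((q.1 : V →L[ℝ] V) q.2.X, (q.1 : V →L[ℝ] V) q.2.Y)
  fun_prop

/-- The average of a function over the rotations of a frame does not depend on the frame, since the
orthogonal group acts transitively on frames. -/
theorem integral_rotate_eq {η : Measure (unitary (V →L[ℝ] V))} [η.IsMulRightInvariant]
    (F : Stiefel2 V → ℝ) (p q : Stiefel2 V) :
    ∫ g, F (p.map (Unitary.linearIsometryEquiv g)) ∂η =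
      ∫ g, F (q.map (Unitary.linearIsometryEquiv g)) ∂η := by
  obtain ⟨e, rfl⟩ := exists_map_eq p q
  rw [← integral_mul_right_eq_self (fun g => F (p.map (Unitary.linearIsometryEquiv g)))
    (Unitary.linearIsometryEquiv.symm e)]
  simp only [map_mul, MulEquiv.apply_symm_apply]
  rfl

end Stiefel2

namespace Grassmannian2

variable [FiniteDimensional ℝ V]

theorem continuous_sec (R : AlgebraicCurvatureTensor V) : Continuous (sec R) := by
  rw [isQuotientMap_toGrassmannian.continuous_iff]
  exact (Stiefel2.continuous_sec R).congr fun p => (sec_toGrassmannian R p).symm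

theorem integrable_sec_pow (R : AlgebraicCurvatureTensor V) (k : ℕ) :
    Integrable (fun P : Grassmannian2 V => sec R P ^ k) volFS := by
  have : IsFiniteMeasure (volFS : Measure (Grassmannian2 V)) := ⟨volFS_univ_lt_top⟩
  exact ((continuous_sec R).pow k).integrable_of_hasCompactSupport (HasCompactSupport.of_compactSpace _)

theorem continuous_rotate : Continuous (Function.uncurry fun (g : unitary (V →L[ℝ] V))
    (P : Grassmannian2 V) => map (Unitary.linearIsometryEquiv g) P) := by
  rw [isInducing_proj.continuous_iff]
  have := isInducing_proj (V := V) |>.continuous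
  have h : proj ∘ (Function.uncurry fun (g : unitary (V →L[ℝ] V)) (P : Grassmannian2 V) =>
      map (Unitary.linearIsometryEquiv g) P) = fun q => (q.1 : V →L[ℝ] V) * proj q.2 *
        ((q.1⁻¹ : unitary (V →L[ℝ] V)) : V →L[ℝ] V) := by
    ext q x
    simp only [Function.comp_apply, Function.uncurry, proj_map]
    rfl
  rw [h]
  fun_prop

end Grassmannian2

section Moments

variable [FiniteDimensional ℝ V]

/-- The falling factorial as a product of the Gaussian moments of the squared norm in dimensions
`m - 1` and `m`. -/
theorem fallingFactorial_eq (m : ℝ) (k : ℕ) : fallingFactorial (m + 2 * k - 2) (2 * k) =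
    (∏ j ∈ Finset.range k, (m - 1 + 2 * j)) * ∏ j ∈ Finset.range k, (m + 2 * j) := by
  have h : fallingFactorial (m + 2 * k - 2) (2 * k) = ∏ i ∈ Finset.range (2 * k), (m - 1 + i) := by
    rw [fallingFactorial, ← Finset.prod_range_reflect]
    refine Finset.prod_congr rfl fun i hi => ?_
    rw [Finset.mem_range] at hi
    rw [Nat.cast_sub (by lia), Nat.cast_sub (by lia)]
    push_cast
    ring
  rw [h]
  clear h
  induction k with
  | zero => simp
  | succ k ih =>
    rw [mul_add, mul_one, Finset.prod_range_succ, Finset.prod_range_succ, ih,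
      Finset.prod_range_succ, Finset.prod_range_succ]
    push_cast
    ring

theorem fallingFactorial_pos {m : ℝ} (hm : 1 < m) (k : ℕ) :
    0 < fallingFactorial (m + 2 * k - 2) (2 * k) := by
  rw [fallingFactorial_eq]
  have : ∀ j : ℕ, (0 : ℝ) ≤ 2 * j := fun j => by positivity
  exact mul_pos (Finset.prod_pos fun j _ => by linarith [this j])
    (Finset.prod_pos fun j _ => by linarith [this j])

variable [MeasurableSpace V] [BorelSpace V]

theorem integral_inner_self_pow (k : ℕ) : ∫ x : V, (inner ℝ x x : ℝ) ^ k ∂(gaussianVolume V) =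
    (∏ j ∈ Finset.range k, ((finrank ℝ V : ℝ) + 2 * j)) * (gaussianVolume V).real Set.univ := by
  have h := integral_inner_pow_of_sq_eq (ContinuousLinearMap.id ℝ V) (c := 1)
    (fun x y => rfl) (fun x => by simp) k
  simpa using h

/-- The Gaussian moments of the squared area of a parallelogram. -/
theorem integral_integral_gram_det_pow (k : ℕ) :
    ∫ x : V, ∫ y : V, (inner ℝ x x * inner ℝ y y - inner ℝ x y ^ 2 : ℝ) ^ k
      ∂(gaussianVolume V) ∂(gaussianVolume V) =
    (gaussianVolume V).real Set.univ ^ 2 *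
      fallingFactorial ((finrank ℝ V : ℝ) + 2 * k - 2) (2 * k) := by
  have key : ∀ x : V, ∫ y : V, (inner ℝ x x * inner ℝ y y - inner ℝ x y ^ 2 : ℝ) ^ k
      ∂(gaussianVolume V) = (∏ j ∈ Finset.range k, ((finrank ℝ V : ℝ) - 1 + 2 * j)) *
        (gaussianVolume V).real Set.univ * (inner ℝ x x : ℝ) ^ k := by
    intro x
    -- the multiple of the projection to the orthogonal complement of `x` by `‖x‖²`
    set A : V →L[ℝ] V := (inner ℝ x x : ℝ) • ContinuousLinearMap.id ℝ V -
      (innerSL ℝ x).smulRight x with hA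
    have hAapp : ∀ y, A y = (inner ℝ x x : ℝ) • y - (inner ℝ x y : ℝ) • x := fun y => rfl
    have hq : ∀ y, (inner ℝ x x * inner ℝ y y - inner ℝ x y ^ 2 : ℝ) = inner ℝ (A y) y := by
      intro y
      rw [hAapp, inner_sub_left, real_inner_smul_left, real_inner_smul_left]
      ring
    have hsymm : (A : V →ₗ[ℝ] V).IsSymmetric := by
      intro y z
      simp only [ContinuousLinearMap.coe_coe, hAapp, inner_sub_left, inner_sub_right,
        real_inner_smul_left, real_inner_smul_right, real_inner_comm y x]
      ring
    have hsq : ∀ y, A (A y) = (inner ℝ x x : ℝ) • A y := by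
      intro y
      simp only [hAapp, inner_sub_right, real_inner_smul_right]
      module
    have htr : LinearMap.trace ℝ V (A : V →ₗ[ℝ] V) = ((finrank ℝ V : ℝ) - 1) * inner ℝ x x := by
      have h1 : (A : V →ₗ[ℝ] V) = (inner ℝ x x : ℝ) • LinearMap.id -
          ((innerSL ℝ x : V →L[ℝ] ℝ) : V →ₗ[ℝ] ℝ).smulRight x := by
        ext y
        rfl
      rw [h1, map_sub, map_smul, LinearMap.trace_id, LinearMap.trace_smulRight]
      simp
      ring
    simp only [hq]
    rw [integral_inner_pow_of_sq_eq A hsymm hsq, htr]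
    have h2 : ∀ j : ℕ, ((finrank ℝ V : ℝ) - 1) * inner ℝ x x + 2 * j * inner ℝ x x =
        ((finrank ℝ V : ℝ) - 1 + 2 * j) * inner ℝ x x := fun j => by ring
    simp only [h2]
    rw [Finset.prod_mul_distrib, Finset.prod_const, Finset.card_range]
    ring
  simp only [key]
  rw [integral_const_mul, integral_inner_self_pow, fallingFactorial_eq]
  ring

theorem integrable_pow_of_abs_le {Q : V × V → ℝ} (hQ : Continuous Q) {C : ℝ}
    (h : ∀ q, |Q q| ≤ C * (‖q.1‖ ^ 2 * ‖q.2‖ ^ 2)) (k : ℕ) :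
    Integrable (fun q => Q q ^ k) ((gaussianVolume V).prod (gaussianVolume V)) := by
  have h1 : Integrable (fun x : V => ‖x‖ ^ (2 * k)) (gaussianVolume V) := by
    refine integrable_gaussianVolume_of_bound (by fun_prop) (C := 1) (n := 2 * k) fun x => ?_
    rw [abs_of_nonneg (by positivity), one_mul]
    gcongr
    linarith
  refine ((h1.mul_prod h1).const_mul (C ^ k)).mono'
    (hQ.pow k).measurable.aestronglyMeasurable (Eventually.of_forall fun q => ?_)
  rw [Real.norm_eq_abs, abs_pow, pow_mul, pow_mul, ← mul_pow, ← mul_pow]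
  exact pow_le_pow_left₀ (abs_nonneg _) (h q) k

theorem integral_inner_clm (A : V →L[ℝ] V) : ∫ x, inner ℝ (A x) x ∂(gaussianVolume V) =
    LinearMap.trace ℝ V A * (gaussianVolume V).real Set.univ := by
  have h1 : SmoothHomogeneous 0 fun _ : V => (1 : ℝ) := ⟨contDiff_const, fun t ht x => by simp⟩
  have h := h1.integral_inner_mul A
  simpa using h

end Moments

namespace AlgebraicCurvatureTensor

variable [FiniteDimensional ℝ V] (R : AlgebraicCurvatureTensor V)

theorem abs_inner_toFun_le (x y : V) :
    |(inner ℝ (R.toFun y x x) y : ℝ)| ≤ ‖R.toCLM‖ * (‖x‖ ^ 2 * ‖y‖ ^ 2) := by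
  calc |(inner ℝ (R.toFun y x x) y : ℝ)| ≤ ‖R.toFun y x x‖ * ‖y‖ := abs_real_inner_le_norm _ _
    _ ≤ ‖R.toCLM‖ * ‖x‖ ^ 2 * ‖y‖ * ‖y‖ := by
        gcongr
        exact R.norm_jacobi_le x y
    _ = _ := by ring

theorem integral_jacobi [MeasurableSpace V] [BorelSpace V] (x : V) :
    ∫ y, inner ℝ (R.toFun y x x) y ∂(gaussianVolume V) =
      LinearMap.trace ℝ V (R.jacobi x) * (gaussianVolume V).real Set.univ :=
  integral_inner_clm (LinearMap.toContinuousLinearMap (R.jacobi x))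

/-- The first moment is the scalar curvature, as the Gaussian mean of a quadratic form is the trace
of its operator. -/
theorem negLaplacianPowAtZero_one : negLaplacianPowAtZero 1 R.momentSeries = R.scalarCurvature := by
  borelize V
  set Z := (gaussianVolume V).real Set.univ with hZ
  have hZ0 : Z ≠ 0 := gaussianVolume_real_univ_pos.ne'
  set b := stdOrthonormalBasis ℝ V with hb
  have htr : ∀ x, LinearMap.trace ℝ V (R.jacobi x) = ∑ i, inner ℝ (R.toFun x (b i) (b i)) x := by
    intro x
    rw [LinearMap.trace_eq_sum_inner _ b]
    refine Finset.sum_congr rfl fun i _ => ?_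
    rw [real_inner_comm, jacobi_apply, R.inner_toFun_comm]
  have hint : ∀ i, Integrable (fun x => (inner ℝ (R.toFun x (b i) (b i)) x : ℝ))
      (gaussianVolume V) := fun i =>
    (SmoothHomogeneous.inner_clm (LinearMap.toContinuousLinearMap (R.jacobi (b i)))).integrable
  have h := R.integral_integral_pow 1
  simp only [pow_one, R.integral_jacobi] at h
  rw [integral_mul_const] at h
  simp only [htr] at h
  rw [integral_finsetSum _ fun i _ => hint i] at h
  simp only [R.integral_jacobi, ← Finset.sum_mul, ← hZ] at h
  have hκ : ∑ i, LinearMap.trace ℝ V (R.jacobi (b i)) = R.scalarCurvature := by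
    rw [scalarCurvature, Finset.sum_comm]
    refine Finset.sum_congr rfl fun i _ => ?_
    rw [LinearMap.trace_eq_sum_inner _ b]
    exact Finset.sum_congr rfl fun j _ => real_inner_comm _ _
  rw [hκ] at h
  have h3 : Z ^ 2 * (negLaplacianPowAtZero 1 R.momentSeries - R.scalarCurvature) = 0 := by
    linear_combination -h
  exact sub_eq_zero.1 ((mul_eq_zero.1 h3).resolve_left (pow_ne_zero 2 hZ0))

/-- The average of the `k`-th power of the sectional curvature over the rotations of a frame. The
Gaussian mean of `g(R_{Y,X} X, Y)^k` factors as the product of this average and the Gaussian mean of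
the `k`-th power of the Gram determinant of `X, Y`. -/
theorem integral_sec_rotate_pow (hm : 2 ≤ finrank ℝ V) {η : Measure (unitary (V →L[ℝ] V))}
    [IsProbabilityMeasure η] [η.IsMulRightInvariant] (p : Stiefel2 V) (k : ℕ) :
    ∫ g, Stiefel2.sec R (p.map (Unitary.linearIsometryEquiv g)) ^ k ∂η =
      negLaplacianPowAtZero k R.momentSeries /
        fallingFactorial ((finrank ℝ V : ℝ) + 2 * k - 2) (2 * k) := by
  borelize V
  set c := ∫ g, Stiefel2.sec R (p.map (Unitary.linearIsometryEquiv g)) ^ k ∂η with hc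
  have hact : Measurable (Function.uncurry fun (g : unitary (V →L[ℝ] V)) (q : V × V) =>
      (Unitary.linearIsometryEquiv g q.1, Unitary.linearIsometryEquiv g q.2)) := by
    refine Continuous.measurable ?_
    change Continuous fun q : unitary (V →L[ℝ] V) × (V × V) =>
      ((q.1 : V →L[ℝ] V) q.2.1, (q.1 : V →L[ℝ] V) q.2.2)
    fun_prop
  have hinv : ∀ g : unitary (V →L[ℝ] V), ((gaussianVolume V).prod (gaussianVolume V)).map
      (fun q : V × V => (Unitary.linearIsometryEquiv g q.1, Unitary.linearIsometryEquiv g q.2)) =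
      (gaussianVolume V).prod (gaussianVolume V) := fun g =>
    ((measurePreserving_gaussianVolume _).prod (measurePreserving_gaussianVolume _)).map_eq
  have hint := integrable_pow_of_abs_le R.continuous_inner_toFun
    (fun q => R.abs_inner_toFun_le q.1 q.2) k
  have h := integral_eq_integral_average (η := η)
    (F := fun q : V × V => (inner ℝ (R.toFun q.2 q.1 q.1) q.2 : ℝ) ^ k) hact hinv
    (R.continuous_inner_toFun.pow k).measurable hint
  have hD : ∀ q : V × V, ∫ g : unitary (V →L[ℝ] V),
      (inner ℝ (R.toFun (Unitary.linearIsometryEquiv g q.2) (Unitary.linearIsometryEquiv g q.1)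
        (Unitary.linearIsometryEquiv g q.1)) (Unitary.linearIsometryEquiv g q.2) : ℝ) ^ k ∂η =
      c * (inner ℝ q.1 q.1 * inner ℝ q.2 q.2 - inner ℝ q.1 q.2 ^ 2 : ℝ) ^ k := by
    intro q
    rcases R.exists_inner_toFun_eq q.1 q.2 with ⟨h0, h1⟩ | ⟨p', h1⟩
    · simp only [h0, h1]
      -- `0 ^ 0 = 1` is consistent with `c = 1` in the case `k = 0`
      rcases k.eq_zero_or_pos with rfl | hk
      · simp [hc]
      · simp [hk.ne']
    · simp only [h1, mul_pow]
      rw [integral_const_mul, hc, Stiefel2.integral_rotate_eq (fun p => Stiefel2.sec R p ^ k) p p',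
        mul_comm]
  simp only [hD] at h
  rw [integral_const_mul, integral_prod _ hint, R.integral_integral_pow k] at h
  have hDint : Integrable (fun q : V × V =>
      (inner ℝ q.1 q.1 * inner ℝ q.2 q.2 - inner ℝ q.1 q.2 ^ 2 : ℝ) ^ k)
      ((gaussianVolume V).prod (gaussianVolume V)) := by
    refine integrable_pow_of_abs_le (by fun_prop) (C := 1) (fun q => ?_) k
    have h1 := real_inner_mul_inner_self_le q.1 q.2
    simp only [← real_inner_self_eq_norm_sq]
    rw [abs_of_nonneg (by linarith)]
    linarith [sq_nonneg (inner ℝ q.1 q.2 : ℝ)]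
  rw [integral_prod _ hDint, integral_integral_gram_det_pow] at h
  have hZ := gaussianVolume_real_univ_pos (V := V)
  have hF := fallingFactorial_pos (m := finrank ℝ V) (by exact_mod_cast hm) k
  rw [eq_div_iff hF.ne']
  have hZ2 := (pow_pos hZ 2).ne'
  refine mul_left_cancel₀ hZ2 ?_
  rw [h]
  ring

/-- The integral over frames is the volume times the average over the rotations of any one frame. -/
theorem integral_stiefel_sec_pow (hm : 2 ≤ finrank ℝ V) (k : ℕ) :
    ∫ p, Stiefel2.sec R p ^ k ∂Stiefel2.volFS = (Stiefel2.volFS : Measure (Stiefel2 V)).real Set.univ *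
      (negLaplacianPowAtZero k R.momentSeries /
        fallingFactorial ((finrank ℝ V : ℝ) + 2 * k - 2) (2 * k)) := by
  obtain ⟨η, _, _⟩ := exists_isMulRightInvariant V
  have : IsFiniteMeasure (Stiefel2.volFS : Measure (Stiefel2 V)) := ⟨Stiefel2.volFS_univ_lt_top⟩
  rw [integral_eq_integral_average (η := η) (F := fun p => Stiefel2.sec R p ^ k)
    Stiefel2.continuous_rotate.measurable
    (fun g => Stiefel2.map_volFS _) ((Stiefel2.continuous_sec R).pow k).measurable
    (Stiefel2.integrable_sec_pow R k)]
  simp only [R.integral_sec_rotate_pow hm]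
  simp

theorem integral_grassmannian_sec_pow (hm : 2 ≤ finrank ℝ V) (k : ℕ) :
    ∫ P, Grassmannian2.sec R P ^ k ∂Grassmannian2.volFS =
      (Grassmannian2.volFS : Measure (Grassmannian2 V)).real Set.univ *
      (negLaplacianPowAtZero k R.momentSeries /
        fallingFactorial ((finrank ℝ V : ℝ) + 2 * k - 2) (2 * k)) := by
  obtain ⟨η, _, _⟩ := exists_isMulRightInvariant V
  have : IsFiniteMeasure (Grassmannian2.volFS : Measure (Grassmannian2 V)) :=
    ⟨Grassmannian2.volFS_univ_lt_top⟩
  rw [integral_eq_integral_average (η := η) (F := fun P => Grassmannian2.sec R P ^ k)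
    Grassmannian2.continuous_rotate.measurable
    (fun g => Grassmannian2.map_volFS _) ((Grassmannian2.continuous_sec R).pow k).measurable
    (Grassmannian2.integrable_sec_pow R k)]
  have key : ∀ P : Grassmannian2 V, ∫ g, Grassmannian2.sec R
      (Grassmannian2.map (Unitary.linearIsometryEquiv g) P) ^ k ∂η =
      negLaplacianPowAtZero k R.momentSeries /
        fallingFactorial ((finrank ℝ V : ℝ) + 2 * k - 2) (2 * k) := by
    intro P
    obtain ⟨p, rfl⟩ := Grassmannian2.exists_toGrassmannian_eq P
    simp only [Grassmannian2.map_toGrassmannian, Grassmannian2.sec_toGrassmannian]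
    exact R.integral_sec_rotate_pow hm p k
  simp only [key]
  simp

end AlgebraicCurvatureTensor

theorem Stiefel2.exists_of_two_le_finrank [FiniteDimensional ℝ V] (hm : 2 ≤ finrank ℝ V) :
    Nonempty (Stiefel2 V) := by
  have h := (stdOrthonormalBasis ℝ V).orthonormal
  exact ⟨⟨stdOrthonormalBasis ℝ V ⟨0, by lia⟩, stdOrthonormalBasis ℝ V ⟨1, by lia⟩,
    by rw [real_inner_self_eq_norm_sq, h.1]; norm_num,
    by rw [real_inner_self_eq_norm_sq, h.1]; norm_num, h.2 (by simp)⟩⟩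

end

theorem theorem2p4 {V : Type*} [NormedAddCommGroup V] [InnerProductSpace ℝ V]
    [FiniteDimensional ℝ V] (m : ℕ) (hm : finrank ℝ V = m) (hm2 : 2 ≤ m)
    (R : AlgebraicCurvatureTensor V) :
    -- the exponential series converges near the origin, defines an analytic germ, and
    -- is the germ of the inverse square root of the determinant
    (∀ᶠ X in 𝓝 (0 : V), Summable fun r : ℕ =>
      1 / (2 * ((r : ℝ) + 1)) * LinearMap.trace ℝ V (R.jacobi X ^ (r + 1))) ∧
    AnalyticAt ℝ R.momentSeries 0 ∧
    (∀ᶠ X in 𝓝 (0 : V), 0 < LinearMap.det (1 - R.jacobi X) ∧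
      R.momentSeries X = LinearMap.det (1 - R.jacobi X) ^ (-(1 / 2) : ℝ)) ∧
    -- moments over the Stiefel manifold
    (0 < (Stiefel2.volFS : Measure (Stiefel2 V)) Set.univ ∧
      (Stiefel2.volFS : Measure (Stiefel2 V)) Set.univ < ⊤) ∧
    (∀ k : ℕ, Integrable (fun p : Stiefel2 V => Stiefel2.sec R p ^ k) Stiefel2.volFS ∧
      ((Stiefel2.volFS : Measure (Stiefel2 V)).real Set.univ)⁻¹ *
          ∫ p : Stiefel2 V, Stiefel2.sec R p ^ k ∂Stiefel2.volFS =
        negLaplacianPowAtZero k R.momentSeries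
          / fallingFactorial ((m : ℝ) + 2 * k - 2) (2 * k)) ∧
    (R.scalarCurvature / (m * (m - 1)) =
      ((Stiefel2.volFS : Measure (Stiefel2 V)).real Set.univ)⁻¹ *
        ∫ p : Stiefel2 V, Stiefel2.sec R p ∂Stiefel2.volFS) ∧
    -- the sectional curvature is constant along the fibers of the projection to the Grassmannian
    (∀ p : Stiefel2 V, Grassmannian2.sec R p.toGrassmannian = Stiefel2.sec R p) ∧
    -- moments over the Grassmannian
    (0 < (Grassmannian2.volFS : Measure (Grassmannian2 V)) Set.univ ∧
      (Grassmannian2.volFS : Measure (Grassmannian2 V)) Set.univ < ⊤) ∧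
    (∀ k : ℕ, Integrable (fun P : Grassmannian2 V => Grassmannian2.sec R P ^ k)
        Grassmannian2.volFS ∧
      ((Grassmannian2.volFS : Measure (Grassmannian2 V)).real Set.univ)⁻¹ *
          ∫ P : Grassmannian2 V, Grassmannian2.sec R P ^ k ∂Grassmannian2.volFS =
        negLaplacianPowAtZero k R.momentSeries
          / fallingFactorial ((m : ℝ) + 2 * k - 2) (2 * k)) ∧
    (R.scalarCurvature / (m * (m - 1)) =
      ((Grassmannian2.volFS : Measure (Grassmannian2 V)).real Set.univ)⁻¹ *
        ∫ P : Grassmannian2 V, Grassmannian2.sec R P ∂Grassmannian2.volFS) := by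
  subst hm
  obtain ⟨p⟩ := Stiefel2.exists_of_two_le_finrank hm2
  have hS : 0 < (Stiefel2.volFS : Measure (Stiefel2 V)) Set.univ := Stiefel2.volFS_univ_pos p
  have hS' : (Stiefel2.volFS : Measure (Stiefel2 V)).real Set.univ ≠ 0 :=
    (ENNReal.toReal_pos hS.ne' Stiefel2.volFS_univ_lt_top.ne).ne'
  have hG : 0 < (Grassmannian2.volFS : Measure (Grassmannian2 V)) Set.univ :=
    Grassmannian2.volFS_univ_pos p.toGrassmannian
  have hG' : (Grassmannian2.volFS : Measure (Grassmannian2 V)).real Set.univ ≠ 0 :=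
    (ENNReal.toReal_pos hG.ne' Grassmannian2.volFS_univ_lt_top.ne).ne'
  have hκ : R.scalarCurvature / ((finrank ℝ V : ℝ) * (finrank ℝ V - 1)) =
      negLaplacianPowAtZero 1 R.momentSeries /
        fallingFactorial ((finrank ℝ V : ℝ) + 2 * (1 : ℕ) - 2) (2 * 1) := by
    rw [R.negLaplacianPowAtZero_one, fallingFactorial_eq]
    simp [mul_comm]
  refine ⟨?_, R.analyticAt_momentSeries, ?_, ⟨hS, Stiefel2.volFS_univ_lt_top⟩,
    fun k => ⟨Stiefel2.integrable_sec_pow R k, ?_⟩, ?_, Grassmannian2.sec_toGrassmannian R,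
    ⟨hG, Grassmannian2.volFS_univ_lt_top⟩,
    fun k => ⟨Grassmannian2.integrable_sec_pow R k, ?_⟩, ?_⟩
  · filter_upwards [R.eventually_norm_lt] with X hX using R.summable_momentSeries hX
  · filter_upwards [R.eventually_norm_lt] with X hX using ⟨R.det_pos hX, R.momentSeries_eq hX⟩
  · rw [R.integral_stiefel_sec_pow hm2, inv_mul_cancel_left₀ hS']
  · have h := R.integral_stiefel_sec_pow hm2 1
    simp only [pow_one] at h
    rw [h, inv_mul_cancel_left₀ hS', hκ]
  · rw [R.integral_grassmannian_sec_pow hm2, inv_mul_cancel_left₀ hG']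
  · have h := R.integral_grassmannian_sec_pow hm2 1
    simp only [pow_one] at h
    rw [h, inv_mul_cancel_left₀ hG', hκ]
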